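/- Let $m,n\ge 2$ be integers, $N:=m+n-1\ (\ge 3)$, $\mathbb S^N\subset\mathbb R^{N+1}=\mathbb R^m\times\mathbb R^n$ the unit sphere with its round metric $g$, volume $dV_g$ and Laplace–Beltrami operator $\Delta_g$. Let $G=O(m)\times O(n)$ act on $\mathbb S^N$ by $(x,y)\mapsto(Ax,By)$, and for a space $X$ of real functions on $\mathbb S^N$ let $X^G$ be the subspace of $G$-invariant ones. Put $f(x,y)=|x|^2-|y|^2$, $\alpha:=\frac n2-1$, $\beta:=\frac m2-1$, and for $i\in\mathbb N_0$ let $P_i^{(\alpha,\beta)}$ be the unique monic polynomial satisfying the Jacobi equation $$(1-t^2)x''+[\beta-\alpha-(\alpha+\beta+2)t]x'+i(i+\alpha+\beta+1)x=0,$$ $\Phi_i:=P_i^{(\alpha,\beta)}\circ f$ on $\mathbb S^N$, and $\lambda_i:=2i(N-1+2i)$. For $s\in(0,1)$ let $c_{N,s}:=4^s\pi^{-N/2}\frac{\Gamma(\frac N2+s)}{\Gamma(2-s)}s(1-s)$, $A_{N,s}:=\frac{\Gamma(\frac N2+s)}{\Gamma(\frac N2-s)}$, and for $u\in C^\infty(\mathbb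 S^N)$ let $$\mathscr P_g^su(z):=c_{N,s}\,\mathrm{p.v.}\!\int_{\mathbb S^N}\frac{u(z)-u(\zeta)}{|z-\zeta|^{N+2s}}\,dV_g(\zeta)+A_{N,s}u(z).$$ Let $H^1_g(\mathbb S^N)$ and $H^s_g(\mathbb S^N)$ be the completions of $C^\infty(\mathbb S^N)$ in $L^2_g(\mathbb S^N)$ with respect to the Hilbert norms given by $\|u\|_{H^1_g}^2=\int|\nabla_gu|^2dV_g+\int u^2dV_g$ and $$\|u\|_{H^s_g}^2=\frac{c_{N,s}}2\iint\frac{|u(z)-u(\zeta)|^2}{|z-\zeta|^{N+2s}}\,dV_g(z)\,dV_g(\zeta)+A_{N,s}\int u^2\,dV_g.$$ Then: 1. $(\Phi_i)_{i\in\mathbb N_0}$ is an orthogonal basis of $L^2_g(\mathbb S^N)^G$ and of $H^1_g(\mathbb S^N)^G$. 2. Each $\Phi_i$ is smooth, $G$-invariant, nonzero, and $-\Delta_g\Phi_i=\lambda_i\Phi_i$ on $\mathbb S^N$. The numbers $\lambda_i$ are strictly increasing, they are the only eigenvalues of $-\Delta_g$ that have nonzero $G$-invariant ($C^2$) eigenfunctions,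 and each is simple among $G$-invariant functions: every $G$-invariant $u\in C^2(\mathbb S^N)$ with $-\Delta_gu=\lambda_iu$ is a multiple of $\Phi_i$. 3. For every $s\in(0,1)$ there are a function $\varphi_{N,s}$ and a constant $C>1$, depending only on $N$ and $s$, such that $$C^{-1}(1+\lambda_i^s)\le\varphi_{N,s}(\lambda_i)\le C(1+\lambda_i^s)\qquad\text{for all }i\in\mathbb N_0,$$ and, for all $m,n\ge 2$ with $m+n=N+1$: $\varphi_{N,s}$ is the symbol of $\mathscr P^s_g$, i.e. $\mathscr P_g^su=\varphi_{N,s}(\mu)u$ for every $\mu \in \mathbb R$ and every $u\in C^\infty(\mathbb S^N)$ with $-\Delta_gu=\mu u$; in particular $\mathscr P_g^s\Phi_i=\varphi_{N,s}(\lambda_i)\Phi_i$ on $\mathbb S^N$ for all $i$ (the principal values exist at every point); and $(\Phi_i)_{i\in\mathbb N_0}$ is an orthogonal basis of $H^s_g(\mathbb S^N)^G$. -/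

import Mathlib

open MeasureTheory Filter Topology Polynomial
open scoped ENNReal Manifold ContDiff InnerProductSpace

namespace SphereJacobi

noncomputable section

/-! ### Jacobi polynomials -/

/-- `P` is a monic polynomial solution of the Jacobi equation
`(1 - t²) x'' + [β - α - (α + β + 2) t] x' + i (i + α + β + 1) x = 0`. -/
def IsMonicJacobi (α β : ℝ) (i : ℕ) (P : ℝ[X]) : Prop :=
  P.Monic ∧
    (1 - X ^ 2) * derivative (derivative P)
      + (C (β - α) - C (α + β + 2) * X) * derivative P
      + C ((i : ℝ) * (i + α + β + 1)) * P = 0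

/-- Coefficient of `(X - 1) ^ k` in the monic Jacobi polynomial of degree `i`. -/
def jacobiCoeff (α β : ℝ) (i k : ℕ) : ℝ :=
  ∏ j ∈ Finset.Ico k i,
    (2 * ((j : ℝ) + 1) * (j + 1 + α)) / (((i : ℝ) - j) * (i + j + α + β + 1))

/-- The monic Jacobi polynomial `P_i^{(α, β)}`, expanded in powers of `X - 1`. For `α, β > -1` it
is the unique monic polynomial solving the Jacobi equation, see `isMonicJacobi_iff`. -/
def jacobi (α β : ℝ) (i : ℕ) : ℝ[X] :=
  ∑ k ∈ Finset.range (i + 1), C (jacobiCoeff α β i k) * (X - 1) ^ k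

theorem jacobi_comp (α β : ℝ) (i : ℕ) :
    (jacobi α β i).comp (X + 1) =
      ∑ k ∈ Finset.range (i + 1), C (jacobiCoeff α β i k) * X ^ k := by
  simp [jacobi]

theorem jacobi_comp_coeff (α β : ℝ) (i k : ℕ) :
    ((jacobi α β i).comp (X + 1)).coeff k = if k ≤ i then jacobiCoeff α β i k else 0 := by
  rw [jacobi_comp]
  simp [Polynomial.coeff_C_mul, Polynomial.coeff_X_pow]

theorem ode_iff (α β : ℝ) (i : ℕ) (P : ℝ[X]) :
    (1 - X ^ 2) * derivative (derivative P)
      + (C (β - α) - C (α + β + 2) * X) * derivative P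
      + C ((i : ℝ) * (i + α + β + 1)) * P = 0 ↔
    ∀ k : ℕ, ((i : ℝ) - k) * (i + k + α + β + 1) * (P.comp (X + 1)).coeff k =
      2 * (k + 1) * (k + 1 + α) * (P.comp (X + 1)).coeff (k + 1) := by
  have hinj : ∀ A : ℝ[X], A = 0 ↔ A.comp (X + 1) = 0 := fun A => by
    constructor
    · rintro rfl
      simp
    · intro h
      have h2 : (A.comp (X + 1)).comp (X - 1) = 0 := by rw [h]; simp
      rw [Polynomial.comp_assoc] at h2
      simpa using h2
  set Q := P.comp (X + 1) with hQ
  have h1 : (derivative P).comp (X + 1) = derivative Q := by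
    rw [hQ, Polynomial.derivative_comp]; simp
  have h2 : (derivative (derivative P)).comp (X + 1) = derivative (derivative Q) := by
    rw [← h1, Polynomial.derivative_comp]; simp
  have hC2 : (C (2 : ℝ) : ℝ[X]) = 2 := rfl
  have h22 : (2 : ℝ[X]).comp (X + 1) = 2 := C_comp (a := (2 : ℝ)) (p := X + 1)
  rw [hinj]
  have h3 : ((1 - X ^ 2) * derivative (derivative P)
      + (C (β - α) - C (α + β + 2) * X) * derivative P
      + C ((i : ℝ) * (i + α + β + 1)) * P).comp (X + 1) =
      - (derivative (derivative Q) * X * X) - C 2 * (derivative (derivative Q) * X)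
        - C (2 * (α + 1)) * derivative Q - C (α + β + 2) * (derivative Q * X)
        + C ((i : ℝ) * (i + α + β + 1)) * Q := by
    simp only [add_comp, mul_comp, sub_comp, pow_comp, X_comp, C_comp, one_comp, h1, h2, ← hQ,
      C_add, C_sub, C_mul, C_1, hC2, h22]
    ring
  rw [h3, Polynomial.ext_iff]
  refine forall_congr' fun k => ?_
  rcases k with _ | _ | k
  · simp [-map_mul, -map_add, coeff_derivative]
    constructor <;> intro h <;> linarith
  · simp [-map_mul, -map_add, coeff_C_mul, coeff_derivative, coeff_mul_X]
    constructor <;> intro h <;> linarith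
  · simp [-map_mul, -map_add, coeff_C_mul, coeff_derivative, coeff_mul_X]
    constructor <;> intro h <;> linarith

theorem isMonicJacobi_iff {α β : ℝ} (hα : -1 < α) (hβ : -1 < β) (i : ℕ) (P : ℝ[X]) :
    IsMonicJacobi α β i P ↔ P = jacobi α β i := by
  have hpos : ∀ j : ℕ, j < i → ((i : ℝ) - j) * (i + j + α + β + 1) ≠ 0 := fun j hj => by
    have h1 : (j : ℝ) + 1 ≤ i := by exact_mod_cast hj
    have h2 : (0 : ℝ) ≤ j := Nat.cast_nonneg j
    exact mul_ne_zero (by linarith) (by linarith)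
  have hstep : ∀ k, k < i → ((i : ℝ) - k) * (i + k + α + β + 1) * jacobiCoeff α β i k =
      2 * (k + 1) * (k + 1 + α) * jacobiCoeff α β i (k + 1) := fun k hk => by
    have h : jacobiCoeff α β i k = (2 * ((k : ℝ) + 1) * (k + 1 + α)) /
        (((i : ℝ) - k) * (i + k + α + β + 1)) * jacobiCoeff α β i (k + 1) := by
      rw [jacobiCoeff, Finset.prod_eq_prod_Ico_succ_bot hk]; rfl
    rw [h, ← mul_assoc, mul_div_cancel₀ _ (hpos k hk)]
  have hdeg : (X + 1 : ℝ[X]).natDegree = 1 := natDegree_X_add_C 1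
  have hmon : (X + 1 : ℝ[X]).Monic := monic_X_add_C 1
  have hback : ∀ A B : ℝ[X], A.comp (X + 1) = B.comp (X + 1) → A = B := fun A B h => by
    have h2 : (A.comp (X + 1)).comp (X - 1) = (B.comp (X + 1)).comp (X - 1) := by rw [h]
    rw [Polynomial.comp_assoc, Polynomial.comp_assoc] at h2
    simpa using h2
  rw [IsMonicJacobi, ode_iff]
  constructor
  · rintro ⟨hP, hode⟩
    set Q := P.comp (X + 1) with hQ
    have hQm : Q.Monic := hP.comp hmon (by rw [hdeg]; exact one_ne_zero)
    have hd : Q.natDegree = i := by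
      have h := hode Q.natDegree
      rw [hQm.coeff_natDegree, coeff_eq_zero_of_natDegree_lt (Nat.lt_succ_self _), mul_zero,
        mul_one] at h
      by_contra hne
      rcases mul_eq_zero.mp h with h | h
      · exact hne (by exact_mod_cast (sub_eq_zero.mp h).symm)
      · have : (1 : ℝ) ≤ (i : ℝ) + Q.natDegree := by
          have : 1 ≤ i + Q.natDegree := by omega
          exact_mod_cast this
        linarith
    have hco : ∀ d k, k + d = i → Q.coeff k = jacobiCoeff α β i k := by
      intro d
      induction d with
      | zero =>
        intro k hk
        have hk' : k = i := by omega
        subst hk'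
        rw [jacobiCoeff, Finset.Ico_self, Finset.prod_empty]
        conv_lhs => rw [← hd]
        exact hQm.coeff_natDegree
      | succ d ih =>
        intro k hk
        have hki : k < i := by omega
        refine mul_left_cancel₀ (hpos k hki) ?_
        rw [hode k, hstep k hki, ih (k + 1) (by omega)]
    refine hback _ _ (Polynomial.ext fun k => ?_)
    rw [jacobi_comp_coeff, ← hQ]
    split_ifs with hk
    · exact hco (i - k) k (by omega)
    · exact coeff_eq_zero_of_natDegree_lt (by omega)
  · rintro rfl
    constructor
    · have hle : (jacobi α β i).natDegree ≤ i := by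
        refine natDegree_sum_le_of_forall_le _ _ fun k hk => ?_
        refine (natDegree_C_mul_le _ _).trans (natDegree_pow_le.trans ?_)
        have : (X - 1 : ℝ[X]).natDegree = 1 := natDegree_X_sub_C 1
        rw [this]
        have := Finset.mem_range.mp hk
        omega
      have hc : ((jacobi α β i).comp (X + 1)).Monic := by
        refine monic_of_natDegree_le_of_coeff_eq_one i ?_ ?_
        · rw [natDegree_comp, hdeg, mul_one]
          exact hle
        · rw [jacobi_comp_coeff, if_pos le_rfl, jacobiCoeff, Finset.Ico_self, Finset.prod_empty]
      have hb : jacobi α β i = ((jacobi α β i).comp (X + 1)).comp (X - 1) := by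
        rw [Polynomial.comp_assoc]; simp
      rw [hb]
      exact hc.comp (monic_X_sub_C 1)
        (by rw [show (X - 1 : ℝ[X]).natDegree = 1 from natDegree_X_sub_C 1]; exact one_ne_zero)
    · intro k
      rw [jacobi_comp_coeff, jacobi_comp_coeff]
      rcases lt_trichotomy k i with hk | rfl | hk
      · rw [if_pos hk.le, if_pos (by omega : k + 1 ≤ i), hstep k hk]
      · simp
      · rw [if_neg (by omega), if_neg (by omega)]
        simp

/-! ### The sphere and the group `O(m) × O(n)` -/

/-- `ℝ^{N+1} = ℝ^m × ℝ^n` with the Euclidean norm. -/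
abbrev Ambient (m n : ℕ) : Type := EuclideanSpace ℝ (Fin m ⊕ Fin n)

/-- The unit sphere `𝕊^N` of `ℝ^m × ℝ^n`, where `m + n = N + 1`. -/
abbrev Sph (m n : ℕ) : Type := Metric.sphere (0 : Ambient m n) 1

instance finrankFact (N m n : ℕ) [h : Fact (m + n = N + 1)] :
    Fact (Module.finrank ℝ (Ambient m n) = N + 1) :=
  ⟨by simpa using h.out⟩

/-- The surface measure, i.e. the Riemannian volume of the round metric. -/
def surf (m n : ℕ) : Measure (Sph m n) := (volume : Measure (Ambient m n)).toSphere

/-- The component `x ∈ ℝ^m` of `(x, y)`. -/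
def xPart {m n : ℕ} (z : Ambient m n) : EuclideanSpace ℝ (Fin m) :=
  WithLp.toLp 2 fun i => z (Sum.inl i)

/-- The component `y ∈ ℝ^n` of `(x, y)`. -/
def yPart {m n : ℕ} (z : Ambient m n) : EuclideanSpace ℝ (Fin n) :=
  WithLp.toLp 2 fun j => z (Sum.inr j)

/-- The point `(x, y)`. -/
def pair {m n : ℕ} (x : EuclideanSpace ℝ (Fin m)) (y : EuclideanSpace ℝ (Fin n)) : Ambient m n :=
  WithLp.toLp 2 (Sum.elim (fun i => x i) (fun j => y j))

theorem norm_sq_parts {m n : ℕ} (z : Ambient m n) :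
    ‖z‖ ^ 2 = ‖xPart z‖ ^ 2 + ‖yPart z‖ ^ 2 := by
  simp [EuclideanSpace.norm_sq_eq, Fintype.sum_sum_type, xPart, yPart]

/-- Linear isometries of `ℝ^k`. -/
abbrev O (k : ℕ) : Type := EuclideanSpace ℝ (Fin k) ≃ₗᵢ[ℝ] EuclideanSpace ℝ (Fin k)

/-- The action of `(A, B) ∈ O(m) × O(n)` on the sphere, `(x, y) ↦ (A x, B y)`. -/
def act {m n : ℕ} (A : O m) (B : O n) (z : Sph m n) : Sph m n :=
  ⟨pair (A (xPart (z : Ambient m n))) (B (yPart (z : Ambient m n))), by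
    have hz : ‖(z : Ambient m n)‖ = 1 := by simp
    have h : ‖pair (A (xPart (z : Ambient m n))) (B (yPart (z : Ambient m n)))‖ ^ 2 = 1 := by
      rw [norm_sq_parts]
      change ‖A (xPart (z : Ambient m n))‖ ^ 2 + ‖B (yPart (z : Ambient m n))‖ ^ 2 = 1
      rw [A.norm_map, B.norm_map, ← norm_sq_parts, hz, one_pow]
    rw [mem_sphere_zero_iff_norm]
    nlinarith [norm_nonneg (pair (A (xPart (z : Ambient m n))) (B (yPart (z : Ambient m n))))]⟩

/-- `u` is `G`-invariant, `G = O(m) × O(n)`. -/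
def GInvariant {m n : ℕ} (u : Sph m n → ℝ) : Prop :=
  ∀ (A : O m) (B : O n) (z : Sph m n), u (act A B z) = u z

/-- `G`-invariance of a class of functions modulo equality almost everywhere. -/
def AEGInvariant {m n : ℕ} (u : Sph m n → ℝ) : Prop :=
  ∀ (A : O m) (B : O n), (fun z => u (act A B z)) =ᵐ[surf m n] u

/-- `f (x, y) = |x|² - |y|²`. -/
def f {m n : ℕ} (z : Sph m n) : ℝ :=
  ‖xPart (z : Ambient m n)‖ ^ 2 - ‖yPart (z : Ambient m n)‖ ^ 2

/-- `Φ_i = P_i^{(α, β)} ∘ f` with `α = n / 2 - 1` and `β = m / 2 - 1`. -/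
def Phi (m n i : ℕ) (z : Sph m n) : ℝ :=
  (jacobi ((n : ℝ) / 2 - 1) ((m : ℝ) / 2 - 1) i).eval (f z)

/-- `λ_i = 2 i (N - 1 + 2 i)`. -/
def lam (N i : ℕ) : ℝ := 2 * (i : ℝ) * ((N : ℝ) - 1 + 2 * i)

/-! ### Differential operators on the sphere -/

/-- Extension of `u` to `x ↦ u (x / |x|)`, homogeneous of degree zero (and `0` at the origin). -/
def homExt {m n : ℕ} (u : Sph m n → ℝ) (x : Ambient m n) : ℝ :=
  if h : x = 0 then 0
  else u ⟨‖x‖⁻¹ • x, by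
    rw [mem_sphere_zero_iff_norm, norm_smul, norm_inv, norm_norm,
      inv_mul_cancel₀ (norm_ne_zero_iff.mpr h)]⟩

/-- The Laplace-Beltrami operator `Δ_g`. In polar coordinates the Laplacian of `ℝ^{N+1}` is
`∂_r² + (N / r) ∂_r + r⁻² Δ_g`, so `Δ_g u` is the restriction to the sphere of the Euclidean
Laplacian of the extension of `u` that is constant on rays. -/
def sphLaplacian {m n : ℕ} (u : Sph m n → ℝ) (z : Sph m n) : ℝ :=
  Laplacian.laplacian (homExt u) (z : Ambient m n)

/-- The Riemannian gradient `∇_g u (z)`, a vector tangent to the sphere at `z`, seen in `ℝ^{N+1}`: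
the Euclidean gradient of the extension of `u` that is constant on rays. -/
def sphGradient {m n : ℕ} (u : Sph m n → ℝ) (z : Sph m n) : Ambient m n :=
  gradient (homExt u) (z : Ambient m n)

/-- `u ∈ C^k(𝕊^N)`. -/
def IsCk (N : ℕ) {m n : ℕ} [Fact (m + n = N + 1)] (k : WithTop ℕ∞) (u : Sph m n → ℝ) : Prop :=
  ContMDiff (𝓡 N) 𝓘(ℝ, ℝ) k u

/-- `-Δ_g u = μ u` on the sphere. -/
def LaplaceEigen {m n : ℕ} (μ : ℝ) (u : Sph m n → ℝ) : Prop :=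
  ∀ z, -sphLaplacian u z = μ * u z

/-! ### The conformal fractional Laplacian -/

/-- `c_{N,s}`. -/
def cConst (N : ℕ) (s : ℝ) : ℝ :=
  (4 : ℝ) ^ s * Real.pi ^ (-(N : ℝ) / 2) * (Real.Gamma ((N : ℝ) / 2 + s) / Real.Gamma (2 - s))
    * s * (1 - s)

/-- `A_{N,s}`. -/
def aConst (N : ℕ) (s : ℝ) : ℝ :=
  Real.Gamma ((N : ℝ) / 2 + s) / Real.Gamma ((N : ℝ) / 2 - s)

/-- The conformal fractional Laplacian of `u` at `z` exists and equals `L`: that is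
`L = c_{N,s} p.v. ∫ (u(z) - u(ζ)) / |z - ζ|^{N+2s} dV_g(ζ) + A_{N,s} u(z)`, the principal value
being the limit as `ε → 0⁺` of the integrals over `|z - ζ| > ε`. -/
def HasConfFracLaplacianAt (N : ℕ) {m n : ℕ} (s : ℝ) (u : Sph m n → ℝ) (z : Sph m n) (L : ℝ) :
    Prop :=
  ∃ I : ℝ,
    Tendsto (fun ε : ℝ => ∫ ζ in {ζ : Sph m n | ε < dist z ζ},
        (u z - u ζ) / dist z ζ ^ ((N : ℝ) + 2 * s) ∂surf m n) (𝓝[>] 0) (𝓝 I) ∧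
      L = cConst N s * I + aConst N s * u z

/-! ### Function spaces

`H^1` and `H^s` are the completions of `C^∞(𝕊^N)` for their norms. Each is realized as the closure
of the smooth functions `u` inside a Hilbert space of pairs, `u` being the first component and the
second one being the gradient, respectively the difference `u(z) - u(ζ)`; the norm of the pair is
the norm of the function. The second component is determined by the first one. -/

/-- `L²(𝕊^N)`. -/
abbrev L2 (m n : ℕ) : Type := Lp ℝ 2 (surf m n)

/-- `L²(𝕊^N)^G`. -/
def L2G (m n : ℕ) : Set (L2 m n) := {u | AEGInvariant u}

/-- Pairs `(u, V)` with `‖(u, V)‖² = ∫ u² dV_g + ∫ |V|² dV_g`. -/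
abbrev H1Pair (m n : ℕ) : Type := WithLp 2 (L2 m n × Lp (Ambient m n) 2 (surf m n))

/-- `p` is the pair `(u, ∇_g u)`. -/
def RepresentsH1 {m n : ℕ} (u : Sph m n → ℝ) (p : H1Pair m n) : Prop :=
  p.fst =ᵐ[surf m n] u ∧ p.snd =ᵐ[surf m n] sphGradient u

/-- `H^1(𝕊^N)`, with `‖u‖² = ∫ |∇_g u|² dV_g + ∫ u² dV_g`. -/
def H1 (N m n : ℕ) [Fact (m + n = N + 1)] : Submodule ℝ (H1Pair m n) :=
  (Submodule.span ℝ {p | ∃ u : Sph m n → ℝ, IsCk N ∞ u ∧ RepresentsH1 u p}).topologicalClosure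

/-- `H^1(𝕊^N)^G`. -/
def H1G (N m n : ℕ) [Fact (m + n = N + 1)] : Set (H1Pair m n) :=
  {p | p ∈ H1 N m n ∧ AEGInvariant p.fst}

/-- The measure `(c_{N,s} / 2) |z - ζ|^{-(N+2s)} dV_g(z) dV_g(ζ)` on `𝕊^N × 𝕊^N`. -/
def gagliardo (N m n : ℕ) (s : ℝ) : Measure (Sph m n × Sph m n) :=
  ((surf m n).prod (surf m n)).withDensity fun p =>
    ENNReal.ofReal (cConst N s / 2 / dist p.1 p.2 ^ ((N : ℝ) + 2 * s))

/-- Pairs `(u, D)` with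
`‖(u, D)‖² = A_{N,s} ∫ u² dV_g + (c_{N,s} / 2) ∬ D(z, ζ)² / |z - ζ|^{N+2s} dV_g(z) dV_g(ζ)`. -/
abbrev HsPair (N m n : ℕ) (s : ℝ) : Type :=
  WithLp 2 (Lp ℝ 2 (ENNReal.ofReal (aConst N s) • surf m n) × Lp ℝ 2 (gagliardo N m n s))

/-- `p` is the pair formed by `u` and `(z, ζ) ↦ u(z) - u(ζ)`. -/
def RepresentsHs {N m n : ℕ} {s : ℝ} (u : Sph m n → ℝ) (p : HsPair N m n s) : Prop :=
  p.fst =ᵐ[surf m n] u ∧ p.snd =ᵐ[gagliardo N m n s] fun q => u q.1 - u q.2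

/-- `H^s(𝕊^N)`, with
`‖u‖² = (c_{N,s} / 2) ∬ |u(z) - u(ζ)|² / |z - ζ|^{N+2s} dV_g dV_g + A_{N,s} ∫ u² dV_g`. -/
def Hs (N m n : ℕ) [Fact (m + n = N + 1)] (s : ℝ) : Submodule ℝ (HsPair N m n s) :=
  (Submodule.span ℝ {p | ∃ u : Sph m n → ℝ, IsCk N ∞ u ∧ RepresentsHs u p}).topologicalClosure

/-- `H^s(𝕊^N)^G`. -/
def HsG (N m n : ℕ) [Fact (m + n = N + 1)] (s : ℝ) : Set (HsPair N m n s) :=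
  {p | p ∈ Hs N m n s ∧ AEGInvariant p.fst}

/-- `(e_i)` is an orthogonal basis of the closed subspace `K` of a Hilbert space. -/
def IsOrthogonalBasis {H : Type*} [NormedAddCommGroup H] [InnerProductSpace ℝ H]
    (e : ℕ → H) (K : Set H) : Prop :=
  (∀ i, e i ≠ 0) ∧ (∀ i j, i ≠ j → ⟪e i, e j⟫_ℝ = 0) ∧
    closure (Submodule.span ℝ (Set.range e) : Set H) = K

end

end SphereJacobi

open SphereJacobi

/-! The level function `f` is isoparametric: `|∇f|² = 4 (1 - f²)`, and `Δ f` is affine in `f`. Hence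
`Δ` acts on `p ∘ f` as four times the Jacobi operator acting on `p`, so each `Φ_i` is an
eigenfunction (`laplaceEigen_Phi`). Operators on the sphere are computed in the ambient space on
extensions constant along rays. The divergence theorem applied to such an extension gives Green's
formula (`integral_green`), hence the symmetry of `Δ` and the orthogonality of eigenfunctions with
distinct eigenvalues.

Completeness (`ae_eq_zero_of_integral_mul_Phi`) is proved without averaging over the group. Let `w`
be invariant and orthogonal to all `Φ_i`, hence to every continuous function of `f`. The function
`F(z) = ∫ w(ζ) ⟨z, ζ⟩^k dζ` is invariant, so it is a continuous function of `f` and `∫ w F = 0`.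
Expanding the power shows that `∫ w F` is the sum of the squares of the moments of `w` against the
monomials of degree `k`. All these moments therefore vanish, and Stone–Weierstrass gives `w = 0`.
Completeness and orthogonality together exclude further invariant eigenvalues and give simplicity.

The symbol comes from a Funk–Hecke formula (`funkHecke`) derived from moments. For an eigenfunction
`v` and a point `z`, the numbers `∫ v ⟨z, ·⟩^k` satisfy a two-step recursion (`MomentRec`). Its
solutions vanish unless the eigenvalue is some `l (l + N - 1)`, and then they are fixed by the
`l`-th moment. So `v` and `v(z)` times the normalized zonal Gegenbauer polynomial of degree `l` have
the same integrals against functions of `⟨z, ·⟩`. The same recursion identifies the law of `⟨z, ·⟩`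
as a multiple of `(1 - t²)^(N/2 - 1)`, which depends on `N` alone; that is why one symbol serves all
`m, n`. The two-sided bound rests on `0 ≤ 1 - C_l ≤ 2` and on `1 - C_l(t)` being comparable to `ev N
l * (1 - t)` for `1 - t` of order `1 / ev N l`.

In both Sobolev spaces, pairing with `Φ_i` is a positive multiplier times the `L²` pairing: `1 +
λ_i` by Green's formula, the symbol at `λ_i` by the Funk–Hecke computation. Orthogonality and
totality are thus inherited from `L²`, once a vanishing first component is known to force a
vanishing second one. -/

namespace SphereJacobi

noncomputable section

/-! ### Euclidean Leibniz and chain rules for the gradient and the Laplacian -/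

section Calculus

variable {E : Type*} [NormedAddCommGroup E] [InnerProductSpace ℝ E] [FiniteDimensional ℝ E]

open Laplacian

theorem laplacian_eq_sum_fderiv {ι : Type*} [Fintype ι] (b : OrthonormalBasis ι ℝ E) {F : E → ℝ}
    {x : E} (hF : ContDiffAt ℝ 2 F x) :
    Laplacian.laplacian F x = ∑ i, fderiv ℝ (fun y => fderiv ℝ F y (b i)) x (b i) := by
  rw [InnerProductSpace.laplacian_eq_iteratedFDeriv_orthonormalBasis F b]
  refine Finset.sum_congr rfl fun i _ => ?_
  have h : DifferentiableAt ℝ (fderiv ℝ F) x :=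
    (hF.fderiv_right (m := 1) (by norm_num)).differentiableAt (by norm_num)
  rw [iteratedFDeriv_two_apply, fderiv_clm_apply h (differentiableAt_const _)]
  simp

theorem inner_gradient_left (F : E → ℝ) (x v : E) : ⟪gradient F x, v⟫_ℝ = fderiv ℝ F x v := by
  simp [gradient]

theorem inner_gradient_gradient {ι : Type*} [Fintype ι] (b : OrthonormalBasis ι ℝ E)
    (F G : E → ℝ) (x : E) :
    ⟪gradient F x, gradient G x⟫_ℝ = ∑ i, fderiv ℝ F x (b i) * fderiv ℝ G x (b i) := by
  rw [← b.sum_inner_mul_inner]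
  refine Finset.sum_congr rfl fun i _ => ?_
  rw [inner_gradient_left, real_inner_comm, inner_gradient_left]

theorem laplacian_mul {F G : E → ℝ} {x : E} (hF : ContDiffAt ℝ 2 F x) (hG : ContDiffAt ℝ 2 G x) :
    Laplacian.laplacian (fun y => F y * G y) x =
      F x * Laplacian.laplacian G x + 2 * ⟪gradient F x, gradient G x⟫_ℝ
        + G x * Laplacian.laplacian F x := by
  set b := stdOrthonormalBasis ℝ E
  have hF1 : ∀ᶠ y in 𝓝 x, DifferentiableAt ℝ F y :=
    (hF.eventually (by simp)).mono fun y hy => hy.differentiableAt (by norm_num)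
  have hG1 : ∀ᶠ y in 𝓝 x, DifferentiableAt ℝ G y :=
    (hG.eventually (by simp)).mono fun y hy => hy.differentiableAt (by norm_num)
  have hF2 : ∀ v, DifferentiableAt ℝ (fun y => fderiv ℝ F y v) x := fun v =>
    ((hF.fderiv_right (m := 1) (by norm_num)).differentiableAt (by norm_num)).clm_apply
      (differentiableAt_const _)
  have hG2 : ∀ v, DifferentiableAt ℝ (fun y => fderiv ℝ G y v) x := fun v =>
    ((hG.fderiv_right (m := 1) (by norm_num)).differentiableAt (by norm_num)).clm_apply
      (differentiableAt_const _)
  rw [laplacian_eq_sum_fderiv b (hF.mul hG), laplacian_eq_sum_fderiv b hF,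
    laplacian_eq_sum_fderiv b hG, inner_gradient_gradient b, Finset.mul_sum, Finset.mul_sum,
    Finset.mul_sum, ← Finset.sum_add_distrib, ← Finset.sum_add_distrib]
  refine Finset.sum_congr rfl fun i _ => ?_
  have h : (fun y => fderiv ℝ (fun y => F y * G y) y (b i)) =ᶠ[𝓝 x]
      fun y => F y * fderiv ℝ G y (b i) + G y * fderiv ℝ F y (b i) := by
    filter_upwards [hF1, hG1] with y h1 h2
    rw [fderiv_fun_mul h1 h2]
    simp
  rw [h.fderiv_eq, fderiv_fun_add (hF1.self_of_nhds.fun_mul (hG2 _)) (hG1.self_of_nhds.fun_mul (hF2 _)),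
    fderiv_fun_mul hF1.self_of_nhds (hG2 _), fderiv_fun_mul hG1.self_of_nhds (hF2 _)]
  simp
  ring

theorem laplacian_comp {p : ℝ → ℝ} {F : E → ℝ} {x : E} (hp : ContDiffAt ℝ 2 p (F x))
    (hF : ContDiffAt ℝ 2 F x) :
    Laplacian.laplacian (fun y => p (F y)) x =
      deriv (deriv p) (F x) * ‖gradient F x‖ ^ 2 + deriv p (F x) * Laplacian.laplacian F x := by
  set b := stdOrthonormalBasis ℝ E
  have hF1 : ∀ᶠ y in 𝓝 x, DifferentiableAt ℝ F y :=
    (hF.eventually (by simp)).mono fun y hy => hy.differentiableAt (by norm_num)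
  have hp1 : ∀ᶠ y in 𝓝 x, DifferentiableAt ℝ p (F y) :=
    hF.continuousAt.eventually
      ((hp.eventually (by simp)).mono fun y hy => hy.differentiableAt (by norm_num))
  have hF2 : ∀ v, DifferentiableAt ℝ (fun y => fderiv ℝ F y v) x := fun v =>
    ((hF.fderiv_right (m := 1) (by norm_num)).differentiableAt (by norm_num)).clm_apply
      (differentiableAt_const _)
  have hp2 : DifferentiableAt ℝ (deriv p) (F x) := by
    have : deriv p = fun t => fderiv ℝ p t 1 := by ext; simp
    rw [this]
    exact ((hp.fderiv_right (m := 1) (by norm_num)).differentiableAt (by norm_num)).clm_apply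
      (differentiableAt_const _)
  have hp2' : DifferentiableAt ℝ (fun y => deriv p (F y)) x :=
    hp2.comp x hF1.self_of_nhds
  change Laplacian.laplacian (p ∘ F) x = _
  rw [laplacian_eq_sum_fderiv b (hp.comp x hF), laplacian_eq_sum_fderiv b hF,
    ← real_inner_self_eq_norm_sq, inner_gradient_gradient b, Finset.mul_sum, Finset.mul_sum,
    ← Finset.sum_add_distrib]
  refine Finset.sum_congr rfl fun i _ => ?_
  have h : (fun y => fderiv ℝ (p ∘ F) y (b i)) =ᶠ[𝓝 x]
      fun y => deriv p (F y) * fderiv ℝ F y (b i) := by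
    filter_upwards [hF1, hp1] with y h1 h2
    rw [fderiv_comp y h2 h1]
    simp [fderiv_eq_smul_deriv, mul_comm]
  have h' : fderiv ℝ (fun y => deriv p (F y)) x (b i) = deriv (deriv p) (F x) * fderiv ℝ F x (b i) := by
    rw [show (fun y => deriv p (F y)) = deriv p ∘ F from rfl, fderiv_comp x hp2 hF1.self_of_nhds]
    simp [fderiv_eq_smul_deriv, mul_comm]
  rw [h.fderiv_eq, fderiv_fun_mul hp2' (hF2 _)]
  simp [h']
  ring

theorem gradient_comp {p : ℝ → ℝ} {F : E → ℝ} {x : E} (hp : DifferentiableAt ℝ p (F x))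
    (hF : DifferentiableAt ℝ F x) :
    gradient (fun y => p (F y)) x = deriv p (F x) • gradient F x := by
  refine ext_inner_right ℝ fun v => ?_
  rw [inner_gradient_left, inner_smul_left, inner_gradient_left,
    show (fun y => p (F y)) = p ∘ F from rfl, fderiv_comp x hp hF]
  simp [fderiv_eq_smul_deriv, mul_comm]

theorem gradient_mul {F G : E → ℝ} {x : E} (hF : DifferentiableAt ℝ F x)
    (hG : DifferentiableAt ℝ G x) :
    gradient (fun y => F y * G y) x = F x • gradient G x + G x • gradient F x := by
  refine ext_inner_right ℝ fun v => ?_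
  rw [inner_gradient_left, inner_add_left, inner_smul_left, inner_smul_left, inner_gradient_left,
    inner_gradient_left, fderiv_fun_mul hF hG]
  simp

end Calculus

/-! ### Smoothness of the extension constant on rays -/

section Extension

variable {N m n : ℕ} [Fact (m + n = N + 1)]

/-- The radial projection onto the sphere. -/
def radial {m n : ℕ} (x : Ambient m n) (h : x ≠ 0) : Sph m n :=
  ⟨‖x‖⁻¹ • x, by
    rw [mem_sphere_zero_iff_norm, norm_smul, norm_inv, norm_norm,
      inv_mul_cancel₀ (norm_ne_zero_iff.mpr h)]⟩

theorem homExt_of_ne {m n : ℕ} (u : Sph m n → ℝ) {x : Ambient m n} (h : x ≠ 0) :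
    homExt u x = u (radial x h) := by
  rw [homExt, dif_neg h]; rfl

theorem Sph.ne_zero {m n : ℕ} (z : Sph m n) : (z : Ambient m n) ≠ 0 :=
  ne_zero_of_mem_unit_sphere z

theorem Sph.norm_eq {m n : ℕ} (z : Sph m n) : ‖(z : Ambient m n)‖ = 1 := by simp

@[simp] theorem homExt_coe {m n : ℕ} (u : Sph m n → ℝ) (z : Sph m n) : homExt u z = u z := by
  rw [homExt_of_ne u z.ne_zero]
  congr 1
  ext1
  simp [radial]

theorem homExt_smul {m n : ℕ} (u : Sph m n → ℝ) {c : ℝ} (hc : 0 < c) (x : Ambient m n) :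
    homExt u (c • x) = homExt u x := by
  by_cases h : x = 0
  · simp [h]
  · have h' : c • x ≠ 0 := smul_ne_zero hc.ne' h
    rw [homExt_of_ne u h, homExt_of_ne u h']
    congr 1
    ext1
    simp only [radial, norm_smul, Real.norm_eq_abs, abs_of_pos hc, smul_smul]
    congr 1
    field_simp

/-- Off the origin the extension is `u` after the radial projection, which is smooth as a map into
the sphere. This turns manifold smoothness into Euclidean smoothness, in which all later calculus is
done. -/
theorem IsCk.contDiffAt_homExt {k : WithTop ℕ∞} {u : Sph m n → ℝ} (hu : IsCk N k u)
    {x : Ambient m n} (hx : x ≠ 0) : ContDiffAt ℝ k (homExt u) x := by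
  -- The projection is smooth only off the origin, so it is treated as a map on the open submanifold
  -- `{0}ᶜ`.
  let M : TopologicalSpace.Opens (Ambient m n) := ⟨{0}ᶜ, isOpen_compl_singleton⟩
  have hne : ∀ y : M, (y : Ambient m n) ≠ 0 := fun y => y.2
  have h1 : ContMDiff 𝓘(ℝ, Ambient m n) 𝓘(ℝ, Ambient m n) k
      (fun y : M => ‖(y : Ambient m n)‖⁻¹ • (y : Ambient m n)) := by
    intro y
    have h : ContDiffAt ℝ k (fun y : Ambient m n => ‖y‖⁻¹ • y) y :=
      ((contDiffAt_norm ℝ (hne y)).inv (norm_ne_zero_iff.mpr (hne y))).smul contDiffAt_id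
    exact h.contMDiffAt.comp y (contMDiff_subtype_val y)
  have h2 := h1.codRestrict_sphere (n := N) (fun y => (radial _ (hne y)).2)
  have h3 : ContMDiff 𝓘(ℝ, Ambient m n) 𝓘(ℝ, ℝ) k (fun y : M => homExt u y) := by
    have h4 : (fun y : M => homExt u y) = u ∘ Set.codRestrict _ _ (fun y => (radial _ (hne y)).2) := by
      ext y
      rw [homExt_of_ne u (hne y)]
      rfl
    rw [h4]
    exact ContMDiff.comp hu h2
  have h5 := h3 ⟨x, hx⟩
  exact (contMDiffAt_subtype_iff.mp h5).contDiffAt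

theorem isCk_of_contDiff {k : WithTop ℕ∞} {F : Ambient m n → ℝ} (hF : ContDiff ℝ k F) :
    IsCk N k (fun z : Sph m n => F z) :=
  hF.contMDiff.comp contMDiff_coe_sphere

theorem IsCk.continuous {k : WithTop ℕ∞} {u : Sph m n → ℝ} (hu : IsCk N k u) : Continuous u :=
  ContMDiff.continuous hu

end Extension

/-! ### Homogeneity of the derivatives of the extension -/

section Homogeneous

variable {m n : ℕ} {u : Sph m n → ℝ} {x : Ambient m n}

/-- First derivatives of a function homogeneous of degree 0 have degree -1, second ones degree -2.
Values on the sphere therefore determine them off the origin. No differentiability is required here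
because the chain rule for dilations is unconditional. -/
theorem fderiv_homExt_smul (u : Sph m n → ℝ) {c : ℝ} (hc : 0 < c) (x v : Ambient m n) :
    fderiv ℝ (homExt u) (c • x) v = c⁻¹ * fderiv ℝ (homExt u) x v := by
  have h : (fun y => homExt u (c • y)) = homExt u := funext fun y => homExt_smul u hc y
  have h2 : fderiv ℝ (homExt u) x = c • fderiv ℝ (homExt u) (c • x) := by
    rw [← fderiv_comp_smul, h]
  rw [h2]
  simp only [_root_.smul_apply, smul_eq_mul]
  field_simp

theorem gradient_homExt_smul (u : Sph m n → ℝ) {c : ℝ} (hc : 0 < c) (x : Ambient m n) :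
    gradient (homExt u) (c • x) = c⁻¹ • gradient (homExt u) x := by
  refine ext_inner_right ℝ fun v => ?_
  rw [inner_gradient_left, inner_smul_left, inner_gradient_left, fderiv_homExt_smul u hc]
  simp

theorem laplacian_homExt_smul (u : Sph m n → ℝ) {c : ℝ} (hc : 0 < c) {x : Ambient m n}
    (hx : ContDiffAt ℝ 2 (homExt u) x) (hcx : ContDiffAt ℝ 2 (homExt u) (c • x)) :
    Laplacian.laplacian (homExt u) (c • x) = (c ^ 2)⁻¹ * Laplacian.laplacian (homExt u) x := by
  set b := stdOrthonormalBasis ℝ (Ambient m n)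
  rw [laplacian_eq_sum_fderiv b hx, laplacian_eq_sum_fderiv b hcx, Finset.mul_sum]
  refine Finset.sum_congr rfl fun i _ => ?_
  set G := fun y => fderiv ℝ (homExt u) y (b i) with hG
  have h : (fun y => G (c • y)) = c⁻¹ • G := funext fun y => fderiv_homExt_smul u hc y (b i)
  have hd : DifferentiableAt ℝ G x :=
    ((hx.fderiv_right (m := 1) (by norm_num)).differentiableAt (by norm_num)).clm_apply
      (differentiableAt_const _)
  have h2 : c⁻¹ • fderiv ℝ G x = c • fderiv ℝ G (c • x) := by
    rw [← fderiv_comp_smul, h, fderiv_const_smul hd]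
  have h3 := congrArg (fun L : Ambient m n →L[ℝ] ℝ => L (b i)) h2
  simp only [_root_.smul_apply, smul_eq_mul] at h3
  field_simp at h3 ⊢
  linarith

theorem fderiv_homExt_self (u : Sph m n → ℝ) (x : Ambient m n) : fderiv ℝ (homExt u) x x = 0 := by
  by_cases hd : DifferentiableAt ℝ (homExt u) x
  · have h1 : HasDerivAt (fun t : ℝ => x + t • x) x 0 := by
      simpa using ((hasDerivAt_id (0 : ℝ)).smul_const x).const_add x
    have h2 : HasDerivAt (fun t : ℝ => homExt u (x + t • x)) (fderiv ℝ (homExt u) x x) 0 := by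
      have hd' : HasFDerivAt (homExt u) (fderiv ℝ (homExt u) x) (x + (0 : ℝ) • x) := by
        simpa using hd.hasFDerivAt
      exact hd'.comp_hasDerivAt 0 h1
    have h3 : (fun t : ℝ => homExt u (x + t • x)) =ᶠ[𝓝 0] fun _ => homExt u x := by
      filter_upwards [lt_mem_nhds (show (-1 : ℝ) < 0 by norm_num)] with t ht
      rw [show x + t • x = (1 + t) • x by rw [add_smul, one_smul], homExt_smul u (by linarith)]
    have h4 : HasDerivAt (fun t : ℝ => homExt u (x + t • x)) 0 0 :=
      (hasDerivAt_const (0 : ℝ) (homExt u x)).congr_of_eventuallyEq h3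
    exact h2.unique h4
  -- The default value of `fderiv` at points of non-differentiability already gives zero.
  · rw [fderiv_zero_of_not_differentiableAt hd]; rfl

variable {N : ℕ} [Fact (m + n = N + 1)]

theorem IsCk.laplacian_homExt (hu : IsCk N 2 u) (hx : x ≠ 0) :
    Laplacian.laplacian (homExt u) x = (‖x‖ ^ 2)⁻¹ * sphLaplacian u (radial x hx) := by
  have h : x = ‖x‖ • (radial x hx : Ambient m n) := by
    simp [radial, smul_smul, norm_ne_zero_iff.mpr hx]
  conv_lhs => rw [h]
  rw [laplacian_homExt_smul u (norm_pos_iff.mpr hx) (hu.contDiffAt_homExt (Sph.ne_zero _))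
    (hu.contDiffAt_homExt (by rwa [← h]))]
  rfl

theorem gradient_homExt (hx : x ≠ 0) :
    gradient (homExt u) x = ‖x‖⁻¹ • sphGradient u (radial x hx) := by
  have h : x = ‖x‖ • (radial x hx : Ambient m n) := by
    simp [radial, smul_smul, norm_ne_zero_iff.mpr hx]
  conv_lhs => rw [h]
  rw [gradient_homExt_smul u (norm_pos_iff.mpr hx)]
  rfl

theorem IsCk.continuous_sphGradient {k : WithTop ℕ∞} (hk : 1 ≤ k) (hu : IsCk N k u) :
    Continuous (sphGradient u) := by
  rw [continuous_iff_continuousAt]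
  intro z
  have h : ContinuousAt (fun x => (InnerProductSpace.toDual ℝ (Ambient m n)).symm
      (fderiv ℝ (homExt u) x)) (z : Ambient m n) :=
    (LinearIsometryEquiv.continuous _).continuousAt.comp
      (((hu.contDiffAt_homExt z.ne_zero).fderiv_right (m := 0) (by simpa using hk)).continuousAt)
  exact h.comp continuous_subtype_val.continuousAt

theorem IsCk.continuous_sphLaplacian (hu : IsCk N 2 u) : Continuous (sphLaplacian u) := by
  set b := stdOrthonormalBasis ℝ (Ambient m n)
  rw [continuous_iff_continuousAt]
  intro z
  have h : ContinuousAt (Laplacian.laplacian (homExt u)) (z : Ambient m n) := by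
    have hz := hu.contDiffAt_homExt z.ne_zero
    have he : Laplacian.laplacian (homExt u) =ᶠ[𝓝 (z : Ambient m n)]
        fun x => ∑ i, fderiv ℝ (fun y => fderiv ℝ (homExt u) y (b i)) x (b i) :=
      (hz.eventually (by simp)).mono fun y hy => laplacian_eq_sum_fderiv b hy
    refine ContinuousAt.congr ?_ he.symm
    refine tendsto_finsetSum _ fun i _ => ?_
    have h1 : ContDiffAt ℝ 1 (fun y => fderiv ℝ (homExt u) y (b i)) (z : Ambient m n) :=
      (hz.fderiv_right (m := 1) (by norm_num)).clm_apply contDiffAt_const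
    exact ((h1.fderiv_right (m := 0) (by norm_num)).clm_apply contDiffAt_const).continuousAt
  exact h.comp continuous_subtype_val.continuousAt

end Homogeneous

/-! ### Polar coordinates and Green's formula -/

section Green

variable {N m n : ℕ} [Fact (m + n = N + 1)]

instance : IsFiniteMeasure (surf m n) := by unfold surf; infer_instance

instance : (surf m n).IsOpenPosMeasure := by unfold surf; infer_instance

theorem nontrivial_ambient (N : ℕ) {m n : ℕ} [Fact (m + n = N + 1)] : Nontrivial (Ambient m n) :=
  Module.nontrivial_of_finrank_pos (R := ℝ) (by rw [(finrankFact N m n).out]; omega)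

/-- Integration in polar coordinates. -/
theorem integral_norm_mul_homExt {m n : ℕ} [Nontrivial (Ambient m n)] (b : ℝ → ℝ)
    (g : Sph m n → ℝ) :
    ∫ x : Ambient m n, b ‖x‖ * homExt g x =
      (∫ r : Set.Ioi (0 : ℝ), b r ∂(Measure.volumeIoiPow (Module.finrank ℝ (Ambient m n) - 1))) *
        ∫ z, g z ∂surf m n := by
  calc ∫ x : Ambient m n, b ‖x‖ * homExt g x
      = ∫ x : ({(0)}ᶜ : Set (Ambient m n)), b ‖(x : Ambient m n)‖ * homExt g x
          ∂((volume : Measure (Ambient m n)).comap Subtype.val) := by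
        rw [integral_subtype_comap (measurableSet_singleton _).compl
            fun x : Ambient m n ↦ b ‖x‖ * homExt g x, restrict_compl_singleton]
    _ = ∫ p : Sph m n × Set.Ioi (0 : ℝ), b (p.2 : ℝ) * g p.1 ∂(surf m n).prod
          (.volumeIoiPow (Module.finrank ℝ (Ambient m n) - 1)) := by
        rw [surf, ← (volume : Measure
          (Ambient m n)).measurePreserving_homeomorphUnitSphereProd.integral_comp
          (Homeomorph.measurableEmbedding _)]
        refine integral_congr_ae (Eventually.of_forall fun x => ?_)
        simp only [homeomorphUnitSphereProd_apply_snd_coe]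
        rw [homExt_of_ne g x.2]
        congr 2
        ext1
        simp [radial]
    _ = _ := by
        rw [mul_comm, ← integral_prod_mul]
        simp_rw [mul_comm]

/-- Integration by parts against the constant 1, with integrability supplied by the compact support.
-/
theorem integral_fderiv_eq_zero {E : Type*} [NormedAddCommGroup E] [NormedSpace ℝ E]
    [FiniteDimensional ℝ E] [MeasurableSpace E] [BorelSpace E] (μ : Measure E) [μ.IsAddHaarMeasure]
    {W : E → ℝ} (hW : ContDiff ℝ 1 W) (hc : HasCompactSupport W) (v : E) :
    ∫ x, fderiv ℝ W x v ∂μ = 0 := by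
  have h1 : Integrable (fun x => fderiv ℝ W x v) μ := by
    refine Continuous.integrable_of_hasCompactSupport
      ((hW.continuous_fderiv (by norm_num)).clm_apply continuous_const) ?_
    exact hc.fderiv_apply (𝕜 := ℝ) v
  have h2 : Integrable W μ := hW.continuous.integrable_of_hasCompactSupport hc
  have h := integral_mul_fderiv_eq_neg_fderiv_mul_of_integrable (μ := μ) (f := fun _ => (1 : ℝ))
    (g := W) (v := v) (by simp) (by simpa using h1) (by simpa using h2)
    (fun x _ => differentiableAt_const _)
    (fun x _ => (hW.differentiable (by norm_num)) x)
  simpa using h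

/-- A radial cutoff function. -/
def cutoff : ContDiffBump (2 : ℝ) := ⟨1 / 2, 1, by norm_num, by norm_num⟩

/-- The bump is evaluated at `‖x‖²`. Centred at 2 with outer radius 1, it vanishes near the origin,
where the extensions are singular, and also outside a ball. -/
theorem cutoff_eventually {t : ℝ} (ht : t < 1) : (fun x => cutoff x) =ᶠ[𝓝 t] 0 := by
  filter_upwards [gt_mem_nhds ht] with y hy
  refine cutoff.zero_of_le_dist ?_
  rw [Real.dist_eq, abs_of_nonpos (by linarith)]
  change 1 ≤ _
  linarith

theorem cutoff_eq_zero {t : ℝ} (ht : 3 ≤ t) : cutoff t = 0 := by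
  refine cutoff.zero_of_le_dist ?_
  rw [Real.dist_eq, abs_of_nonneg (by linarith)]
  change 1 ≤ _
  linarith

theorem hasCompactSupport_of_cutoff {E : Type*} [NormedAddCommGroup E] [NormedSpace ℝ E]
    [FiniteDimensional ℝ E] {F : E → ℝ} (hF : ∀ x : E, cutoff (‖x‖ ^ 2) = 0 → F x = 0) :
    HasCompactSupport F := by
  have := FiniteDimensional.proper ℝ E
  refine HasCompactSupport.intro (isCompact_closedBall (0 : E) 2) fun x hx => hF x ?_
  rw [mem_closedBall_zero_iff, not_le] at hx
  exact cutoff_eq_zero (by nlinarith)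

theorem cutoff_norm_eventually {E : Type*} [NormedAddCommGroup E] :
    (fun x : E => cutoff (‖x‖ ^ 2)) =ᶠ[𝓝 0] 0 := by
  have h : Tendsto (fun x : E => ‖x‖ ^ 2) (𝓝 0) (𝓝 0) := by
    have : Continuous fun x : E => ‖x‖ ^ 2 := by fun_prop
    simpa using this.tendsto 0
  exact h.eventually (cutoff_eventually (by norm_num))

/-- **Green's formula** on the sphere. -/
theorem integral_green {u v : Sph m n → ℝ} (hu : IsCk N 2 u) (hv : IsCk N 2 v) :
    ∫ z, (⟪sphGradient u z, sphGradient v z⟫_ℝ + u z * sphLaplacian v z) ∂surf m n = 0 := by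
  have := nontrivial_ambient N (m := m) (n := n)
  set b := stdOrthonormalBasis ℝ (Ambient m n)
  set U := homExt u with hU
  set V := homExt v with hV
  set ψ : Ambient m n → ℝ := fun x => cutoff (‖x‖ ^ 2) with hψ
  have hψC : ContDiff ℝ 2 ψ := cutoff.contDiff.comp (contDiff_norm_sq ℝ)
  -- The components of the vector field `ψ U ∇V`, whose divergence integrates to zero.
  let W : Fin (Module.finrank ℝ (Ambient m n)) → Ambient m n → ℝ :=
    fun i x => ψ x * (U x * fderiv ℝ V x (b i))
  have hW0 : ∀ i, W i =ᶠ[𝓝 0] 0 := fun i => by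
    filter_upwards [cutoff_norm_eventually (E := Ambient m n)] with x hx
    simp only [W, hψ, hx, Pi.zero_apply, zero_mul]
  have hVd : ∀ i, ∀ x : Ambient m n, x ≠ 0 → ContDiffAt ℝ 1 (fun x => fderiv ℝ V x (b i)) x :=
    fun i x hx => ((hv.contDiffAt_homExt hx).fderiv_right (m := 1) (by norm_num)).clm_apply
      contDiffAt_const
  have hWC : ∀ i, ContDiff ℝ 1 (W i) := fun i => by
    rw [contDiff_iff_contDiffAt]
    intro x
    by_cases hx : x = 0
    · subst hx
      exact (contDiffAt_const (c := (0 : ℝ))).congr_of_eventuallyEq (hW0 i)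
    · exact (hψC.contDiffAt.of_le (by norm_num)).mul
        (((hu.contDiffAt_homExt hx).of_le (by norm_num)).mul (hVd i x hx))
  have hWc : ∀ i, HasCompactSupport (W i) := fun i =>
    hasCompactSupport_of_cutoff fun x hx => by simp only [W, hψ, hx, zero_mul]
  have hint : ∫ x, ∑ i, fderiv ℝ (W i) x (b i) = 0 := by
    rw [integral_finsetSum]
    · exact Finset.sum_eq_zero fun i _ => integral_fderiv_eq_zero _ (hWC i) (hWc i) _
    · exact fun i _ => Continuous.integrable_of_hasCompactSupport
        (((hWC i).continuous_fderiv (by norm_num)).clm_apply continuous_const)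
        ((hWc i).fderiv_apply (𝕜 := ℝ) _)
  have hgrad : ∀ x : Ambient m n, gradient ψ x = (deriv cutoff (‖x‖ ^ 2) * 2) • x := fun x => by
    refine ext_inner_right ℝ fun y => ?_
    rw [inner_gradient_left]
    have h1 : HasFDerivAt (fun x : Ambient m n => ‖x‖ ^ 2) (2 • innerSL ℝ x) x :=
      (hasStrictFDerivAt_norm_sq x).hasFDerivAt
    have h2 : HasDerivAt cutoff (deriv cutoff (‖x‖ ^ 2)) (‖x‖ ^ 2) :=
      ((cutoff.contDiff (n := 1)).differentiable (by norm_num) _).hasDerivAt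
    have hcomp : ∀ (c : ℝ → ℝ) (d : ℝ), HasDerivAt c d (‖x‖ ^ 2) →
        HasFDerivAt (fun x : Ambient m n => c (‖x‖ ^ 2)) (d • (2 • innerSL ℝ x)) x :=
      fun c d hc => hc.comp_hasFDerivAt x h1
    have h3 : HasFDerivAt ψ (deriv cutoff (‖x‖ ^ 2) • (2 • innerSL ℝ x)) x := hcomp _ _ h2
    rw [h3.fderiv]
    simp [inner_smul_left]
    ring
  -- The gradient of the cutoff is radial and `∇V` is orthogonal to the radius, so the cutoff is not
  -- felt by the divergence. The remaining terms are homogeneous of degree -2 up to the factor `ψ`,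
  -- which separates the radial variable from the spherical one.
  have hdiv : ∀ x : Ambient m n, ∑ i, fderiv ℝ (W i) x (b i) = (cutoff (‖x‖ ^ 2) * (‖x‖ ^ 2)⁻¹) *
      homExt (fun z => ⟪sphGradient u z, sphGradient v z⟫_ℝ + u z * sphLaplacian v z) x := by
    intro x
    by_cases hx : x = 0
    · subst hx
      have : ∀ i, fderiv ℝ (W i) 0 = 0 := fun i => by
        rw [(hW0 i).fderiv_eq]
        simp
      simp [this]
    · have hUx := hu.contDiffAt_homExt hx
      have hVx := hv.contDiffAt_homExt hx
      have h1 : ∀ i, fderiv ℝ (W i) x (b i) =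
          ψ x * (fderiv ℝ U x (b i) * fderiv ℝ V x (b i))
          + ψ x * U x * fderiv ℝ (fun y => fderiv ℝ V y (b i)) x (b i)
          + U x * (fderiv ℝ ψ x (b i) * fderiv ℝ V x (b i)) := fun i => by
        have hd1 : DifferentiableAt ℝ ψ x := hψC.differentiable (by norm_num) x
        have hd2 : DifferentiableAt ℝ U x := hUx.differentiableAt (by norm_num)
        have hd3 := (hVd i x hx).differentiableAt (by norm_num)
        simp only [W]
        rw [fderiv_fun_mul hd1 (hd2.fun_mul hd3), fderiv_fun_mul hd2 hd3]
        simp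
        ring
      simp_rw [h1]
      rw [Finset.sum_add_distrib, Finset.sum_add_distrib, ← Finset.mul_sum, ← Finset.mul_sum,
        ← Finset.mul_sum, ← inner_gradient_gradient b, ← inner_gradient_gradient b,
        ← laplacian_eq_sum_fderiv b hVx, hgrad, inner_smul_left, real_inner_comm (gradient V x) x,
        inner_gradient_left V, fderiv_homExt_self, hv.laplacian_homExt hx, gradient_homExt hx,
        gradient_homExt hx, homExt_of_ne _ hx, inner_smul_left, inner_smul_right, hU,
        homExt_of_ne _ hx]
      simp only [hψ, conj_trivial, mul_zero, add_zero]
      field_simp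
  simp_rw [hdiv] at hint
  set B : ℝ → ℝ := fun r => cutoff (r ^ 2) * (r ^ 2)⁻¹ with hB
  have hpol := integral_norm_mul_homExt (m := m) (n := n) B
  have hpos : 0 < ∫ x : Ambient m n, B ‖x‖ := by
    refine Continuous.integral_pos_of_hasCompactSupport_nonneg_nonzero ?_ ?_ ?_
      -- A point with `‖x‖² = 2`, the centre of the bump.
      (x := (Real.sqrt 2) • b ⟨0, Module.finrank_pos⟩) ?_
    · rw [continuous_iff_continuousAt]
      intro x
      by_cases hx : x = 0
      · subst hx
        refine (continuousAt_const (y := (0 : ℝ))).congr ?_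
        filter_upwards [cutoff_norm_eventually (E := Ambient m n)] with x hx
        simp only [hB, hx, Pi.zero_apply, zero_mul]
      · exact (cutoff.continuous.comp (continuous_norm.pow 2)).continuousAt.mul
          ((continuous_norm.pow 2).continuousAt.inv₀ (by simpa using hx))
    · exact hasCompactSupport_of_cutoff fun x hx => by simp only [hB, hx, zero_mul]
    · exact fun x => mul_nonneg cutoff.nonneg (by positivity)
    · have h2 : ‖(Real.sqrt 2) • b ⟨0, Module.finrank_pos⟩‖ ^ 2 = 2 := by
        rw [norm_smul, b.norm_eq_one]
        simp
      simp only [hB, h2]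
      have : cutoff 2 = 1 := cutoff.one_of_mem_closedBall (by simp [cutoff])
      rw [this]
      norm_num
  -- The constant function 1 shows that the radial factor is nonzero; the Green integrand then has
  -- to integrate to zero.
  have h1 := hpol 1
  have hae : ∫ x : Ambient m n, B ‖x‖ * homExt 1 x = ∫ x : Ambient m n, B ‖x‖ := by
    refine integral_congr_ae ?_
    have : ∀ᵐ x : Ambient m n, x ≠ 0 := by simp [ae_iff]
    filter_upwards [this] with x hx
    rw [homExt_of_ne _ hx]
    simp
  rw [hae] at h1
  have h2 := hpol (fun z => ⟪sphGradient u z, sphGradient v z⟫_ℝ + u z * sphLaplacian v z)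
  rw [hint] at h2
  refine (mul_eq_zero.mp h2.symm).resolve_left fun h0 => ?_
  rw [h0, zero_mul] at h1
  exact hpos.ne' h1

theorem integrable_surf_of_continuous {m n : ℕ} {g : Sph m n → ℝ} (hg : Continuous g) :
    Integrable g (surf m n) :=
  hg.integrable_of_hasCompactSupport (HasCompactSupport.of_compactSpace g)

theorem integral_inner_sphGradient {u v : Sph m n → ℝ} (hu : IsCk N 2 u) (hv : IsCk N 2 v) :
    ∫ z, ⟪sphGradient u z, sphGradient v z⟫_ℝ ∂surf m n = -∫ z, u z * sphLaplacian v z ∂surf m n := by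
  have h := integral_green hu hv
  rw [integral_add] at h
  · linarith
  · exact integrable_surf_of_continuous ((hu.continuous_sphGradient (by norm_num)).inner
      (hv.continuous_sphGradient (by norm_num)))
  · exact integrable_surf_of_continuous (hu.continuous.mul hv.continuous_sphLaplacian)

theorem integral_mul_sphLaplacian_comm {u v : Sph m n → ℝ} (hu : IsCk N 2 u) (hv : IsCk N 2 v) :
    ∫ z, u z * sphLaplacian v z ∂surf m n = ∫ z, v z * sphLaplacian u z ∂surf m n := by
  have h1 := integral_inner_sphGradient hu hv
  have h2 := integral_inner_sphGradient hv hu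
  have h3 : ∫ z, ⟪sphGradient u z, sphGradient v z⟫_ℝ ∂surf m n =
    ∫ z, ⟪sphGradient v z, sphGradient u z⟫_ℝ ∂surf m n :=
    integral_congr_ae (Eventually.of_forall fun z => real_inner_comm _ _)
  linarith

end Green

/-! ### Diagonal quadratic forms -/

section Quadratic

variable {ι : Type*} [Fintype ι]

/-- A diagonal quadratic form. -/
def quad (s : ι → ℝ) (x : EuclideanSpace ℝ ι) : ℝ := ∑ k, s k * x k ^ 2

theorem quad_one (x : EuclideanSpace ℝ ι) : quad (fun _ => 1) x = ‖x‖ ^ 2 := by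
  simp [quad, EuclideanSpace.norm_sq_eq]

theorem contDiff_quad {k : WithTop ℕ∞} (s : ι → ℝ) : ContDiff ℝ k (quad s) := by
  unfold quad
  refine ContDiff.sum fun i _ => contDiff_const.mul (ContDiff.pow ?_ 2)
  exact (EuclideanSpace.proj i : EuclideanSpace ℝ ι →L[ℝ] ℝ).contDiff

theorem fderiv_quad (s : ι → ℝ) (x v : EuclideanSpace ℝ ι) :
    fderiv ℝ (quad s) x v = ∑ k, 2 * s k * x k * v k := by
  have h : HasFDerivAt (quad s)
      (∑ k, s k • ((2 * x k) • (EuclideanSpace.proj k : EuclideanSpace ℝ ι →L[ℝ] ℝ))) x := by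
    unfold quad
    refine HasFDerivAt.fun_sum fun k _ => HasFDerivAt.const_mul ?_ _
    have := (EuclideanSpace.proj k : EuclideanSpace ℝ ι →L[ℝ] ℝ).hasFDerivAt (x := x)
    simpa using this.pow 2
  rw [h.fderiv]
  simp only [_root_.sum_apply, _root_.smul_apply, smul_eq_mul]
  refine Finset.sum_congr rfl fun k _ => ?_
  simp
  ring

theorem gradient_quad (s : ι → ℝ) (x : EuclideanSpace ℝ ι) :
    gradient (quad s) x = WithLp.toLp 2 fun k => 2 * s k * x k := by
  refine ext_inner_right ℝ fun v => ?_
  rw [inner_gradient_left, fderiv_quad, PiLp.inner_apply]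
  refine Finset.sum_congr rfl fun k _ => ?_
  simp
  ring

theorem laplacian_quad (s : ι → ℝ) (x : EuclideanSpace ℝ ι) :
    Laplacian.laplacian (quad s) x = 2 * ∑ k, s k := by
  classical
  rw [laplacian_eq_sum_fderiv (EuclideanSpace.basisFun ι ℝ) (contDiff_quad s).contDiffAt,
    Finset.mul_sum]
  refine Finset.sum_congr rfl fun k _ => ?_
  have h : (fun y => fderiv ℝ (quad s) y (EuclideanSpace.basisFun ι ℝ k)) =
      fun y => ((2 * s k) • (EuclideanSpace.proj k : EuclideanSpace ℝ ι →L[ℝ] ℝ)) y := by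
    ext y
    rw [fderiv_quad, Finset.sum_eq_single k]
    · simp
    · intro j _ hj
      simp [hj]
    · simp
  rw [h, ContinuousLinearMap.fderiv]
  simp

end Quadratic

/-! ### Restrictions of homogeneous functions; Jacobi and Gegenbauer operators -/

section Restriction

variable {N m n : ℕ} [Fact (m + n = N + 1)]

/-- Euler's identity, by differentiating along the ray `t ↦ t • x` at `t = 1`. -/
theorem fderiv_self_of_homogeneous {E : Type*} [NormedAddCommGroup E] [NormedSpace ℝ E]
    {q : E → ℝ} {d : ℕ} (hq : ∀ c : ℝ, 0 < c → ∀ x, q (c • x) = c ^ d * q x) {x : E}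
    (hd : DifferentiableAt ℝ q x) : fderiv ℝ q x x = d * q x := by
  have h1 : HasDerivAt (fun t : ℝ => t • x) x 1 := by
    simpa using (hasDerivAt_id (1 : ℝ)).smul_const x
  have h2 : HasDerivAt (fun t : ℝ => q (t • x)) (fderiv ℝ q x x) 1 := by
    have hd' : HasFDerivAt q (fderiv ℝ q x) ((1 : ℝ) • x) := by simpa using hd.hasFDerivAt
    exact hd'.comp_hasDerivAt 1 h1
  have h3 : (fun t : ℝ => q (t • x)) =ᶠ[𝓝 1] fun t => t ^ d * q x := by
    filter_upwards [lt_mem_nhds (show (0 : ℝ) < 1 by norm_num)] with t ht using hq t ht x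
  have h4 : HasDerivAt (fun t : ℝ => t ^ d * q x) (d * q x) 1 := by
    simpa using (hasDerivAt_pow d (1 : ℝ)).mul_const (q x)
  exact h2.unique (h4.congr_of_eventuallyEq h3)

/-- The function `|x| ^ (-d)`. -/
def normPow (d : ℕ) {m n : ℕ} (x : Ambient m n) : ℝ := (quad (fun _ => 1) x) ^ (-(d : ℝ) / 2)

theorem deriv_rpow_at_one (p : ℝ) :
    deriv (fun t : ℝ => t ^ p) 1 = p ∧ deriv (deriv fun t : ℝ => t ^ p) 1 = p * (p - 1) := by
  have h : ∀ᶠ t in 𝓝 (1 : ℝ), deriv (fun t : ℝ => t ^ p) t = p * t ^ (p - 1) := by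
    filter_upwards [lt_mem_nhds (show (0 : ℝ) < 1 by norm_num)] with t ht
    exact Real.deriv_rpow_const t p
  refine ⟨by rw [h.self_of_nhds]; simp, ?_⟩
  rw [Filter.EventuallyEq.deriv_eq h, deriv_const_mul _ (by
    exact (Real.hasDerivAt_rpow_const (Or.inl one_ne_zero)).differentiableAt),
    Real.deriv_rpow_const]
  simp

/-- Multiplying by `|x|^(-d)` makes a function of degree `d` constant on rays. Spherical derivatives
of a restriction then follow from the Leibniz rule. -/
theorem homExt_eventuallyEq {q : Ambient m n → ℝ} {d : ℕ}
    (hq : ∀ c : ℝ, 0 < c → ∀ x, q (c • x) = c ^ d * q x) {x : Ambient m n} (hx : x ≠ 0) :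
    homExt (fun z : Sph m n => q z) =ᶠ[𝓝 x] fun y => normPow d y * q y := by
  filter_upwards [isOpen_ne.mem_nhds hx] with y hy
  have hy' := norm_pos_iff.mpr hy
  rw [homExt_of_ne _ hy, radial, hq _ (inv_pos.mpr hy'), normPow, quad_one]
  congr 1
  rw [← Real.rpow_natCast, ← Real.rpow_natCast, ← Real.rpow_mul hy'.le, ← Real.rpow_neg_one,
    ← Real.rpow_mul hy'.le]
  congr 1
  push_cast
  ring

variable {q : Ambient m n → ℝ} {d : ℕ}

theorem contDiffAt_normPow (z : Sph m n) : ContDiffAt ℝ 2 (normPow d) (z : Ambient m n) := by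
  unfold normPow
  refine (contDiff_quad _).contDiffAt.rpow_const_of_ne ?_
  rw [quad_one]
  simp

theorem gradient_normPow (z : Sph m n) :
    gradient (normPow d) (z : Ambient m n) = (-(d : ℝ)) • (z : Ambient m n) := by
  have h1 : quad (fun _ => 1) (z : Ambient m n) = 1 := by rw [quad_one]; simp
  have := gradient_comp (p := fun t : ℝ => t ^ (-(d : ℝ) / 2)) (F := quad fun _ => 1)
    (x := (z : Ambient m n)) (by
      rw [h1]; exact (Real.hasDerivAt_rpow_const (Or.inl one_ne_zero)).differentiableAt)
    ((contDiff_quad (k := 1) _).differentiable (by norm_num) _)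
  rw [h1, (deriv_rpow_at_one _).1, gradient_quad] at this
  change gradient (fun y : Ambient m n => quad (fun _ => 1) y ^ (-(d : ℝ) / 2)) (z : Ambient m n) = _
  rw [this]
  ext k
  simp
  ring

theorem laplacian_normPow (z : Sph m n) :
    Laplacian.laplacian (normPow d) (z : Ambient m n) = d * (d + 1 - N) := by
  have h1 : quad (fun _ => 1) (z : Ambient m n) = 1 := by rw [quad_one]; simp
  have := laplacian_comp (p := fun t : ℝ => t ^ (-(d : ℝ) / 2)) (F := quad fun _ => 1)
    (x := (z : Ambient m n)) (by
      rw [h1]; exact contDiffAt_id.rpow_const_of_ne one_ne_zero) (contDiff_quad _).contDiffAt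
  rw [h1, (deriv_rpow_at_one _).1, (deriv_rpow_at_one _).2, gradient_quad, laplacian_quad] at this
  change Laplacian.laplacian (fun y : Ambient m n => quad (fun _ => 1) y ^ (-(d : ℝ) / 2)) (z : Ambient m n) = _
  rw [this]
  have h2 : (WithLp.toLp 2 fun k => 2 * 1 * (z : Ambient m n) k : Ambient m n) =
      (2 : ℝ) • (z : Ambient m n) := by ext k; simp
  have h3 : (m : ℝ) + n = N + 1 := by exact_mod_cast (Fact.out : m + n = N + 1)
  rw [h2, norm_smul, z.norm_eq]
  simp [h3]
  ring

theorem sphGradient_of_homogeneous (hq : ∀ c : ℝ, 0 < c → ∀ x, q (c • x) = c ^ d * q x)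
    (hC : ContDiff ℝ 2 q) (z : Sph m n) :
    sphGradient (fun z : Sph m n => q z) z =
      gradient q (z : Ambient m n) - (d * q z) • (z : Ambient m n) := by
  have h1 : normPow d (z : Ambient m n) = 1 := by rw [normPow, quad_one]; simp
  rw [sphGradient, gradient, (homExt_eventuallyEq hq z.ne_zero).fderiv_eq, ← gradient,
    gradient_mul ((contDiffAt_normPow z).differentiableAt (by norm_num))
      (hC.differentiable (by norm_num) _), gradient_normPow, h1, smul_smul]
  module

/-- In the Leibniz rule for `|x|^(-d) q`, Euler's identity turns the cross term into `-2 d² q`,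
while the Laplacian of `|x|^(-d)` contributes `d (d + 1 - N) q`. -/
theorem sphLaplacian_of_homogeneous (hq : ∀ c : ℝ, 0 < c → ∀ x, q (c • x) = c ^ d * q x)
    (hC : ContDiff ℝ 2 q) (z : Sph m n) :
    sphLaplacian (fun z : Sph m n => q z) z =
      Laplacian.laplacian q (z : Ambient m n) - d * (d + N - 1) * q z := by
  have h1 : normPow d (z : Ambient m n) = 1 := by rw [normPow, quad_one]; simp
  rw [sphLaplacian, (InnerProductSpace.laplacian_congr_nhds (homExt_eventuallyEq hq z.ne_zero)).eq_of_nhds,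
    laplacian_mul (contDiffAt_normPow z) hC.contDiffAt, gradient_normPow, h1, inner_smul_left,
    real_inner_comm, inner_gradient_left,
    fderiv_self_of_homogeneous hq (hC.differentiable (by norm_num) _), laplacian_normPow (N := N)]
  simp
  ring

theorem sphLaplacian_comp {h : Sph m n → ℝ} (hh : IsCk N 2 h) {p : ℝ → ℝ} (hp : ContDiff ℝ 2 p)
    (z : Sph m n) :
    sphLaplacian (fun z => p (h z)) z =
      deriv (deriv p) (h z) * ‖sphGradient h z‖ ^ 2 + deriv p (h z) * sphLaplacian h z := by
  have he : homExt (fun z => p (h z)) =ᶠ[𝓝 (z : Ambient m n)] fun y => p (homExt h y) := by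
    filter_upwards [isOpen_ne.mem_nhds z.ne_zero] with y hy
    rw [homExt_of_ne _ hy, homExt_of_ne _ hy]
  rw [sphLaplacian, (InnerProductSpace.laplacian_congr_nhds he).eq_of_nhds, laplacian_comp hp.contDiffAt
    (hh.contDiffAt_homExt z.ne_zero), homExt_coe]
  rfl

/-- The zonal function `ζ ↦ ⟨z, ζ⟩`. -/
def zonal (z ζ : Sph m n) : ℝ := ⟪(z : Ambient m n), (ζ : Ambient m n)⟫_ℝ

theorem isCk_zonal {k : WithTop ℕ∞} (z : Sph m n) : IsCk N k (zonal z) :=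
  isCk_of_contDiff (F := fun x : Ambient m n => ⟪(z : Ambient m n), x⟫_ℝ)
    (contDiff_const.inner ℝ contDiff_id)

theorem zonal_self (z : Sph m n) : zonal z z = 1 := by
  rw [zonal, real_inner_self_eq_norm_sq, z.norm_eq, one_pow]

theorem gradient_inner {E : Type*} [NormedAddCommGroup E] [InnerProductSpace ℝ E]
    [FiniteDimensional ℝ E] (z x : E) : gradient (fun y => ⟪z, y⟫_ℝ) x = z := by
  refine ext_inner_right ℝ fun v => ?_
  rw [inner_gradient_left]
  change fderiv ℝ (fun y => innerSL ℝ z y) x v = _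
  rw [ContinuousLinearMap.fderiv]
  rfl

theorem laplacian_inner {E : Type*} [NormedAddCommGroup E] [InnerProductSpace ℝ E]
    [FiniteDimensional ℝ E] (z x : E) : Laplacian.laplacian (fun y => ⟪z, y⟫_ℝ) x = 0 := by
  have hC : ContDiff ℝ 2 fun y : E => ⟪z, y⟫_ℝ := contDiff_const.inner ℝ contDiff_id
  rw [laplacian_eq_sum_fderiv (stdOrthonormalBasis ℝ E) hC.contDiffAt]
  refine Finset.sum_eq_zero fun i _ => ?_
  have : (fun y => fderiv ℝ (fun y => ⟪z, y⟫_ℝ) y (stdOrthonormalBasis ℝ E i)) =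
      fun _ => ⟪z, stdOrthonormalBasis ℝ E i⟫_ℝ := by
    ext y
    rw [← inner_gradient_left, gradient_inner]
  rw [this]
  simp

theorem norm_sphGradient_zonal (z ζ : Sph m n) : ‖sphGradient (zonal z) ζ‖ ^ 2 = 1 - zonal z ζ ^ 2 := by
  have h := sphGradient_of_homogeneous (q := fun x : Ambient m n => ⟪(z : Ambient m n), x⟫_ℝ)
    (d := 1) (fun c _ x => by simp [inner_smul_right]) (contDiff_const.inner ℝ contDiff_id) ζ
  change ‖sphGradient (fun ζ : Sph m n => ⟪(z : Ambient m n), (ζ : Ambient m n)⟫_ℝ) ζ‖ ^ 2 = _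
  rw [h, gradient_inner, norm_sub_sq_real, norm_smul, inner_smul_right, z.norm_eq, ζ.norm_eq]
  simp [zonal]
  ring

theorem sphLaplacian_zonal (z ζ : Sph m n) : sphLaplacian (zonal z) ζ = -N * zonal z ζ := by
  have h := sphLaplacian_of_homogeneous (N := N)
    (q := fun x : Ambient m n => ⟪(z : Ambient m n), x⟫_ℝ)
    (d := 1) (fun c _ x => by simp [inner_smul_right]) (contDiff_const.inner ℝ contDiff_id) ζ
  change sphLaplacian (fun ζ : Sph m n => ⟪(z : Ambient m n), (ζ : Ambient m n)⟫_ℝ) ζ = _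
  rw [h, laplacian_inner]
  simp [zonal]

/-- The signs `+1` on `ℝ^m` and `-1` on `ℝ^n`. -/
def signs (m n : ℕ) : Fin m ⊕ Fin n → ℝ := Sum.elim (fun _ => 1) (fun _ => -1)

theorem f_eq_quad (z : Sph m n) : f z = quad (signs m n) (z : Ambient m n) := by
  simp [f, quad, signs, xPart, yPart, EuclideanSpace.norm_sq_eq]
  ring

theorem isCk_f {k : WithTop ℕ∞} : IsCk N k (f : Sph m n → ℝ) := by
  have := isCk_of_contDiff (N := N) (contDiff_quad (k := k) (signs m n))
  convert this using 2 with z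
  exact f_eq_quad z

theorem quad_smul {ι : Type*} [Fintype ι] (s : ι → ℝ) (c : ℝ) (x : EuclideanSpace ℝ ι) :
    quad s (c • x) = c ^ 2 * quad s x := by
  simp [quad, Finset.mul_sum]
  refine Finset.sum_congr rfl fun k _ => by ring

/-- The coefficients `±1` give the ambient gradient length 2 on the sphere. By Euler's identity its
radial part is `2 f`, and removing it leaves `4 - 4 f²`. -/
theorem norm_sphGradient_f (z : Sph m n) : ‖sphGradient f z‖ ^ 2 = 4 * (1 - f z ^ 2) := by
  have hf : (f : Sph m n → ℝ) = fun z : Sph m n => quad (signs m n) (z : Ambient m n) :=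
    funext f_eq_quad
  have h := sphGradient_of_homogeneous (d := 2) (fun c _ x => quad_smul (signs m n) c x)
    (contDiff_quad _) z
  have h1 : ⟪gradient (quad (signs m n)) (z : Ambient m n), (z : Ambient m n)⟫_ℝ =
      2 * quad (signs m n) (z : Ambient m n) := by
    rw [inner_gradient_left, fderiv_self_of_homogeneous (d := 2)
      (fun c _ x => quad_smul (signs m n) c x)
      ((contDiff_quad (k := 1) _).differentiable (by norm_num) _)]
    simp
  have h2 : ‖gradient (quad (signs m n)) (z : Ambient m n)‖ ^ 2 = 4 := by
    rw [gradient_quad, EuclideanSpace.norm_sq_eq]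
    have : ∀ k, ‖2 * signs m n k * (z : Ambient m n) k‖ ^ 2 = 4 * (1 * (z : Ambient m n) k ^ 2) := by
      rintro (k | k) <;> simp [signs, mul_pow] <;> norm_num
    simp only [this]
    rw [← Finset.mul_sum]
    change 4 * quad (fun _ => 1) (z : Ambient m n) = 4
    rw [quad_one, z.norm_eq]
    norm_num
  rw [hf, h, norm_sub_sq_real, norm_smul, inner_smul_right, z.norm_eq, h1, h2, mul_one,
    Real.norm_eq_abs, sq_abs]
  push_cast
  ring

theorem sphLaplacian_f (z : Sph m n) :
    sphLaplacian f z = 2 * ((m : ℝ) - n) - 2 * (N + 1) * f z := by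
  have hf : (f : Sph m n → ℝ) = fun z : Sph m n => quad (signs m n) (z : Ambient m n) :=
    funext f_eq_quad
  rw [hf, sphLaplacian_of_homogeneous (N := N) (d := 2) (fun c _ x => quad_smul (signs m n) c x)
    (contDiff_quad _) z, laplacian_quad]
  simp [signs]
  ring

theorem contDiff_eval {k : WithTop ℕ∞} (p : ℝ[X]) : ContDiff ℝ k (fun t => p.eval t) := by
  simpa using p.contDiff_aeval (𝕜 := ℝ) k

theorem deriv_eval (p : ℝ[X]) : deriv (fun t => p.eval t) = fun t => (derivative p).eval t :=
  funext fun _ => p.deriv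

/-- On functions of `⟨z, ·⟩` the Laplacian is the Gegenbauer operator, i.e. the Jacobi operator with
both parameters `N / 2 - 1`. -/
theorem sphLaplacian_eval_zonal (p : ℝ[X]) (z ζ : Sph m n) :
    sphLaplacian (fun ζ => p.eval (zonal z ζ)) ζ =
      (1 - zonal z ζ ^ 2) * (derivative (derivative p)).eval (zonal z ζ)
        - N * zonal z ζ * (derivative p).eval (zonal z ζ) := by
  rw [sphLaplacian_comp (N := N) (isCk_zonal z) (contDiff_eval p), deriv_eval, deriv_eval,
    norm_sphGradient_zonal, sphLaplacian_zonal (N := N)]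
  ring

theorem isCk_eval_zonal {k : WithTop ℕ∞} (p : ℝ[X]) (z : Sph m n) :
    IsCk N k (fun ζ => p.eval (zonal z ζ)) :=
  (contDiff_eval (k := k) p).contMDiff.comp (isCk_zonal (N := N) z)

theorem isCk_Phi {k : WithTop ℕ∞} (i : ℕ) : IsCk N k (Phi m n i) :=
  (contDiff_eval (k := k) (jacobi _ _ i)).contMDiff.comp (isCk_f (N := N))

theorem jacobi_ode {α β : ℝ} (hα : -1 < α) (hβ : -1 < β) (i : ℕ) (t : ℝ) :
    (1 - t ^ 2) * (derivative (derivative (jacobi α β i))).eval t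
      + ((β - α) - (α + β + 2) * t) * (derivative (jacobi α β i)).eval t
      + (i : ℝ) * (i + α + β + 1) * (jacobi α β i).eval t = 0 := by
  have h := congrArg (eval t) (((isMonicJacobi_iff hα hβ i _).mpr rfl).2)
  simpa [-map_mul, -map_add, -map_sub] using h

/-- The squared gradient and the Laplacian of `f` are functions of `f` that reproduce four times the
coefficients of the Jacobi equation. Since `α + β + 1 = (N - 1) / 2`, the eigenvalue `4 i (i + α + β
+ 1)` is `λ_i`. -/
theorem laplaceEigen_Phi (hm : 1 ≤ m) (hn : 1 ≤ n) (i : ℕ) :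
    LaplaceEigen (lam N i) (Phi m n i) := by
  intro z
  have hm' : (1 : ℝ) ≤ m := by exact_mod_cast hm
  have hn' : (1 : ℝ) ≤ n := by exact_mod_cast hn
  have h3 : (m : ℝ) + n = N + 1 := by exact_mod_cast (Fact.out : m + n = N + 1)
  have hN : (N : ℝ) = m + n - 1 := by linarith
  have hode := jacobi_ode (α := (n : ℝ) / 2 - 1) (β := (m : ℝ) / 2 - 1) (by linarith)
    (by linarith) i (f z)
  change -sphLaplacian (fun z => (jacobi ((n : ℝ) / 2 - 1) ((m : ℝ) / 2 - 1) i).eval (f z)) z = _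
  rw [sphLaplacian_comp (N := N) isCk_f (contDiff_eval _), deriv_eval, deriv_eval,
    norm_sphGradient_f, sphLaplacian_f (N := N), lam, hN]
  unfold Phi
  linear_combination -4 * hode

/-- The eigenvalues of the sphere. -/
def ev (N l : ℕ) : ℝ := (l : ℝ) * (l + N - 1)

theorem lam_eq_ev (N i : ℕ) : lam N i = ev N (2 * i) := by
  simp only [lam, ev]
  push_cast
  ring

/-- The Gegenbauer polynomial of degree `l`, as a monic polynomial. -/
def gegen (N l : ℕ) : ℝ[X] := jacobi ((N : ℝ) / 2 - 1) ((N : ℝ) / 2 - 1) l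

theorem gegen_ode (hN : 1 ≤ N) (l : ℕ) (t : ℝ) :
    (1 - t ^ 2) * (derivative (derivative (gegen N l))).eval t
      - N * t * (derivative (gegen N l)).eval t + ev N l * (gegen N l).eval t = 0 := by
  have hN' : (1 : ℝ) ≤ N := by exact_mod_cast hN
  have h := jacobi_ode (α := (N : ℝ) / 2 - 1) (β := (N : ℝ) / 2 - 1) (by linarith) (by linarith) l t
  rw [gegen, ev]
  linear_combination h

end Restriction

/-! ### Isometries of the sphere and invariant functions -/

section Isometries

variable {m n : ℕ}

/-- The map of the sphere induced by a linear isometry. -/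
def sphMap (L : Ambient m n ≃ₗᵢ[ℝ] Ambient m n) (z : Sph m n) : Sph m n :=
  ⟨L z, by rw [mem_sphere_zero_iff_norm, L.norm_map, z.norm_eq]⟩

theorem continuous_sphMap (L : Ambient m n ≃ₗᵢ[ℝ] Ambient m n) : Continuous (sphMap L) :=
  (L.continuous.comp continuous_subtype_val).subtype_mk _

/-- `sphMap L` as a homeomorphism. -/
def sphHomeo (L : Ambient m n ≃ₗᵢ[ℝ] Ambient m n) : Sph m n ≃ₜ Sph m n where
  toFun := sphMap L
  invFun := sphMap L.symm
  left_inv z := by ext1; simp [sphMap]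
  right_inv z := by ext1; simp [sphMap]
  continuous_toFun := continuous_sphMap L
  continuous_invFun := continuous_sphMap L.symm

open scoped Pointwise in
-- The surface measure of a set is, up to a constant, the volume of the cone over it. Linear
-- isometries commute with taking cones and preserve volume.
theorem measurePreserving_sphMap (L : Ambient m n ≃ₗᵢ[ℝ] Ambient m n) :
    MeasurePreserving (sphMap L) (surf m n) (surf m n) := by
  refine ⟨(continuous_sphMap L).measurable, Measure.ext fun s hs => ?_⟩
  rw [Measure.map_apply (continuous_sphMap L).measurable hs, surf, Measure.toSphere_apply' _ hs,
    Measure.toSphere_apply' _ ((continuous_sphMap L).measurable hs)]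
  congr 1
  have h : Set.Ioo (0 : ℝ) 1 • (Subtype.val '' (sphMap L ⁻¹' s)) =
      L ⁻¹' (Set.Ioo (0 : ℝ) 1 • (Subtype.val '' s)) := by
    ext x
    simp only [Set.mem_smul, Set.mem_image, Set.mem_preimage]
    constructor
    · rintro ⟨r, hr, _, ⟨z, hz, rfl⟩, rfl⟩
      exact ⟨r, hr, _, ⟨_, hz, rfl⟩, by simp [sphMap]⟩
    · rintro ⟨r, hr, _, ⟨z, hz, rfl⟩, hx⟩
      refine ⟨r, hr, _, ⟨sphMap L.symm z, ?_, rfl⟩, ?_⟩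
      · have : sphMap L (sphMap L.symm z) = z := by ext1; simp [sphMap]
        rwa [this]
      · apply L.injective
        rw [← hx]
        simp [sphMap]
  rw [h]
  exact L.measurePreserving.measure_preimage_equiv (f := L.toHomeomorph.toMeasurableEquiv) _

theorem inner_eq_parts (z w : Ambient m n) :
    ⟪z, w⟫_ℝ = ⟪xPart z, xPart w⟫_ℝ + ⟪yPart z, yPart w⟫_ℝ := by
  simp [PiLp.inner_apply, Fintype.sum_sum_type, xPart, yPart]

/-- The isometry `(x, y) ↦ (A x, B y)`. -/
def prodIso (A : O m) (B : O n) : Ambient m n ≃ₗᵢ[ℝ] Ambient m n :=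
  LinearIsometry.toLinearIsometryEquiv
    { toFun := fun z => pair (A (xPart z)) (B (yPart z))
      map_add' := fun z w => by
        have h1 : xPart (z + w) = xPart z + xPart w := rfl
        have h2 : yPart (z + w) = yPart z + yPart w := rfl
        ext (k | k) <;> simp [pair, h1, h2]
      map_smul' := fun c z => by
        have h1 : xPart (c • z) = c • xPart z := rfl
        have h2 : yPart (c • z) = c • yPart z := rfl
        ext (k | k) <;> simp [pair, h1, h2]
      norm_map' := fun z => by
        have h : ‖pair (A (xPart z)) (B (yPart z))‖ ^ 2 = ‖z‖ ^ 2 := by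
          rw [norm_sq_parts, norm_sq_parts z]
          change ‖A (xPart z)‖ ^ 2 + ‖B (yPart z)‖ ^ 2 = _
          rw [A.norm_map, B.norm_map]
        exact (sq_eq_sq₀ (norm_nonneg _) (norm_nonneg _)).mp h } rfl

theorem act_eq_sphMap (A : O m) (B : O n) : act A B = sphMap (prodIso A B) := rfl

theorem measurePreserving_act (A : O m) (B : O n) :
    MeasurePreserving (act A B) (surf m n) (surf m n) := by
  rw [act_eq_sphMap]
  exact measurePreserving_sphMap _

theorem zonal_sphMap (L : Ambient m n ≃ₗᵢ[ℝ] Ambient m n) (z ζ : Sph m n) :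
    zonal (sphMap L z) (sphMap L ζ) = zonal z ζ := L.inner_map_map _ _

/-- The reflection in the hyperplane orthogonal to `x - y` exchanges two vectors of equal norm. -/
theorem exists_isometry_eq {k : ℕ} {x y : EuclideanSpace ℝ (Fin k)} (h : ‖x‖ = ‖y‖) :
    ∃ A : O k, A x = y :=
  ⟨_, Submodule.reflection_sub h⟩

theorem GInvariant.eq_of_norm_eq {u : Sph m n → ℝ} (hu : GInvariant u) {z w : Sph m n}
    (hx : ‖xPart (z : Ambient m n)‖ = ‖xPart (w : Ambient m n)‖)
    (hy : ‖yPart (z : Ambient m n)‖ = ‖yPart (w : Ambient m n)‖) : u z = u w := by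
  obtain ⟨A, hA⟩ := exists_isometry_eq hx
  obtain ⟨B, hB⟩ := exists_isometry_eq hy
  rw [← hu A B z]
  congr 1
  ext1
  change pair (A _) (B _) = _
  rw [hA, hB]
  ext (k | k) <;> rfl

theorem f_act (A : O m) (B : O n) (z : Sph m n) : f (act A B z) = f z := by
  change ‖A (xPart (z : Ambient m n))‖ ^ 2 - ‖B (yPart (z : Ambient m n))‖ ^ 2 = _
  rw [A.norm_map, B.norm_map]
  rfl

theorem gInvariant_Phi (i : ℕ) : GInvariant (Phi m n i) := fun A B z => by
  rw [Phi, f_act]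
  rfl

theorem f_mem_Icc (z : Sph m n) : f z ∈ Set.Icc (-1 : ℝ) 1 := by
  have h := norm_sq_parts (z : Ambient m n)
  rw [z.norm_eq] at h
  constructor <;> unfold f <;> nlinarith [sq_nonneg ‖xPart (z : Ambient m n)‖,
    sq_nonneg ‖yPart (z : Ambient m n)‖]

theorem sq_norm_xPart (z : Sph m n) : ‖xPart (z : Ambient m n)‖ ^ 2 = (1 + f z) / 2 := by
  have h := norm_sq_parts (z : Ambient m n)
  rw [z.norm_eq] at h
  unfold f
  linarith

theorem sq_norm_yPart (z : Sph m n) : ‖yPart (z : Ambient m n)‖ ^ 2 = (1 - f z) / 2 := by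
  have h := norm_sq_parts (z : Ambient m n)
  rw [z.norm_eq] at h
  unfold f
  linarith

/-- A curve on which `f` takes the value `t` at `t ∈ [-1, 1]`. -/
def section_ (x : EuclideanSpace ℝ (Fin m)) (y : EuclideanSpace ℝ (Fin n)) (t : ℝ) : Ambient m n :=
  pair (Real.sqrt ((1 + t) / 2) • x) (Real.sqrt ((1 - t) / 2) • y)

theorem continuous_section (x : EuclideanSpace ℝ (Fin m)) (y : EuclideanSpace ℝ (Fin n)) :
    Continuous (section_ x y) := by
  unfold section_ pair
  refine (PiLp.continuous_toLp 2 _).comp (continuous_pi ?_)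
  rintro (k | k) <;> simp <;> fun_prop

theorem norm_section {x : EuclideanSpace ℝ (Fin m)} {y : EuclideanSpace ℝ (Fin n)} (hx : ‖x‖ = 1)
    (hy : ‖y‖ = 1) {t : ℝ} (ht : t ∈ Set.Icc (-1 : ℝ) 1) : ‖section_ x y t‖ = 1 := by
  have h : ‖section_ x y t‖ ^ 2 = 1 := by
    rw [norm_sq_parts]
    change ‖Real.sqrt ((1 + t) / 2) • x‖ ^ 2 + ‖Real.sqrt ((1 - t) / 2) • y‖ ^ 2 = 1
    rw [norm_smul, norm_smul, hx, hy, mul_one, mul_one, Real.norm_eq_abs, Real.norm_eq_abs, sq_abs,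
      sq_abs, Real.sq_sqrt (by linarith [ht.1]), Real.sq_sqrt (by linarith [ht.2])]
    ring
  nlinarith [norm_nonneg (section_ x y t)]

/-- An invariant function that extends continuously is a continuous function of `f`. -/
theorem GInvariant.exists_eq_comp_f (hm : 1 ≤ m) (hn : 1 ≤ n) {F : Ambient m n → ℝ}
    (hF : Continuous F) (hu : GInvariant fun z : Sph m n => F z) :
    ∃ h : ℝ → ℝ, Continuous h ∧ ∀ z : Sph m n, F z = h (f z) := by
  let x : EuclideanSpace ℝ (Fin m) := EuclideanSpace.single ⟨0, hm⟩ 1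
  let y : EuclideanSpace ℝ (Fin n) := EuclideanSpace.single ⟨0, hn⟩ 1
  have hx : ‖x‖ = 1 := by simp [x]
  have hy : ‖y‖ = 1 := by simp [y]
  -- `Real.sqrt` vanishes on negative numbers, so the curve is continuous on all of `ℝ`, although it
  -- lies on the sphere only over `[-1, 1]`. This is why `F` has to be given on the ambient space.
  refine ⟨fun t => F (section_ x y t), hF.comp (continuous_section x y), fun z => ?_⟩
  have hz : ‖section_ x y (f z)‖ = 1 := norm_section hx hy (f_mem_Icc z)
  refine hu.eq_of_norm_eq (w := ⟨section_ x y (f z), mem_sphere_zero_iff_norm.mpr hz⟩) ?_ ?_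
  · change _ = ‖Real.sqrt ((1 + f z) / 2) • x‖
    rw [norm_smul, hx, mul_one, Real.norm_eq_abs, abs_of_nonneg (Real.sqrt_nonneg _),
      ← sq_norm_xPart, Real.sqrt_sq (norm_nonneg _)]
  · change _ = ‖Real.sqrt ((1 - f z) / 2) • y‖
    rw [norm_smul, hy, mul_one, Real.norm_eq_abs, abs_of_nonneg (Real.sqrt_nonneg _),
      ← sq_norm_yPart, Real.sqrt_sq (norm_nonneg _)]

end Isometries

/-! ### Completeness of the family among invariant functions -/

section Completeness

variable {m n : ℕ}

theorem degree_jacobi {α β : ℝ} (hα : -1 < α) (hβ : -1 < β) (i : ℕ) :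
    (jacobi α β i).degree = i := by
  have hmon : (jacobi α β i).Monic := ((isMonicJacobi_iff hα hβ i _).mpr rfl).1
  have hle : (jacobi α β i).natDegree ≤ i := by
    refine natDegree_sum_le_of_forall_le _ _ fun k hk => ?_
    refine (natDegree_C_mul_le _ _).trans (natDegree_pow_le.trans ?_)
    have : (X - 1 : ℝ[X]).natDegree = 1 := natDegree_X_sub_C 1
    rw [this]
    have := Finset.mem_range.mp hk
    omega
  have hge : i ≤ ((jacobi α β i).comp (X + 1)).natDegree := by
    refine le_natDegree_of_ne_zero ?_
    rw [jacobi_comp_coeff, if_pos le_rfl, jacobiCoeff, Finset.Ico_self, Finset.prod_empty]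
    exact one_ne_zero
  rw [natDegree_comp, show (X + 1 : ℝ[X]).natDegree = 1 from natDegree_X_add_C 1, mul_one] at hge
  rw [degree_eq_natDegree hmon.ne_zero, le_antisymm hle hge]

theorem span_jacobi {α β : ℝ} (hα : -1 < α) (hβ : -1 < β) :
    Submodule.span ℝ (Set.range (jacobi α β)) = ⊤ := by
  refine Polynomial.Sequence.span ⟨jacobi α β, degree_jacobi hα hβ⟩ fun i => ?_
  have : (jacobi α β i).Monic := ((isMonicJacobi_iff hα hβ i _).mpr rfl).1
  change IsUnit (jacobi α β i).leadingCoeff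
  rw [this.leadingCoeff]
  exact isUnit_one

theorem continuous_f : Continuous (f : Sph m n → ℝ) := by
  have : (f : Sph m n → ℝ) = fun z : Sph m n => quad (signs m n) (z : Ambient m n) :=
    funext f_eq_quad
  rw [this]
  exact (contDiff_quad (k := 0) _).continuous.comp continuous_subtype_val

theorem integrable_mul_continuous {w g : Sph m n → ℝ} (hw : Integrable w (surf m n))
    (hg : Continuous g) : Integrable (fun z => w z * g z) (surf m n) := by
  obtain ⟨C, hC⟩ := isCompact_univ.exists_bound_of_continuousOn hg.continuousOn
  exact hw.mul_bdd hg.aestronglyMeasurable (Eventually.of_forall fun z => hC z trivial)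

theorem integral_mul_eval_f_eq_zero (hm : 1 ≤ m) (hn : 1 ≤ n) {w : Sph m n → ℝ}
    (hw : Integrable w (surf m n)) (h : ∀ i, ∫ z, w z * Phi m n i z ∂surf m n = 0) (p : ℝ[X]) :
    ∫ z, w z * p.eval (f z) ∂surf m n = 0 := by
  have hm' : (1 : ℝ) ≤ m := by exact_mod_cast hm
  have hn' : (1 : ℝ) ≤ n := by exact_mod_cast hn
  have hp : p ∈ Submodule.span ℝ (Set.range (jacobi ((n : ℝ) / 2 - 1) ((m : ℝ) / 2 - 1))) := by
    rw [span_jacobi (by linarith) (by linarith)]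
    trivial
  have hint : ∀ p : ℝ[X], Integrable (fun z => w z * p.eval (f z)) (surf m n) := fun p =>
    integrable_mul_continuous hw (p.continuous.comp continuous_f)
  induction hp using Submodule.span_induction with
  | mem p hp => obtain ⟨i, rfl⟩ := hp; exact h i
  | zero => simp
  | add p q _ _ hp hq =>
    simp only [eval_add, mul_add]
    rw [integral_add (hint p) (hint q), hp, hq, add_zero]
  | smul c p _ hp =>
    simp only [eval_smul, smul_eq_mul, mul_left_comm _ c]
    rw [integral_const_mul, hp, mul_zero]

/-- If an integrable function is orthogonal to all polynomials in `g`, it is orthogonal to all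
continuous functions of `g`. -/
theorem integral_mul_comp_eq_zero {X : Type*} [MeasurableSpace X] {μ : Measure X} {w g : X → ℝ}
    (hw : Integrable w μ) (hg : Measurable g) {a b : ℝ} (hab : ∀ x, g x ∈ Set.Icc a b)
    (hp : ∀ p : ℝ[X], ∫ x, w x * p.eval (g x) ∂μ = 0) {h : ℝ → ℝ} (hh : Continuous h) :
    ∫ x, w x * h (g x) ∂μ = 0 := by
  have hbdd : ∀ h : ℝ → ℝ, Continuous h → Integrable (fun x => w x * h (g x)) μ := fun h hh => by
    obtain ⟨C, hC⟩ := (isCompact_Icc (a := a) (b := b)).exists_bound_of_continuousOn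
      hh.continuousOn
    exact hw.mul_bdd (hh.measurable.comp hg).aestronglyMeasurable
      (Eventually.of_forall fun z => hC _ (hab z))
  have key : ∀ ε > 0, |∫ x, w x * h (g x) ∂μ| ≤ ε * ∫ x, |w x| ∂μ := fun ε hε => by
    obtain ⟨p, hpε⟩ := exists_polynomial_near_of_continuousOn a b h hh.continuousOn ε hε
    have h1 : ∫ x, w x * h (g x) ∂μ = ∫ x, w x * (h (g x) - p.eval (g x)) ∂μ := by
      simp only [mul_sub]
      rw [integral_sub (hbdd h hh) (hbdd _ p.continuous), hp, sub_zero]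
    rw [h1, ← integral_const_mul, ← Real.norm_eq_abs]
    refine norm_integral_le_of_norm_le (hw.abs.const_mul ε) (Eventually.of_forall fun x => ?_)
    rw [norm_mul, Real.norm_eq_abs, Real.norm_eq_abs, mul_comm, abs_sub_comm]
    exact mul_le_mul_of_nonneg_right (hpε _ (hab x)).le (abs_nonneg _)
  by_contra hne
  have h0 : 0 ≤ ∫ x, |w x| ∂μ := integral_nonneg fun x => abs_nonneg _
  have hpos := abs_pos.mpr hne
  set c := |∫ x, w x * h (g x) ∂μ|
  -- This accuracy makes the bound smaller than `c`; the `+ 1` avoids dividing by zero.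
  have := key (c / (2 * (∫ x, |w x| ∂μ + 1))) (by positivity)
  rw [div_mul_eq_mul_div, le_div_iff₀ (by positivity)] at this
  nlinarith

theorem zonal_pow (z ζ : Sph m n) (k : ℕ) : zonal z ζ ^ k =
    ∑ σ : Fin k → Fin m ⊕ Fin n, (∏ j, (z : Ambient m n) (σ j)) * ∏ j, (ζ : Ambient m n) (σ j) := by
  have : zonal z ζ = ∑ i, (z : Ambient m n) i * (ζ : Ambient m n) i := by
    rw [zonal, PiLp.inner_apply]
    exact Finset.sum_congr rfl fun i _ => by simp [mul_comm]
  rw [this, Fintype.sum_pow]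
  simp_rw [Finset.prod_mul_distrib]

theorem continuous_prod_coord {ι : Type*} [Fintype ι] (σ : ι → Fin m ⊕ Fin n) :
    Continuous fun x : Ambient m n => ∏ j, x (σ j) :=
  continuous_finsetProd _ fun j _ => (EuclideanSpace.proj (𝕜 := ℝ) (σ j)).continuous

/-- The moments are coefficients of `F(z) = ∫ w(ζ) ⟨z, ζ⟩^k`. Invariance of `w` passes to `F`, which
is then a function of `f` and orthogonal to `w`. Since `∫ w F` is the sum of the squared moments,
every moment vanishes. -/
theorem integral_monomial_eq_zero (hm : 1 ≤ m) (hn : 1 ≤ n) {w : Sph m n → ℝ}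
    (hw : Integrable w (surf m n)) (hG : AEGInvariant w)
    (h : ∀ i, ∫ z, w z * Phi m n i z ∂surf m n = 0) {k : ℕ} (σ : Fin k → Fin m ⊕ Fin n) :
    ∫ z : Sph m n, w z * ∏ j, (z : Ambient m n) (σ j) ∂surf m n = 0 := by
  set M : (Fin k → Fin m ⊕ Fin n) → ℝ := fun σ => ∫ z : Sph m n, w z * ∏ j, (z : Ambient m n) (σ j) ∂surf m n
    with hM
  have hint : ∀ σ : Fin k → Fin m ⊕ Fin n,
      Integrable (fun z : Sph m n => w z * ∏ j, (z : Ambient m n) (σ j)) (surf m n) := fun σ =>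
    integrable_mul_continuous hw ((continuous_prod_coord σ).comp continuous_subtype_val)
  -- Written as a polynomial so that it is continuous on the whole ambient space.
  let F : Ambient m n → ℝ := fun x => ∑ σ, (∏ j, x (σ j)) * M σ
  have hFc : Continuous F :=
    continuous_finsetSum _ fun σ _ => (continuous_prod_coord σ).mul continuous_const
  have hF : ∀ z : Sph m n, F z = ∫ ζ, w ζ * zonal z ζ ^ k ∂surf m n := fun z => by
    simp only [zonal_pow, Finset.mul_sum]
    rw [integral_finsetSum]
    · refine Finset.sum_congr rfl fun σ _ => ?_
      rw [hM, ← integral_const_mul]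
      exact integral_congr_ae (Eventually.of_forall fun ζ => by ring)
    · intro σ _
      have := (hint σ).const_mul (∏ j, (z : Ambient m n) (σ j))
      exact this.congr (Eventually.of_forall fun ζ => by ring)
  -- Substitute `ζ ↦ act A B ζ` in the integral: the measure and the inner product are preserved,
  -- and `w` is almost everywhere invariant.
  have hFG : GInvariant fun z : Sph m n => F z := fun A B z => by
    simp only [hF]
    have hmp := measurePreserving_act A B
    have he : MeasurableEmbedding (act A B) :=
      (sphHomeo (prodIso A B)).measurableEmbedding
    rw [← hmp.integral_comp he]
    refine integral_congr_ae ?_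
    filter_upwards [hG A B] with ζ hζ
    rw [hζ, act_eq_sphMap, zonal_sphMap]
  obtain ⟨g, hg, hgF⟩ := hFG.exists_eq_comp_f hm hn hFc
  have h0 : ∫ z, w z * g (f z) ∂surf m n = 0 :=
    integral_mul_comp_eq_zero hw continuous_f.measurable f_mem_Icc
      (integral_mul_eval_f_eq_zero hm hn hw h) hg
  simp only [← hgF, F, Finset.mul_sum] at h0
  rw [integral_finsetSum] at h0
  · have h1 : ∀ σ, ∫ z : Sph m n, w z * ((∏ j, (z : Ambient m n) (σ j)) * M σ) ∂surf m n = M σ * M σ :=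
      fun σ => by
        simp only [← mul_assoc]
        rw [integral_mul_const]
    simp only [h1] at h0
    rw [Finset.sum_eq_zero_iff_of_nonneg fun σ _ => mul_self_nonneg _] at h0
    exact mul_self_eq_zero.mp (h0 σ (Finset.mem_univ _))
  · intro σ _
    simp only [← mul_assoc]
    exact (hint σ).mul_const _

/-- A coordinate, as a continuous function on the sphere. -/
def coord (i : Fin m ⊕ Fin n) : C(Sph m n, ℝ) :=
  ⟨fun z => (z : Ambient m n) i,
    (EuclideanSpace.proj (𝕜 := ℝ) i).continuous.comp continuous_subtype_val⟩

/-- Coordinates separate points, so Stone–Weierstrass makes polynomials uniformly dense. Uniform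
approximation suffices because `w` is integrable. -/
theorem integral_mul_continuous_eq_zero {w : Sph m n → ℝ} (hw : Integrable w (surf m n))
    (h : ∀ (k : ℕ) (σ : Fin k → Fin m ⊕ Fin n),
      ∫ z : Sph m n, w z * ∏ j, (z : Ambient m n) (σ j) ∂surf m n = 0) (g : C(Sph m n, ℝ)) :
    ∫ z, w z * g z ∂surf m n = 0 := by
  set A := Algebra.adjoin ℝ (Set.range (coord (m := m) (n := n))) with hA
  have hint : ∀ g : C(Sph m n, ℝ), Integrable (fun z => w z * g z) (surf m n) := fun g =>
    integrable_mul_continuous hw g.continuous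
  have hsep : A.SeparatesPoints := by
    intro z z' hne
    have : ∃ i, (z : Ambient m n) i ≠ (z' : Ambient m n) i := by
      by_contra! hcon
      exact hne (Subtype.ext (by ext i; exact hcon i))
    obtain ⟨i, hi⟩ := this
    exact ⟨_, ⟨coord i, Algebra.subset_adjoin ⟨i, rfl⟩, rfl⟩, hi⟩
  have hmon : ∀ a ∈ Submonoid.closure (Set.range (coord (m := m) (n := n))),
      ∃ l : List (Fin m ⊕ Fin n), a = (l.map coord).prod := by
    intro a ha
    induction ha using Submonoid.closure_induction with
    | mem a ha => obtain ⟨i, rfl⟩ := ha; exact ⟨[i], by simp⟩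
    | one => exact ⟨[], by simp⟩
    | mul a b _ _ ha hb =>
      obtain ⟨l, rfl⟩ := ha
      obtain ⟨l', rfl⟩ := hb
      exact ⟨l ++ l', by simp⟩
  have hzero : ∀ a ∈ A, ∫ z, w z * a z ∂surf m n = 0 := by
    intro a ha
    rw [← Subalgebra.mem_toSubmodule, hA, Algebra.adjoin_eq_span] at ha
    induction ha using Submodule.span_induction with
    | mem a ha =>
      obtain ⟨l, rfl⟩ := hmon a ha
      rw [← h l.length fun j => l[j]]
      refine integral_congr_ae (Eventually.of_forall fun z => ?_)
      simp only
      rw [← Fin.prod_univ_fun_getElem, ContinuousMap.prod_apply]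
      rfl
    | zero => simp
    | add p q _ _ hp hq =>
      simp only [ContinuousMap.add_apply, mul_add]
      rw [integral_add (hint p) (hint q), hp, hq, add_zero]
    | smul c p _ hp =>
      simp only [ContinuousMap.smul_apply, smul_eq_mul, mul_left_comm _ c]
      rw [integral_const_mul, hp, mul_zero]
  have key : ∀ ε > 0, |∫ x, w x * g x ∂surf m n| ≤ ε * ∫ x, |w x| ∂surf m n := fun ε hε => by
    obtain ⟨a, ha⟩ := ContinuousMap.exists_mem_subalgebra_near_continuousMap_of_separatesPoints
      A hsep g ε hε
    have h1 : ∫ x, w x * g x ∂surf m n = ∫ x, w x * (g x - (a : C(Sph m n, ℝ)) x) ∂surf m n := by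
      simp only [mul_sub]
      rw [integral_sub (hint g) (hint a), hzero a a.2, sub_zero]
    rw [h1, ← integral_const_mul, ← Real.norm_eq_abs]
    refine norm_integral_le_of_norm_le (hw.abs.const_mul ε) (Eventually.of_forall fun x => ?_)
    rw [norm_mul, Real.norm_eq_abs, mul_comm, norm_sub_rev]
    exact mul_le_mul_of_nonneg_right
      ((ContinuousMap.norm_coe_le_norm ((a : C(Sph m n, ℝ)) - g) x).trans ha.le) (abs_nonneg _)
  by_contra hne
  have h0 : 0 ≤ ∫ x, |w x| ∂surf m n := integral_nonneg fun x => abs_nonneg _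
  have hpos := abs_pos.mpr hne
  set c := |∫ x, w x * g x ∂surf m n|
  have := key (c / (2 * (∫ x, |w x| ∂surf m n + 1))) (by positivity)
  rw [div_mul_eq_mul_div, le_div_iff₀ (by positivity)] at this
  nlinarith

/-- Completeness of `(Φ_i)` among invariant square integrable functions. -/
theorem ae_eq_zero_of_integral_mul_Phi (hm : 1 ≤ m) (hn : 1 ≤ n) {w : Sph m n → ℝ}
    (hw : MemLp w 2 (surf m n)) (hG : AEGInvariant w)
    (h : ∀ i, ∫ z, w z * Phi m n i z ∂surf m n = 0) : w =ᵐ[surf m n] 0 := by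
  have hwi : Integrable w (surf m n) := hw.integrable (by norm_num)
  have h0 := integral_mul_continuous_eq_zero hwi fun k σ =>
    integral_monomial_eq_zero hm hn hwi hG h σ
  have hd := ContinuousMap.toLp_denseRange (α := Sph m n) ℝ (surf m n) ℝ (p := 2) (by norm_num)
  have : hw.toLp w = 0 := by
    refine Dense.eq_zero_of_inner_left ℝ hd ?_
    rintro _ ⟨g, rfl⟩
    rw [L2.inner_def, ← h0 g]
    refine integral_congr_ae ?_
    filter_upwards [hw.coeFn_toLp, ContinuousMap.coeFn_toLp (p := 2) (𝕜 := ℝ) (surf m n) g]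
      with z h1 h2
    rw [h1, h2]
    simp [mul_comm]
  exact hw.coeFn_toLp.symm.trans ((Lp.eq_zero_iff_ae_eq_zero).mp this)

end Completeness

/-! ### Totality and orthogonal bases in a Hilbert space -/

section Abstract

variable {H : Type*} [NormedAddCommGroup H] [InnerProductSpace ℝ H] [CompleteSpace H]

/-- An orthogonal family that is total in a closed subspace is an orthogonal basis of it. -/
theorem isOrthogonalBasis_of_total {e : ℕ → H} {K : Submodule ℝ H} (hK : IsClosed (K : Set H))
    (heK : ∀ i, e i ∈ K) (h0 : ∀ i, e i ≠ 0) (horth : ∀ i j, i ≠ j → ⟪e i, e j⟫_ℝ = 0)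
    (htot : ∀ p ∈ K, (∀ i, ⟪e i, p⟫_ℝ = 0) → p = 0) : IsOrthogonalBasis e (K : Set H) := by
  refine ⟨h0, horth, ?_⟩
  set S := Submodule.span ℝ (Set.range e)
  have hS : S ≤ K := Submodule.span_le.mpr (by rintro _ ⟨i, rfl⟩; exact heK i)
  have hSK : S.topologicalClosure ≤ K := S.topologicalClosure_minimal hS hK
  refine le_antisymm hSK fun p hp => ?_
  have : CompleteSpace S.topologicalClosure :=
    S.isClosed_topologicalClosure.completeSpace_coe
  -- The residual of the projection stays in `K` and is orthogonal to the whole family, so totality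
  -- kills it.
  have hz : p - S.topologicalClosure.starProjection p = 0 := by
    refine htot _ (K.sub_mem hp (hSK (Submodule.starProjection_apply_mem _ _))) fun i => ?_
    exact Submodule.sub_starProjection_mem_orthogonal (K := S.topologicalClosure) p _
      (S.le_topologicalClosure (Submodule.subset_span ⟨i, rfl⟩))
  rw [sub_eq_zero] at hz
  change p ∈ S.topologicalClosure
  rw [hz]
  exact Submodule.starProjection_apply_mem _ _

end Abstract

/-! ### The closed subspace of invariant classes -/

section Invariant

variable {m n : ℕ}

theorem AEGInvariant.congr {u v : Sph m n → ℝ} (hu : AEGInvariant u) (h : u =ᵐ[surf m n] v) :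
    AEGInvariant v := fun A B =>
  ((measurePreserving_act A B).quasiMeasurePreserving.ae_eq_comp h).symm.trans ((hu A B).trans h)

theorem GInvariant.aeGInvariant {u : Sph m n → ℝ} (hu : GInvariant u) : AEGInvariant u :=
  fun A B => Eventually.of_forall fun z => hu A B z

/-- The invariant functions in `L²(ν)`, for a measure `ν` equivalent to the surface measure. -/
def invariantLp (ν : Measure (Sph m n)) (hν : ae ν = ae (surf m n)) : Submodule ℝ (Lp ℝ 2 ν) where
  carrier := {u | AEGInvariant u}
  zero_mem' := by
    have h : (0 : Sph m n → ℝ) =ᵐ[surf m n] ((0 : Lp ℝ 2 ν) : Sph m n → ℝ) := by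
      have := (Lp.coeFn_zero ℝ 2 ν).symm
      rwa [EventuallyEq, hν] at this
    refine AEGInvariant.congr (fun A B => ?_) h
    exact EventuallyEq.rfl
  add_mem' := fun {u v} hu hv => by
    have h : ((u : Sph m n → ℝ) + (v : Sph m n → ℝ)) =ᵐ[surf m n] ((u + v : Lp ℝ 2 ν) : Sph m n → ℝ) := by
      have := (Lp.coeFn_add u v).symm
      rwa [EventuallyEq, hν] at this
    exact AEGInvariant.congr (fun A B => (hu A B).add (hv A B)) h
  smul_mem' := fun c u hu => by
    have h : (c • (u : Sph m n → ℝ)) =ᵐ[surf m n] ((c • u : Lp ℝ 2 ν) : Sph m n → ℝ) := by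
      have := (Lp.coeFn_smul c u).symm
      rwa [EventuallyEq, hν] at this
    exact AEGInvariant.congr (fun A B => (hu A B).const_smul c) h

/-- An intersection of fixed-point sets of isometries of `L²`. -/
theorem isClosed_invariantLp (ν : Measure (Sph m n)) (hν : ae ν = ae (surf m n))
    (hmp : ∀ (A : O m) (B : O n), MeasurePreserving (act A B) ν ν) :
    IsClosed (invariantLp ν hν : Set (Lp ℝ 2 ν)) := by
  have h : (invariantLp ν hν : Set (Lp ℝ 2 ν)) =
      ⋂ (A : O m) (B : O n), {u | Lp.compMeasurePreserving (act A B) (hmp A B) u = u} := by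
    ext u
    simp only [Set.mem_iInter, Set.mem_ofPred_eq]
    change (∀ (A : O m) (B : O n), _ =ᵐ[surf m n] _) ↔ _
    refine forall_congr' fun A => forall_congr' fun B => ?_
    rw [Lp.ext_iff, EventuallyEq, ← hν]
    have h1 := Lp.coeFn_compMeasurePreserving u (hmp A B)
    exact ⟨fun h => h1.trans h, fun h => h1.symm.trans h⟩
  rw [h]
  exact isClosed_iInter fun A => isClosed_iInter fun B =>
    isClosed_eq (Lp.isometry_compMeasurePreserving _).continuous continuous_id

end Invariant

/-! ### Invariant eigenfunctions and the basis of L² -/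

section Phi

variable {m n : ℕ}

/-- Expanded in powers of `X - 1`, the polynomial takes at 1 the value of its constant coefficient,
a product of positive factors. -/
theorem jacobi_eval_one_pos {α β : ℝ} (hα : -1 < α) (hβ : -1 < β) (i : ℕ) :
    0 < (jacobi α β i).eval 1 := by
  have h : (jacobi α β i).eval 1 = jacobiCoeff α β i 0 := by
    rw [jacobi, eval_finsetSum, Finset.sum_eq_single 0]
    · simp
    · intro k _ hk
      simp [hk]
    · simp
  rw [h, jacobiCoeff]
  refine Finset.prod_pos fun j hj => ?_
  have hj' : (j : ℝ) + 1 ≤ i := by exact_mod_cast (Finset.mem_Ico.mp hj).2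
  have h0 : (0 : ℝ) ≤ j := Nat.cast_nonneg j
  refine div_pos (mul_pos (by linarith) (by linarith)) (mul_pos (by linarith) (by linarith))

/-- At a point with `y = 0` one has `f = 1`, where the Jacobi polynomial is positive. -/
theorem Phi_ne_zero (hm : 1 ≤ m) (hn : 1 ≤ n) (i : ℕ) : Phi m n i ≠ 0 := by
  intro h
  have hm' : (1 : ℝ) ≤ m := by exact_mod_cast hm
  have hn' : (1 : ℝ) ≤ n := by exact_mod_cast hn
  let x : EuclideanSpace ℝ (Fin m) := EuclideanSpace.single ⟨0, hm⟩ 1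
  have hx : ‖x‖ = 1 := by simp [x]
  have hnorm : ‖(pair x 0 : Ambient m n)‖ = 1 := by
    have : ‖(pair x 0 : Ambient m n)‖ ^ 2 = 1 := by
      rw [norm_sq_parts]
      change ‖x‖ ^ 2 + ‖(0 : EuclideanSpace ℝ (Fin n))‖ ^ 2 = 1
      simp [hx]
    nlinarith [norm_nonneg (pair x 0 : Ambient m n)]
  have hz := congrFun h ⟨pair x 0, mem_sphere_zero_iff_norm.mpr hnorm⟩
  have hf : f (⟨pair x 0, mem_sphere_zero_iff_norm.mpr hnorm⟩ : Sph m n) = 1 := by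
    change ‖x‖ ^ 2 - ‖(0 : EuclideanSpace ℝ (Fin n))‖ ^ 2 = 1
    simp [hx]
  rw [Phi, hf] at hz
  exact (jacobi_eval_one_pos (by linarith) (by linarith) i).ne' hz

theorem lam_strictMono {N : ℕ} (hN : 1 ≤ N) : StrictMono (lam N) := by
  refine strictMono_nat_of_lt_succ fun i => ?_
  have hN' : (1 : ℝ) ≤ N := by exact_mod_cast hN
  have : (0 : ℝ) ≤ i := Nat.cast_nonneg i
  simp only [lam]
  push_cast
  nlinarith

theorem lam_nonneg {N : ℕ} (hN : 1 ≤ N) (i : ℕ) : 0 ≤ lam N i := by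
  have hN' : (1 : ℝ) ≤ N := by exact_mod_cast hN
  have : (0 : ℝ) ≤ i := Nat.cast_nonneg i
  exact mul_nonneg (by positivity) (by linarith)

variable {N : ℕ} [Fact (m + n = N + 1)]

theorem continuous_Phi (i : ℕ) : Continuous (Phi m n i) :=
  (jacobi _ _ i).continuous.comp continuous_f

theorem eigen_sub_mul_integral {μ μ' : ℝ} {u v : Sph m n → ℝ} (hu : IsCk N 2 u) (hv : IsCk N 2 v)
    (hμ : LaplaceEigen μ u) (hμ' : LaplaceEigen μ' v) :
    (μ - μ') * ∫ z, u z * v z ∂surf m n = 0 := by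
  have h := integral_mul_sphLaplacian_comm hu hv
  have h1 : ∀ z, u z * sphLaplacian v z = -μ' * (u z * v z) := fun z => by
    have := hμ' z
    linear_combination -u z * this
  have h2 : ∀ z, v z * sphLaplacian u z = -μ * (u z * v z) := fun z => by
    have := hμ z
    linear_combination -v z * this
  simp_rw [h1, h2] at h
  rw [integral_const_mul, integral_const_mul] at h
  linarith

theorem integral_Phi_mul_Phi (hm : 1 ≤ m) (hn : 1 ≤ n) {i j : ℕ} (hij : i ≠ j) :
    ∫ z, Phi m n i z * Phi m n j z ∂surf m n = 0 := by
  -- The dimension does not occur in the statement, so it is supplied here; `1 ≤ m` makes the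
  -- truncated subtraction exact.
  have hN : Fact (m + n = (m + n - 1) + 1) := ⟨by omega⟩
  have h := eigen_sub_mul_integral (N := m + n - 1) (isCk_Phi i) (isCk_Phi j)
    (laplaceEigen_Phi (N := m + n - 1) hm hn i) (laplaceEigen_Phi (N := m + n - 1) hm hn j)
  exact (mul_eq_zero.mp h).resolve_left
    (sub_ne_zero.mpr fun h => hij ((lam_strictMono (by omega)).injective h))

theorem integral_sq_pos {u : Sph m n → ℝ} (hu : Continuous u) (h0 : u ≠ 0) :
    0 < ∫ z, u z * u z ∂surf m n := by
  obtain ⟨z, hz⟩ : ∃ z, u z ≠ 0 := by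
    by_contra! h
    exact h0 (funext h)
  exact (hu.mul hu).integral_pos_of_hasCompactSupport_nonneg_nonzero
    (HasCompactSupport.of_compactSpace _) (fun z => mul_self_nonneg _) (mul_self_ne_zero.mpr hz)

theorem memLp_of_continuous {F : Type*} [NormedAddCommGroup F] {ν : Measure (Sph m n)}
    [IsFiniteMeasure ν] [SecondCountableTopology F] {u : Sph m n → F} (hu : Continuous u) : MemLp u 2 ν :=
  hu.memLp_of_hasCompactSupport (HasCompactSupport.of_compactSpace u)

theorem eq_zero_of_integral_mul_Phi (hm : 1 ≤ m) (hn : 1 ≤ n) {w : Sph m n → ℝ}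
    (hw : Continuous w) (hG : GInvariant w) (h : ∀ i, ∫ z, w z * Phi m n i z ∂surf m n = 0) :
    w = 0 :=
  Continuous.ae_eq_iff_eq (surf m n) hw continuous_zero |>.mp
    (ae_eq_zero_of_integral_mul_Phi hm hn (memLp_of_continuous hw) hG.aeGInvariant h)

/-- Subtract from `u` its projection onto `Φ_i`. The remainder is orthogonal to `Φ_i` by
construction and to the other `Φ_j` because the eigenvalues differ, so completeness makes it zero.
-/
theorem eq_smul_Phi (hm : 1 ≤ m) (hn : 1 ≤ n) (i : ℕ) {u : Sph m n → ℝ} (hu : IsCk N 2 u)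
    (hG : GInvariant u) (he : LaplaceEigen (lam N i) u) : ∃ a : ℝ, u = a • Phi m n i := by
  have hN : m + n = N + 1 := Fact.out
  have hpos := integral_sq_pos (continuous_Phi (m := m) (n := n) i) (Phi_ne_zero hm hn i)
  set a := (∫ z, u z * Phi m n i z ∂surf m n) / ∫ z, Phi m n i z * Phi m n i z ∂surf m n with ha
  refine ⟨a, ?_⟩
  rw [← sub_eq_zero]
  refine eq_zero_of_integral_mul_Phi hm hn
    (hu.continuous.sub ((continuous_Phi i).const_smul a)) (fun A B z => ?_) fun j => ?_
  · simp [hG A B z, gInvariant_Phi i A B z]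
  · have h1 : Integrable (fun z => u z * Phi m n j z) (surf m n) :=
      integrable_surf_of_continuous (hu.continuous.mul (continuous_Phi j))
    have h2 : Integrable (fun z => Phi m n i z * Phi m n j z) (surf m n) :=
      integrable_surf_of_continuous ((continuous_Phi i).mul (continuous_Phi j))
    have h3 : ∫ z, (u - a • Phi m n i) z * Phi m n j z ∂surf m n =
        ∫ z, u z * Phi m n j z ∂surf m n - a * ∫ z, Phi m n i z * Phi m n j z ∂surf m n := by
      rw [← integral_const_mul, ← integral_sub h1 (h2.const_mul a)]
      refine integral_congr_ae (Eventually.of_forall fun z => ?_)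
      simp
      ring
    rw [h3]
    by_cases hij : i = j
    · subst hij
      rw [ha, div_mul_cancel₀ _ hpos.ne', sub_self]
    · rw [integral_Phi_mul_Phi hm hn hij, mul_zero, sub_zero]
      have h := eigen_sub_mul_integral hu (isCk_Phi j) he
        (laplaceEigen_Phi (N := N) hm hn j)
      exact (mul_eq_zero.mp h).resolve_left
        (sub_ne_zero.mpr fun h => hij ((lam_strictMono (by omega)).injective h))

/-- An eigenfunction for any other eigenvalue would be orthogonal to every `Φ_j`, against
completeness. -/
theorem exists_eq_lam (hm : 1 ≤ m) (hn : 1 ≤ n) {μ : ℝ} {u : Sph m n → ℝ} (hu : IsCk N 2 u)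
    (hG : GInvariant u) (h0 : u ≠ 0) (he : LaplaceEigen μ u) : ∃ i, μ = lam N i := by
  by_contra! hne
  refine h0 (eq_zero_of_integral_mul_Phi hm hn hu.continuous hG fun j => ?_)
  have h := eigen_sub_mul_integral hu (isCk_Phi j) he
        (laplaceEigen_Phi (N := N) hm hn j)
  exact (mul_eq_zero.mp h).resolve_left (sub_ne_zero.mpr (hne j))

theorem inner_Lp_eq {ν : Measure (Sph m n)} (u v : Lp ℝ 2 ν) :
    ⟪u, v⟫_ℝ = ∫ z, u z * v z ∂ν := by
  rw [L2.inner_def]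
  exact integral_congr_ae (Eventually.of_forall fun z => by simp [mul_comm])

theorem exists_basis_L2 (hm : 1 ≤ m) (hn : 1 ≤ n) :
    ∃ e : ℕ → L2 m n, (∀ i, e i =ᵐ[surf m n] Phi m n i) ∧ IsOrthogonalBasis e (L2G m n) := by
  have hmem : ∀ i, MemLp (Phi m n i) 2 (surf m n) := fun i => memLp_of_continuous (continuous_Phi i)
  have hin : ∀ (p : L2 m n) i, ⟪(hmem i).toLp, p⟫_ℝ = ∫ z, p z * Phi m n i z ∂surf m n :=
    fun p i => by
      rw [inner_Lp_eq]
      refine integral_congr_ae ?_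
      filter_upwards [(hmem i).coeFn_toLp] with z hz
      rw [hz, mul_comm]
  refine ⟨fun i => (hmem i).toLp, fun i => (hmem i).coeFn_toLp, ?_⟩
  refine isOrthogonalBasis_of_total (K := invariantLp (surf m n) rfl)
    (isClosed_invariantLp _ rfl measurePreserving_act) (fun i => ?_) (fun i h => ?_)
    (fun i j hij => ?_) fun p hp h => ?_
  · exact (gInvariant_Phi i).aeGInvariant.congr (hmem i).coeFn_toLp.symm
  · have h1 := (hmem i).coeFn_toLp.symm.trans ((Lp.eq_zero_iff_ae_eq_zero).mp h)
    exact Phi_ne_zero hm hn i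
      (Continuous.ae_eq_iff_eq (surf m n) (continuous_Phi i) continuous_zero |>.mp h1)
  · rw [hin, ← integral_Phi_mul_Phi hm hn hij.symm]
    refine integral_congr_ae ?_
    filter_upwards [(hmem j).coeFn_toLp] with z hz
    rw [hz]
  · rw [Lp.eq_zero_iff_ae_eq_zero]
    exact ae_eq_zero_of_integral_mul_Phi hm hn (Lp.memLp p) hp fun i => by rw [← hin, h i]

end Phi

/-! ### The first-order Sobolev space -/

section SobolevOne

theorem two_le_infty : (2 : WithTop ℕ∞) ≤ (∞ : WithTop ℕ∞) := WithTop.coe_le_coe.mpr le_top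

variable {N m n : ℕ} [Fact (m + n = N + 1)]

theorem exists_representsH1 {u : Sph m n → ℝ} (hu : IsCk N 2 u) :
    ∃ p : H1Pair m n, RepresentsH1 u p :=
  ⟨WithLp.toLp 2 ((memLp_of_continuous hu.continuous).toLp,
    (memLp_of_continuous (hu.continuous_sphGradient (by norm_num))).toLp),
    MemLp.coeFn_toLp (memLp_of_continuous hu.continuous),
    MemLp.coeFn_toLp (memLp_of_continuous (hu.continuous_sphGradient (by norm_num)))⟩

/-- Green's formula puts both derivatives on `v`, so that the pairing sees only the first component
of `p`. An identity of this form survives passage to the closure. -/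
theorem inner_representsH1 {u v : Sph m n → ℝ} (hu : IsCk N 2 u) (hv : IsCk N 2 v)
    {p q : H1Pair m n} (hp : RepresentsH1 u p) (hq : RepresentsH1 v q) :
    ⟪q, p⟫_ℝ = ∫ z, u z * (v z - sphLaplacian v z) ∂surf m n := by
  rw [WithLp.prod_inner_apply]
  have h1 : ⟪q.ofLp.1, p.ofLp.1⟫_ℝ = ∫ z, u z * v z ∂surf m n := by
    rw [inner_Lp_eq]
    refine integral_congr_ae ?_
    filter_upwards [hp.1, hq.1] with z h1 h2
    rw [mul_comm]
    exact congrArg₂ _ h1 h2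
  have h2 : ⟪q.ofLp.2, p.ofLp.2⟫_ℝ = ∫ z, ⟪sphGradient u z, sphGradient v z⟫_ℝ ∂surf m n := by
    rw [L2.inner_def]
    refine integral_congr_ae ?_
    filter_upwards [hp.2, hq.2] with z h1 h2
    rw [real_inner_comm]
    exact congrArg₂ _ h1 h2
  rw [h1, h2, integral_inner_sphGradient hu hv, ← sub_eq_add_neg, ← integral_sub]
  · simp only [mul_sub]
  · exact integrable_surf_of_continuous (hu.continuous.mul hv.continuous)
  · exact integrable_surf_of_continuous (hu.continuous.mul hv.continuous_sphLaplacian)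

theorem continuous_withLp_fst {E F : Type*} [NormedAddCommGroup E] [NormedAddCommGroup F] :
    Continuous fun p : WithLp 2 (E × F) => p.fst :=
  continuous_fst.comp (WithLp.prod_continuous_ofLp 2 E F)

theorem isClosed_setOf_inner_eq {E F : Type*} [NormedAddCommGroup E] [InnerProductSpace ℝ E]
    [NormedAddCommGroup F] [InnerProductSpace ℝ F] (q : WithLp 2 (E × F)) (r : E) :
    IsClosed {p : WithLp 2 (E × F) | ⟪q, p⟫_ℝ = ⟪r, p.fst⟫_ℝ} :=
  isClosed_eq (continuous_const.inner continuous_id)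
    (continuous_const.inner continuous_withLp_fst)

/-- An identity `⟨q, p⟩ = ⟨r, p.1⟩` extends to the closed span. -/
theorem inner_eq_inner_fst_of_mem_closure {E F : Type*} [NormedAddCommGroup E]
    [InnerProductSpace ℝ E] [NormedAddCommGroup F] [InnerProductSpace ℝ F] {q : WithLp 2 (E × F)}
    {r : E} {S : Set (WithLp 2 (E × F))} (h : ∀ p ∈ S, ⟪q, p⟫_ℝ = ⟪r, p.fst⟫_ℝ)
    {p : WithLp 2 (E × F)} (hp : p ∈ (Submodule.span ℝ S).topologicalClosure) :
    ⟪q, p⟫_ℝ = ⟪r, p.fst⟫_ℝ := by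
  refine closure_minimal (t := {p : WithLp 2 (E × F) | ⟪q, p⟫_ℝ = ⟪r, p.fst⟫_ℝ}) (fun p hp => ?_)
    (isClosed_setOf_inner_eq q r) hp
  simp only [Set.mem_ofPred_eq]
  induction hp using Submodule.span_induction with
  | mem p hp => exact h p hp
  | zero => simp
  | add p p' _ _ h1 h2 => rw [inner_add_right, h1, h2, WithLp.add_fst, inner_add_right]
  | smul c p _ h1 => rw [inner_smul_right, h1, WithLp.smul_fst, inner_smul_right]

theorem inner_H1 {v : Sph m n → ℝ} (hv : IsCk N 2 v) {p q : H1Pair m n} (hp : p ∈ H1 N m n)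
    (hq : RepresentsH1 v q) :
    ⟪q, p⟫_ℝ = ∫ z, p.fst z * (v z - sphLaplacian v z) ∂surf m n := by
  have hmem : MemLp (fun z => v z - sphLaplacian v z) 2 (surf m n) :=
    memLp_of_continuous (hv.continuous.sub hv.continuous_sphLaplacian)
  have hin : ∀ w : L2 m n, ⟪hmem.toLp, w⟫_ℝ = ∫ z, w z * (v z - sphLaplacian v z) ∂surf m n :=
    fun w => by
      rw [inner_Lp_eq]
      refine integral_congr_ae ?_
      filter_upwards [hmem.coeFn_toLp] with z hz
      rw [hz, mul_comm]
  rw [← hin]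
  refine inner_eq_inner_fst_of_mem_closure ?_ hp
  rintro p ⟨u, hu, hpu⟩
  rw [inner_representsH1 (hu.of_le two_le_infty) hv hpu hq, hin]
  refine integral_congr_ae ?_
  filter_upwards [hpu.1] with z hz
  rw [hz]

/-- Against `Φ_i` the inner product is `1 + λ_i` times the `L²` pairing. The factor is positive, so
orthogonality and totality carry over. -/
theorem exists_basis_H1 (hm : 1 ≤ m) (hn : 1 ≤ n) :
    ∃ e : ℕ → H1Pair m n,
      (∀ i, RepresentsH1 (Phi m n i) (e i)) ∧ IsOrthogonalBasis e (H1G N m n) := by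
  have hN : m + n = N + 1 := Fact.out
  choose e he using fun i => exists_representsH1 (N := N) (isCk_Phi (m := m) (n := n) i)
  have heH : ∀ i, e i ∈ H1 N m n := fun i =>
    Submodule.le_topologicalClosure _ (Submodule.subset_span ⟨_, isCk_Phi i, he i⟩)
  have hin : ∀ i, ∀ p ∈ H1 N m n,
      ⟪e i, p⟫_ℝ = (1 + lam N i) * ∫ z, p.fst z * Phi m n i z ∂surf m n := fun i p hp => by
    rw [inner_H1 (isCk_Phi i) hp (he i), ← integral_const_mul]
    refine integral_congr_ae (Eventually.of_forall fun z => ?_)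
    have := laplaceEigen_Phi (N := N) hm hn i z
    linear_combination p.fst z * this
  have hlam : ∀ i, 1 + lam N i ≠ 0 := fun i => by
    have := lam_nonneg (N := N) (by omega) i
    positivity
  have hcl : IsClosed (invariantLp (surf m n) rfl : Set (L2 m n)) :=
    isClosed_invariantLp _ rfl measurePreserving_act
  let K : Submodule ℝ (H1Pair m n) := H1 N m n ⊓
    { carrier := {p | p.fst ∈ invariantLp (surf m n) rfl}
      zero_mem' := Submodule.zero_mem (invariantLp (surf m n) rfl)
      add_mem' := fun {p q} hp hq => Submodule.add_mem (invariantLp (surf m n) rfl) hp hq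
      smul_mem' := fun c p hp => Submodule.smul_mem (invariantLp (surf m n) rfl) c hp }
  refine ⟨e, he, ?_⟩
  refine isOrthogonalBasis_of_total (K := K) ?_ (fun i => ?_) (fun i h => ?_)
    (fun i j hij => ?_) fun p hp h => ?_
  · exact (Submodule.isClosed_topologicalClosure _).inter (hcl.preimage continuous_withLp_fst)
  · exact ⟨heH i, (gInvariant_Phi i).aeGInvariant.congr (he i).1.symm⟩
  · have h1 : (e i).fst = 0 := by rw [h]; rfl
    have h2 := (he i).1.symm.trans ((Lp.eq_zero_iff_ae_eq_zero).mp h1)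
    exact Phi_ne_zero hm hn i
      (Continuous.ae_eq_iff_eq (surf m n) (continuous_Phi i) continuous_zero |>.mp h2)
  · rw [hin i _ (heH j)]
    refine mul_eq_zero_of_right _ ?_
    rw [← integral_Phi_mul_Phi hm hn hij.symm]
    refine integral_congr_ae ?_
    filter_upwards [(he j).1] with z hz
    rw [hz]
  · have h1 : p.fst = 0 := by
      rw [Lp.eq_zero_iff_ae_eq_zero]
      refine ae_eq_zero_of_integral_mul_Phi hm hn (Lp.memLp _) hp.2 fun i => ?_
      have := h i
      rw [hin i p hp.1] at this
      exact (mul_eq_zero.mp this).resolve_left (hlam i)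
    -- With zero first component, `p` is orthogonal to all smooth pairs, hence to their closed span,
    -- and in particular to itself.
    have h2 : ∀ q ∈ H1 N m n, ⟪p, q⟫_ℝ = ⟪(0 : L2 m n), q.fst⟫_ℝ := fun q hq => by
      refine inner_eq_inner_fst_of_mem_closure ?_ hq
      rintro q ⟨v, hv, hqv⟩
      rw [real_inner_comm, inner_H1 (hv.of_le two_le_infty) hp.1 hqv, inner_zero_left]
      refine integral_eq_zero_of_ae ?_
      filter_upwards [(Lp.eq_zero_iff_ae_eq_zero).mp h1] with z hz
      rw [hz]
      simp
    have h3 := h2 p hp.1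
    rwa [inner_zero_left, inner_self_eq_zero] at h3

end SobolevOne

/-! ### Determination by moments -/

section Moments

/-- Finite measures on `[-1, 1]` with the same moments agree. -/
theorem measure_eq_of_moments {μ ν : Measure ℝ} [IsFiniteMeasure μ] [IsFiniteMeasure ν]
    (hμ : ∀ᵐ t ∂μ, t ∈ Set.Icc (-1 : ℝ) 1) (hν : ∀ᵐ t ∂ν, t ∈ Set.Icc (-1 : ℝ) 1)
    (h : ∀ k : ℕ, ∫ t, t ^ k ∂μ = ∫ t, t ^ k ∂ν) : μ = ν := by
  have hint : ∀ (ρ : Measure ℝ) [IsFiniteMeasure ρ], (∀ᵐ t ∂ρ, t ∈ Set.Icc (-1 : ℝ) 1) →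
      ∀ g : ℝ → ℝ, Continuous g → Integrable g ρ := fun ρ _ hρ g hg => by
    obtain ⟨C, hC⟩ := (isCompact_Icc (a := (-1 : ℝ)) (b := 1)).exists_bound_of_continuousOn
      hg.continuousOn
    exact Integrable.of_bound hg.aestronglyMeasurable C (hρ.mono fun t ht => hC t ht)
  have hpoly : ∀ p : ℝ[X], ∫ t, p.eval t ∂μ = ∫ t, p.eval t ∂ν := fun p => by
    simp only [eval_eq_sum_range]
    rw [integral_finsetSum, integral_finsetSum]
    · simp_rw [integral_const_mul, h]
    · exact fun i _ => hint ν hν _ (by fun_prop)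
    · exact fun i _ => hint μ hμ _ (by fun_prop)
  refine ext_of_forall_integral_eq_of_IsFiniteMeasure fun g => ?_
  have hb : ∀ (ρ : Measure ℝ) [IsFiniteMeasure ρ], (∀ᵐ t ∂ρ, t ∈ Set.Icc (-1 : ℝ) 1) →
      ∀ (ε : ℝ) (p : ℝ[X]), (∀ t ∈ Set.Icc (-1 : ℝ) 1, |p.eval t - g t| < ε) →
      |∫ t, p.eval t ∂ρ - ∫ t, g t ∂ρ| ≤ ε * ρ.real Set.univ := fun ρ _ hρ ε p hp => by
    rw [← integral_sub (hint ρ hρ _ p.continuous) (hint ρ hρ _ g.continuous), ← Real.norm_eq_abs]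
    exact norm_integral_le_of_norm_le_const (hρ.mono fun t ht => (hp t ht).le)
  by_contra hne
  have hpos := abs_pos.mpr (sub_ne_zero.mpr hne)
  set c := |∫ t, g t ∂μ - ∫ t, g t ∂ν| with hc
  set M := μ.real Set.univ + ν.real Set.univ + 1 with hM
  have hM0 : 0 < M := by positivity
  obtain ⟨p, hp⟩ := exists_polynomial_near_of_continuousOn (-1) 1 g g.continuous.continuousOn
    -- With `M` larger than the sum of the two masses, the two approximation errors add up to less
    -- than `c`.
    (c / (2 * M)) (by positivity)
  have h1 := hb μ hμ _ p hp
  have h2 := hb ν hν _ p hp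
  rw [← hpoly p] at h2
  have h3 : c ≤ c / (2 * M) * μ.real Set.univ + c / (2 * M) * ν.real Set.univ := by
    have h4 : ∫ t, g t ∂μ - ∫ t, g t ∂ν = (∫ t, p.eval t ∂μ - ∫ t, g t ∂ν) -
      (∫ t, p.eval t ∂μ - ∫ t, g t ∂μ) := by ring
    rw [hc]
    nth_rewrite 1 [h4]
    refine (abs_sub _ _).trans ?_
    linarith
  have h5 : c / (2 * M) * M = c / 2 := by field_simp
  have h6 : 0 < c / (2 * M) := by positivity
  have : c / (2 * M) * μ.real Set.univ + c / (2 * M) * ν.real Set.univ = c / 2 - c / (2 * M) := by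
    rw [← h5, hM]; ring
  linarith

theorem integral_map_withDensity {X : Type*} [MeasurableSpace X] {μ : Measure X} {d : X → ℝ}
    (hd : Measurable d) (h0 : ∀ x, 0 ≤ d x) {π : X → ℝ} (hπ : Measurable π) {g : ℝ → ℝ}
    (hg : Measurable g) :
    ∫ t, g t ∂(μ.withDensity fun x => ENNReal.ofReal (d x)).map π = ∫ x, d x * g (π x) ∂μ := by
  rw [integral_map hπ.aemeasurable hg.aestronglyMeasurable,
    integral_withDensity_eq_integral_toReal_smul hd.ennreal_ofReal
      (Eventually.of_forall fun x => ENNReal.ofReal_lt_top)]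
  exact integral_congr_ae (Eventually.of_forall fun x => by simp [ENNReal.toReal_ofReal (h0 x)])

theorem isFiniteMeasure_map_withDensity {X : Type*} [MeasurableSpace X] {μ : Measure X} {d : X → ℝ}
    (hd : Integrable d μ) {π : X → ℝ} :
    IsFiniteMeasure ((μ.withDensity fun x => ENNReal.ofReal (d x)).map π) := by
  have : IsFiniteMeasure (μ.withDensity fun x => ENNReal.ofReal (d x)) :=
    isFiniteMeasure_withDensity_ofReal hd.2
  infer_instance

/-- If all moments of `d` along `π` vanish, `d` is orthogonal to all functions of `π`. -/
theorem integral_mul_comp_eq_zero_of_moments {X : Type*} [MeasurableSpace X] {μ : Measure X}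
    {d π : X → ℝ} (hdm : Measurable d) (hd : Integrable d μ) (hπ : Measurable π)
    (hπI : ∀ x, π x ∈ Set.Icc (-1 : ℝ) 1) (h : ∀ k : ℕ, ∫ x, d x * π x ^ k ∂μ = 0) {g : ℝ → ℝ}
    (hg : Measurable g) (hdg : Integrable (fun x => d x * g (π x)) μ) :
    ∫ x, d x * g (π x) ∂μ = 0 := by
  -- The positive and negative parts of `d` are densities whose images under `π` are finite measures
  -- on `[-1, 1]` with equal moments. They coincide as measures, which allows an unbounded `g`.
  have hsplit : ∀ g : ℝ → ℝ, Measurable g → Integrable (fun x => d x * g (π x)) μ →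
      ∫ x, d x * g (π x) ∂μ = ∫ x, max (d x) 0 * g (π x) ∂μ - ∫ x, max (-d x) 0 * g (π x) ∂μ :=
    fun g hg hdg => by
      have hb : ∀ c : X → ℝ, Measurable c → (∀ x, |c x| ≤ |d x|) →
          Integrable (fun x => c x * g (π x)) μ := fun c hc hcd => by
        refine hdg.mono (hc.mul (hg.comp hπ)).aestronglyMeasurable (Eventually.of_forall fun x => ?_)
        rw [norm_mul, norm_mul]
        exact mul_le_mul_of_nonneg_right (hcd x) (norm_nonneg _)
      rw [← integral_sub]
      · refine integral_congr_ae (Eventually.of_forall fun x => ?_)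
        simp only
        rw [← sub_mul]
        congr 1
        rcases le_total (d x) 0 with h | h
        · rw [max_eq_right h, max_eq_left (by linarith)]; ring
        · rw [max_eq_left h, max_eq_right (by linarith)]; ring
      · refine hb _ (hdm.max measurable_const) fun x => ?_
        rw [abs_of_nonneg (le_max_right _ _)]
        exact max_le (le_abs_self _) (abs_nonneg _)
      · refine hb _ (hdm.neg.max measurable_const) fun x => ?_
        rw [abs_of_nonneg (le_max_right _ _)]
        exact max_le (neg_le_abs _) (abs_nonneg _)
  have hdn : Measurable fun x => max (-d x) 0 := hdm.neg.max measurable_const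
  have h1 : IsFiniteMeasure ((μ.withDensity fun x => ENNReal.ofReal (max (d x) 0)).map π) :=
    isFiniteMeasure_map_withDensity hd.pos_part
  have h2 : IsFiniteMeasure ((μ.withDensity fun x => ENNReal.ofReal (max (-d x) 0)).map π) :=
    isFiniteMeasure_map_withDensity hd.neg_part
  have hI : ∀ ρ : Measure X, ∀ᵐ t ∂(ρ.map π), t ∈ Set.Icc (-1 : ℝ) 1 := fun ρ => by
    exact (ae_map_iff (p := fun t => t ∈ Set.Icc (-1 : ℝ) 1) hπ.aemeasurable measurableSet_Icc).mpr
      (Eventually.of_forall hπI)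
  have heq := measure_eq_of_moments (hI (μ.withDensity fun x => ENNReal.ofReal (max (d x) 0)))
    (hI (μ.withDensity fun x => ENNReal.ofReal (max (-d x) 0))) fun k => by
      rw [integral_map_withDensity (hdm.max measurable_const) (fun x => le_max_right _ _) hπ
        (by fun_prop), integral_map_withDensity hdn
        (fun x => le_max_right _ _) hπ (by fun_prop)]
      refine sub_eq_zero.mp ((hsplit (fun t => t ^ k) (by fun_prop) ?_).symm.trans (h k))
      refine hd.mul_bdd (c := 1) (by fun_prop) (Eventually.of_forall fun x => ?_)
      rw [norm_pow]
      exact pow_le_one₀ (norm_nonneg _) (abs_le.mpr (hπI x))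
  rw [hsplit g hg hdg, sub_eq_zero,
    ← integral_map_withDensity (hdm.max measurable_const) (fun x => le_max_right _ _) hπ hg,
    ← integral_map_withDensity hdn (fun x => le_max_right _ _) hπ hg, heq]

/-- The recursion for the moments of an eigenfunction. -/
structure MomentRec (N : ℕ) (μ : ℝ) (a : ℕ → ℝ) : Prop where
  zero : (ev N 0 - μ) * a 0 = 0
  one : (ev N 1 - μ) * a 1 = 0
  step : ∀ k, (ev N (k + 2) - μ) * a (k + 2) = (k + 2) * (k + 1) * a k

theorem MomentRec.sub_smul {N : ℕ} {μ : ℝ} {a b : ℕ → ℝ} (ha : MomentRec N μ a)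
    (hb : MomentRec N μ b) (c : ℝ) : MomentRec N μ fun k => a k - c * b k :=
  ⟨by linear_combination ha.zero - c * hb.zero, by linear_combination ha.one - c * hb.one,
    fun k => by linear_combination ha.step k - c * hb.step k⟩

/-- Zero propagates from index `k` to `k + 2` except where the left coefficient vanishes, that is
where `ev N k = μ`. -/
theorem MomentRec.eq_zero {N : ℕ} {μ : ℝ} {a : ℕ → ℝ} (ha : MomentRec N μ a)
    (h : ∀ k, ev N k = μ → a k = 0) : ∀ k, a k = 0
  | 0 => (mul_eq_zero.mp ha.zero).elim (fun h0 => h 0 (sub_eq_zero.mp h0)) id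
  | 1 => (mul_eq_zero.mp ha.one).elim (fun h0 => h 1 (sub_eq_zero.mp h0)) id
  | k + 2 => by
    have := ha.step k
    rw [ha.eq_zero h k, mul_zero] at this
    exact (mul_eq_zero.mp this).elim (fun h0 => h _ (sub_eq_zero.mp h0)) id

theorem ev_injective {N : ℕ} (hN : 1 ≤ N) : Function.Injective (ev N) := by
  have hN' : (1 : ℝ) ≤ N := by exact_mod_cast hN
  refine (strictMono_nat_of_lt_succ fun i => ?_).injective
  have : (0 : ℝ) ≤ i := Nat.cast_nonneg i
  simp only [ev]
  push_cast
  nlinarith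

end Moments

/-! ### Zonal moments of eigenfunctions and the Funk–Hecke formula -/

section FunkHecke

variable {N m n : ℕ} [Fact (m + n = N + 1)]

theorem continuous_zonal (z : Sph m n) : Continuous (zonal z) := by
  unfold zonal
  fun_prop

theorem zonal_mem_Icc (z ζ : Sph m n) : zonal z ζ ∈ Set.Icc (-1 : ℝ) 1 := by
  have h := abs_real_inner_le_norm (z : Ambient m n) (ζ : Ambient m n)
  rw [z.norm_eq, ζ.norm_eq, mul_one] at h
  exact abs_le.mp h

theorem dist_sq_eq (z ζ : Sph m n) : dist z ζ ^ 2 = 2 - 2 * zonal z ζ := by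
  rw [Subtype.dist_eq, dist_eq_norm_sub, norm_sub_sq_real, z.norm_eq, ζ.norm_eq, zonal]
  ring

theorem dist_eq_sqrt (z ζ : Sph m n) : dist z ζ = Real.sqrt (2 - 2 * zonal z ζ) := by
  rw [← dist_sq_eq, Real.sqrt_sq dist_nonneg]

theorem sphLaplacian_zonal_pow (z ζ : Sph m n) (k : ℕ) :
    sphLaplacian (fun ζ => zonal z ζ ^ (k + 2)) ζ =
      (k + 2) * (k + 1) * zonal z ζ ^ k - ev N (k + 2) * zonal z ζ ^ (k + 2) := by
  have h := sphLaplacian_eval_zonal (N := N) (X ^ (k + 2)) z ζ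
  simp only [eval_pow, eval_X] at h
  rw [h]
  simp [ev]
  ring

/-- Green's formula moves the Laplacian from `v` onto `⟨z, ·⟩^k`, where the Gegenbauer operator
yields a combination of the powers `k` and `k - 2`. -/
theorem momentRec {μ : ℝ} {v : Sph m n → ℝ} (hv : IsCk N 2 v) (he : LaplaceEigen μ v)
    (z : Sph m n) : MomentRec N μ fun k => ∫ ζ, v ζ * zonal z ζ ^ k ∂surf m n := by
  have key : ∀ p : ℝ[X], ∫ ζ, v ζ * sphLaplacian (fun ζ => p.eval (zonal z ζ)) ζ ∂surf m n =
      -μ * ∫ ζ, v ζ * p.eval (zonal z ζ) ∂surf m n := fun p => by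
    rw [integral_mul_sphLaplacian_comm hv (isCk_eval_zonal p z), ← integral_const_mul]
    refine integral_congr_ae (Eventually.of_forall fun ζ => ?_)
    have := he ζ
    linear_combination -(p.eval (zonal z ζ)) * this
  have hint : ∀ k : ℕ, Integrable (fun ζ => v ζ * zonal z ζ ^ k) (surf m n) := fun k =>
    integrable_surf_of_continuous (hv.continuous.mul ((continuous_zonal z).pow k))
  constructor
  · have h := key 1
    simp only [sphLaplacian_eval_zonal (N := N)] at h
    simp at h
    simp [ev]
    exact h
  · have h := key X
    simp only [sphLaplacian_eval_zonal (N := N)] at h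
    simp [-neg_mul] at h
    have h2 : ∫ ζ, v ζ * (N * zonal z ζ) ∂surf m n = N * ∫ ζ, v ζ * zonal z ζ ∂surf m n := by
      rw [← integral_const_mul]
      exact integral_congr_ae (Eventually.of_forall fun ζ => by ring)
    rw [integral_neg, h2] at h
    have h3 : ev N 1 = N := by simp [ev]
    simp only [pow_one, h3]
    linarith
  · intro k
    have h := key (X ^ (k + 2))
    simp only [eval_pow, eval_X, sphLaplacian_zonal_pow (N := N), mul_sub] at h
    have h2 : ∫ ζ, (v ζ * ((k + 2) * (k + 1) * zonal z ζ ^ k)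
        - v ζ * (ev N (k + 2) * zonal z ζ ^ (k + 2))) ∂surf m n =
        (k + 2) * (k + 1) * ∫ ζ, v ζ * zonal z ζ ^ k ∂surf m n
          - ev N (k + 2) * ∫ ζ, v ζ * zonal z ζ ^ (k + 2) ∂surf m n := by
      rw [← integral_const_mul, ← integral_const_mul, ← integral_sub
        ((hint k).const_mul _) ((hint (k + 2)).const_mul _)]
      exact integral_congr_ae (Eventually.of_forall fun ζ => by ring)
    rw [h2] at h
    linarith

/-- A continuous function all of whose zonal moments at `z` vanish is zero at `z`. -/
theorem eq_zero_of_moments {d : Sph m n → ℝ} (hd : Continuous d) {z : Sph m n}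
    (h : ∀ k : ℕ, ∫ ζ, d ζ * zonal z ζ ^ k ∂surf m n = 0) : d z = 0 := by
  by_contra hne
  obtain ⟨δ, hδ, hball⟩ := Metric.continuous_iff.mp hd z (|d z|) (abs_pos.mpr hne)
  -- As a function of `ζ` this is `max 0 (δ² - |z - ζ|²)`, a bump supported in the ball where `d`
  -- keeps the sign of `d z`.
  let g : ℝ → ℝ := fun t => max 0 (δ ^ 2 - (2 - 2 * t))
  have hg : Continuous g := by fun_prop
  have h0 := integral_mul_comp_eq_zero_of_moments hd.measurable (integrable_surf_of_continuous hd)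
    (continuous_zonal z).measurable (zonal_mem_Icc z) h hg.measurable
    (integrable_surf_of_continuous (hd.mul (hg.comp (continuous_zonal z))))
  have hpos : 0 < ∫ ζ, d z * (d ζ * g (zonal z ζ)) ∂surf m n := by
    refine Continuous.integral_pos_of_hasCompactSupport_nonneg_nonzero
      (continuous_const.mul (hd.mul (hg.comp (continuous_zonal z))))
      (HasCompactSupport.of_compactSpace _) (fun ζ => ?_) (x := z) ?_
    · simp only [Pi.zero_apply, ← dist_sq_eq, g]
      by_cases hζ : dist ζ z < δ
      · have h1 := hball ζ hζ
        rw [Real.dist_eq] at h1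
        rw [← mul_assoc]
        refine mul_nonneg ?_ (le_max_left _ _)
        rcases abs_cases (d z) with ⟨h2, _⟩ | ⟨h2, _⟩ <;> rw [h2] at h1 <;>
          have h3 := abs_lt.mp h1
        · exact mul_nonneg (by linarith) (by linarith)
        · exact mul_nonneg_of_nonpos_of_nonpos (by linarith) (by linarith)
      · rw [max_eq_left]
        · simp
        · rw [dist_comm] at hζ
          nlinarith
    · simp only [g, zonal_self]
      rw [max_eq_right (by nlinarith)]
      have : δ ^ 2 - (2 - 2 * 1) ≠ 0 := by nlinarith
      exact mul_ne_zero hne (mul_ne_zero hne this)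
  rw [integral_const_mul, h0, mul_zero] at hpos
  exact lt_irrefl _ hpos

/-- The Gegenbauer polynomial normalized to have the value `1` at `1`. -/
def gegenOne (N l : ℕ) : ℝ[X] := C ((gegen N l).eval 1)⁻¹ * gegen N l

theorem gegenOne_eval_one (hN : 1 ≤ N) (l : ℕ) : (gegenOne N l).eval 1 = 1 := by
  have hN' : (1 : ℝ) ≤ N := by exact_mod_cast hN
  have := jacobi_eval_one_pos (α := (N : ℝ) / 2 - 1) (β := (N : ℝ) / 2 - 1) (by linarith)
    (by linarith) l
  rw [gegenOne, eval_mul, eval_C]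
  exact inv_mul_cancel₀ this.ne'

theorem gegenOne_ode (hN : 1 ≤ N) (l : ℕ) (t : ℝ) :
    (1 - t ^ 2) * (derivative (derivative (gegenOne N l))).eval t
      - N * t * (derivative (gegenOne N l)).eval t + ev N l * (gegenOne N l).eval t = 0 := by
  simp only [gegenOne, derivative_C_mul, eval_mul, eval_C]
  linear_combination ((gegen N l).eval 1)⁻¹ * gegen_ode hN l t

theorem laplaceEigen_gegenOne (hN : 1 ≤ N) (l : ℕ) (z : Sph m n) :
    LaplaceEigen (ev N l) (fun ζ => (gegenOne N l).eval (zonal z ζ)) := by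
  intro ζ
  rw [sphLaplacian_eval_zonal (N := N)]
  linear_combination -gegenOne_ode hN l (zonal z ζ)

/-- No coefficient of the recursion vanishes, so all moments at every `z` are zero. -/
theorem eigen_eq_zero {μ : ℝ} {v : Sph m n → ℝ} (hv : IsCk N 2 v) (he : LaplaceEigen μ v)
    (hμ : ∀ l, ev N l ≠ μ) : v = 0 :=
  funext fun z => eq_zero_of_moments hv.continuous
    ((momentRec hv he z).eq_zero fun k hk => absurd hk (hμ k))

/-- The moments of `v` and of the zonal function `w` solve the same recursion, whose solutions are
determined by their `l`-th entry, so they are proportional. Since `w z = 1`, evaluation at `z`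
identifies the factor as `v z`. -/
theorem moments_eq (hN : 1 ≤ N) {l : ℕ} {v : Sph m n → ℝ} (hv : IsCk N 2 v)
    (he : LaplaceEigen (ev N l) v) (z : Sph m n) (k : ℕ) :
    ∫ ζ, (v ζ - v z * (gegenOne N l).eval (zonal z ζ)) * zonal z ζ ^ k ∂surf m n = 0 := by
  set w : Sph m n → ℝ := fun ζ => (gegenOne N l).eval (zonal z ζ) with hw
  have hwC : IsCk N 2 w := isCk_eval_zonal _ z
  have hR1 := momentRec hv he z
  have hR2 := momentRec hwC (laplaceEigen_gegenOne hN l z) z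
  set a : ℕ → ℝ := fun k => ∫ ζ, v ζ * zonal z ζ ^ k ∂surf m n
  set b : ℕ → ℝ := fun k => ∫ ζ, w ζ * zonal z ζ ^ k ∂surf m n
  -- Otherwise every moment of `w` would vanish, forcing `w z = 0`.
  have hb : b l ≠ 0 := fun hb => by
    have h0 := eq_zero_of_moments hwC.continuous
      (hR2.eq_zero fun k hk => by rw [ev_injective hN hk]; exact hb)
    rw [hw] at h0
    simp only [zonal_self, gegenOne_eval_one hN] at h0
    exact one_ne_zero h0
  have hdiff : ∀ (c : ℝ) (k : ℕ), ∫ ζ, (v ζ - c * w ζ) * zonal z ζ ^ k ∂surf m n = a k - c * b k :=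
    fun c k => by
      rw [← integral_const_mul, ← integral_sub]
      · exact integral_congr_ae (Eventually.of_forall fun ζ => by ring)
      · exact integrable_surf_of_continuous (hv.continuous.mul ((continuous_zonal z).pow k))
      · exact (integrable_surf_of_continuous
          (hwC.continuous.mul ((continuous_zonal z).pow k))).const_mul _
  have hzero : ∀ k, a k - a l / b l * b k = 0 :=
    (hR1.sub_smul hR2 (a l / b l)).eq_zero fun k hk => by
      rw [ev_injective hN hk, div_mul_cancel₀ _ hb, sub_self]
  have hz := eq_zero_of_moments (d := fun ζ => v ζ - a l / b l * w ζ) (z := z)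
    (hv.continuous.sub (continuous_const.mul hwC.continuous)) fun k => by
      rw [hdiff, hzero]
  have hw1 : w z = 1 := by simp only [hw, zonal_self, gegenOne_eval_one hN]
  simp only [hw1, mul_one] at hz
  rw [show v z = a l / b l by linarith, hdiff, hzero]

/-- The **Funk–Hecke formula**. -/
theorem funkHecke (hN : 1 ≤ N) {l : ℕ} {v : Sph m n → ℝ} (hv : IsCk N 2 v)
    (he : LaplaceEigen (ev N l) v) (z : Sph m n) {g : ℝ → ℝ} (hg : Measurable g)
    (hint : Integrable (fun ζ => g (zonal z ζ)) (surf m n)) :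
    ∫ ζ, g (zonal z ζ) * v ζ ∂surf m n =
      v z * ∫ ζ, g (zonal z ζ) * (gegenOne N l).eval (zonal z ζ) ∂surf m n := by
  have hw : Continuous fun ζ => (gegenOne N l).eval (zonal z ζ) :=
    (gegenOne N l).continuous.comp (continuous_zonal z)
  have hd : Continuous fun ζ => v ζ - v z * (gegenOne N l).eval (zonal z ζ) :=
    hv.continuous.sub (continuous_const.mul hw)
  have h := integral_mul_comp_eq_zero_of_moments hd.measurable (integrable_surf_of_continuous hd)
    (continuous_zonal z).measurable (zonal_mem_Icc z) (moments_eq hN hv he z) hg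
    ((integrable_mul_continuous hint hd).congr (Eventually.of_forall fun ζ => mul_comm _ _))
  rw [← integral_const_mul, ← sub_eq_zero, ← h, ← integral_sub
    (integrable_mul_continuous hint hv.continuous) ((integrable_mul_continuous hint hw).const_mul _)]
  exact integral_congr_ae (Eventually.of_forall fun ζ => by ring)

end FunkHecke

/-! ### The law of a coordinate on the sphere -/

section Pushforward

/-- The density of the distribution of a coordinate on the sphere `𝕊^N`, up to a constant. -/
def weight (N : ℕ) (t : ℝ) : ℝ := (1 - t ^ 2) ^ ((N : ℝ) / 2 - 1)

theorem continuous_weight {N : ℕ} (hN : 2 ≤ N) : Continuous (weight N) := by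
  have hN' : (2 : ℝ) ≤ N := by exact_mod_cast hN
  exact (continuous_const.sub (continuous_pow 2)).rpow_const fun t => Or.inr (by linarith)

theorem one_sub_sq_nonneg {t : ℝ} (ht : t ∈ Set.Icc (-1 : ℝ) 1) : 0 ≤ 1 - t ^ 2 := by
  nlinarith [ht.1, ht.2]

theorem weight_nonneg {N : ℕ} {t : ℝ} (ht : t ∈ Set.Icc (-1 : ℝ) 1) : 0 ≤ weight N t :=
  Real.rpow_nonneg (one_sub_sq_nonneg ht) _

theorem integral_weight_pos {N : ℕ} (hN : 2 ≤ N) : 0 < ∫ t in (-1 : ℝ)..1, weight N t := by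
  refine intervalIntegral.intervalIntegral_pos_of_pos_on
    ((continuous_weight hN).intervalIntegrable _ _) (fun t ht => ?_) (by norm_num)
  exact Real.rpow_pos_of_pos (by nlinarith [ht.1, ht.2]) _

/-- The power `(1 - t²)^(N/2)` is the integrating factor of the Gegenbauer operator. Its exponent is
at least 1, so the endpoints are included. -/
theorem hasDerivAt_mul_rpow {N : ℕ} (hN : 2 ≤ N) {q : ℝ → ℝ} {q' t : ℝ} (hq : HasDerivAt q q' t)
    (ht : t ∈ Set.Icc (-1 : ℝ) 1) :
    HasDerivAt (fun t => (1 - t ^ 2) ^ ((N : ℝ) / 2) * q t)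
      (weight N t * ((1 - t ^ 2) * q' - N * t * q t)) t := by
  have hN' : (2 : ℝ) ≤ N := by exact_mod_cast hN
  have h1 : HasDerivAt (fun t : ℝ => 1 - t ^ 2) (-(2 * t)) t := by
    simpa using (hasDerivAt_pow 2 t).const_sub 1
  have h2 := (h1.rpow_const (p := (N : ℝ) / 2) (Or.inr (by linarith))).mul hq
  refine h2.congr_deriv ?_
  have h3 : (1 - t ^ 2) ^ ((N : ℝ) / 2) = weight N t * (1 - t ^ 2) := by
    rw [weight, ← Real.rpow_add_one' (one_sub_sq_nonneg ht) (by linarith)]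
    congr 1
    ring
  rw [h3, weight]
  ring

/-- The weight has the recursion of a constant function, `μ = 0`. It follows by integrating the
preceding derivative, whose primitive vanishes at both endpoints. -/
theorem momentRec_weight {N : ℕ} (hN : 2 ≤ N) :
    MomentRec N 0 fun k => ∫ t in (-1 : ℝ)..1, weight N t * t ^ k := by
  have hN' : (2 : ℝ) ≤ N := by exact_mod_cast hN
  have hint : ∀ k : ℕ, IntervalIntegrable (fun t => weight N t * t ^ k) volume (-1) 1 := fun k =>
    ((continuous_weight hN).mul (continuous_pow k)).intervalIntegrable _ _
  have key : ∀ q q' : ℝ → ℝ, (∀ t, HasDerivAt q (q' t) t) → Continuous q' →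
      ∫ t in (-1 : ℝ)..1, weight N t * ((1 - t ^ 2) * q' t - N * t * q t) = 0 := fun q q' hq hq' => by
    have hqc : Continuous q := continuous_iff_continuousAt.mpr fun t => (hq t).continuousAt
    rw [intervalIntegral.integral_eq_sub_of_hasDerivAt
      (f := fun t => (1 - t ^ 2) ^ ((N : ℝ) / 2) * q t)]
    · have : (0 : ℝ) ^ ((N : ℝ) / 2) = 0 := Real.zero_rpow (by linarith)
      simp [this]
    · intro t ht
      rw [Set.uIcc_of_le (by norm_num)] at ht
      exact hasDerivAt_mul_rpow hN (hq t) ht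
    · have := continuous_weight hN
      exact Continuous.intervalIntegrable (by fun_prop) _ _
  constructor
  · simp [ev]
  · have h := key (fun _ => 1) (fun _ => 0) (fun t => hasDerivAt_const t 1) continuous_const
    have h2 : ∫ t in (-1 : ℝ)..1, weight N t * ((1 - t ^ 2) * 0 - N * t * 1) =
        -N * ∫ t in (-1 : ℝ)..1, weight N t * t ^ 1 := by
      rw [← intervalIntegral.integral_const_mul]
      congr 1
      ext t
      ring
    rw [h2] at h
    have h3 : ev N 1 = N := by simp [ev]
    rw [h3]
    linarith
  · intro k
    have h := key (fun t => t ^ (k + 1)) (fun t => (k + 1) * t ^ k)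
      (fun t => by simpa using hasDerivAt_pow (k + 1) t) (by fun_prop)
    have h2 : ∫ t in (-1 : ℝ)..1, weight N t *
        ((1 - t ^ 2) * ((k + 1) * t ^ k) - N * t * t ^ (k + 1)) =
        (k + 1) * (∫ t in (-1 : ℝ)..1, weight N t * t ^ k)
          - (k + 1 + N) * ∫ t in (-1 : ℝ)..1, weight N t * t ^ (k + 2) := by
      rw [← intervalIntegral.integral_const_mul, ← intervalIntegral.integral_const_mul,
        ← intervalIntegral.integral_sub ((hint k).const_mul _) ((hint (k + 2)).const_mul _)]
      congr 1
      ext t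
      ring
    rw [h2] at h
    simp only [ev]
    push_cast
    linear_combination -(k + 2 : ℝ) * h

/-- The area of `𝕊^N`. -/
def area (N : ℕ) : ℝ :=
  ((N : ℝ) + 1) * (Real.sqrt Real.pi ^ (N + 1) / Real.Gamma (((N : ℝ) + 1) / 2 + 1))

theorem area_pos (N : ℕ) : 0 < area N := by
  have : 0 < Real.Gamma (((N : ℝ) + 1) / 2 + 1) := Real.Gamma_pos_of_pos (by positivity)
  unfold area
  positivity

theorem surf_real_univ {N m n : ℕ} [Fact (m + n = N + 1)] : (surf m n).real Set.univ = area N := by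
  have := nontrivial_ambient N (m := m) (n := n)
  have hr := (finrankFact N m n).out
  rw [surf, Measure.toSphere_real_apply_univ, hr, measureReal_def, InnerProductSpace.volume_ball, hr,
    area]
  have h0 : 0 < Real.Gamma (((N : ℝ) + 1) / 2 + 1) := Real.Gamma_pos_of_pos (by positivity)
  simp only [ENNReal.ofReal_one, one_pow, one_mul]
  rw [ENNReal.toReal_ofReal (by push_cast; positivity)]
  push_cast
  rfl

/-- The constant in front of `weight`. -/
def zonalConst (N : ℕ) : ℝ := area N / ∫ t in (-1 : ℝ)..1, weight N t

theorem zonalConst_pos {N : ℕ} (hN : 2 ≤ N) : 0 < zonalConst N :=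
  div_pos (area_pos N) (integral_weight_pos hN)

/-- The distribution of a coordinate on the sphere `𝕊^N`. -/
def zonalMeasure (N : ℕ) : Measure ℝ :=
  (volume.restrict (Set.Ioc (-1 : ℝ) 1)).withDensity fun t =>
    ENNReal.ofReal (zonalConst N * weight N t)

variable {N m n : ℕ} [Fact (m + n = N + 1)]

theorem integral_zonalMeasure (hN : 2 ≤ N) (g : ℝ → ℝ) :
    ∫ t, g t ∂zonalMeasure N = zonalConst N * ∫ t in (-1 : ℝ)..1, g t * weight N t := by
  rw [zonalMeasure, integral_withDensity_eq_integral_toReal_smul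
    ((continuous_weight hN).measurable.const_mul _).ennreal_ofReal
    (Eventually.of_forall fun x => ENNReal.ofReal_lt_top),
    intervalIntegral.integral_of_le (by norm_num), ← integral_const_mul]
  refine setIntegral_congr_fun measurableSet_Ioc fun t ht => ?_
  have := weight_nonneg (N := N) (Set.Ioc_subset_Icc_self ht)
  have := (zonalConst_pos hN).le
  simp only [smul_eq_mul]
  rw [ENNReal.toReal_ofReal (by positivity)]
  ring

theorem integrable_zonalMeasure (hN : 2 ≤ N) {g : ℝ → ℝ}
    (hg : IntegrableOn (fun t => g t * weight N t) (Set.Ioc (-1 : ℝ) 1)) :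
    Integrable g (zonalMeasure N) := by
  rw [zonalMeasure, integrable_withDensity_iff_integrable_smul'
    ((continuous_weight hN).measurable.const_mul _).ennreal_ofReal
    (Eventually.of_forall fun x => ENNReal.ofReal_lt_top)]
  refine (hg.const_mul (zonalConst N)).congr ?_
  filter_upwards [ae_restrict_mem measurableSet_Ioc] with t ht
  have := weight_nonneg (N := N) (Set.Ioc_subset_Icc_self ht)
  have := (zonalConst_pos hN).le
  simp only [smul_eq_mul]
  rw [ENNReal.toReal_ofReal (by positivity)]
  ring

/-- Both measures have moments solving the recursion with `μ = 0`, and `zonalConst` matches the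
total masses. The right side depends on `N` only, which frees the symbol from `m` and `n`. -/
theorem map_zonal (hN : 2 ≤ N) (z : Sph m n) : (surf m n).map (zonal z) = zonalMeasure N := by
  have hfin : IsFiniteMeasure (zonalMeasure N) := by
    refine isFiniteMeasure_withDensity_ofReal ?_
    exact ((continuous_const.mul (continuous_weight hN)).integrableOn_Icc.mono_set
      Set.Ioc_subset_Icc_self).2
  refine measure_eq_of_moments ?_ ?_ fun k => ?_
  · exact (ae_map_iff (p := fun t => t ∈ Set.Icc (-1 : ℝ) 1) (continuous_zonal z).aemeasurable
      measurableSet_Icc).mpr (Eventually.of_forall (zonal_mem_Icc z))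
  · refine (withDensity_absolutelyContinuous _ _).ae_le ?_
    filter_upwards [ae_restrict_mem measurableSet_Ioc] with t ht using Set.Ioc_subset_Icc_self ht
  · rw [integral_map (continuous_zonal z).aemeasurable (by fun_prop), integral_zonalMeasure hN]
    have hone : LaplaceEigen (m := m) (n := n) 0 fun _ => 1 := fun ζ => by
      have := sphLaplacian_eval_zonal (N := N) 1 z ζ
      simp at this
      simp [this]
    have h1 := momentRec (N := N) (isCk_of_contDiff (F := fun _ => (1 : ℝ)) contDiff_const) hone z
    have hz := (h1.sub_smul (momentRec_weight hN) (zonalConst N)).eq_zero (fun k hk => by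
      have hk0 : k = 0 := by
        refine ev_injective (N := N) (by omega) (hk.trans ?_)
        simp [ev]
      subst hk0
      simp only [pow_zero, mul_one]
      rw [zonalConst, div_mul_cancel₀ _ (integral_weight_pos hN).ne', integral_const,
        surf_real_univ (N := N)]
      simp) k
    simp only [one_mul] at hz
    rw [sub_eq_zero.mp hz]
    simp only [mul_comm]

theorem integral_comp_zonal (hN : 2 ≤ N) (z : Sph m n) {g : ℝ → ℝ} (hg : Measurable g) :
    ∫ ζ, g (zonal z ζ) ∂surf m n = zonalConst N * ∫ t in (-1 : ℝ)..1, g t * weight N t := by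
  rw [← integral_zonalMeasure hN, ← map_zonal (m := m) (n := n) hN z,
    integral_map (continuous_zonal z).aemeasurable hg.aestronglyMeasurable]

theorem integrable_comp_zonal (hN : 2 ≤ N) (z : Sph m n) {g : ℝ → ℝ} (hg : Measurable g)
    (hint : IntegrableOn (fun t => g t * weight N t) (Set.Ioc (-1 : ℝ) 1)) :
    Integrable (fun ζ => g (zonal z ζ)) (surf m n) := by
  have h := integrable_zonalMeasure hN hint
  rw [← map_zonal (m := m) (n := n) hN z] at h
  exact (integrable_map_measure hg.aestronglyMeasurable (continuous_zonal z).aemeasurable).mp h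

end Pushforward

/-! ### The singular kernel and the symbol -/

section Kernel

variable {N : ℕ} {s : ℝ}

/-- The singular kernel `|z - ζ|^{-(N + 2 s)}` as a function of `t = ⟨z, ζ⟩`. -/
def kern (N : ℕ) (s t : ℝ) : ℝ := (Real.sqrt (2 - 2 * t) ^ ((N : ℝ) + 2 * s))⁻¹

theorem kern_nonneg (t : ℝ) : 0 ≤ kern N s t :=
  inv_nonneg.mpr (Real.rpow_nonneg (Real.sqrt_nonneg _) _)

theorem measurable_kern : Measurable (kern N s) := by
  unfold kern
  fun_prop

/-- The exponents of `1 - t` combine to `-1 - s`, whatever `N` is. One extra factor `1 - t` thus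
gives integrability when `s < 1`. -/
theorem kern_mul_weight {t : ℝ} (ht : t ∈ Set.Ioo (-1 : ℝ) 1) :
    kern N s t * weight N t =
      2 ^ (-((N : ℝ) / 2 + s)) * (1 + t) ^ ((N : ℝ) / 2 - 1) * (1 - t) ^ (-1 - s) := by
  have h1 : 0 < 1 - t := by linarith [ht.2]
  have h2 : 0 < 1 + t := by linarith [ht.1]
  have h3 : kern N s t = 2 ^ (-((N : ℝ) / 2 + s)) * (1 - t) ^ (-((N : ℝ) / 2 + s)) := by
    rw [kern, Real.sqrt_eq_rpow, ← Real.rpow_mul (by linarith), ← Real.rpow_neg (by linarith),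
      ← Real.mul_rpow (by norm_num) h1.le]
    congr 1 <;> ring
  have h4 : weight N t = (1 - t) ^ ((N : ℝ) / 2 - 1) * (1 + t) ^ ((N : ℝ) / 2 - 1) := by
    rw [weight, ← Real.mul_rpow h1.le h2.le]
    congr 1
    ring
  have h5 : (1 - t) ^ (-1 - s) = (1 - t) ^ (-((N : ℝ) / 2 + s)) * (1 - t) ^ ((N : ℝ) / 2 - 1) := by
    rw [← Real.rpow_add h1]
    congr 1
    ring
  rw [h3, h4, h5]
  ring

/-- A bound for the constant in `kern_mul_weight`. -/
def kernBound (N : ℕ) (s : ℝ) : ℝ := 2 ^ (-((N : ℝ) / 2 + s)) * 2 ^ ((N : ℝ) / 2 - 1)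

theorem kernBound_pos : 0 < kernBound N s := by
  unfold kernBound
  positivity

theorem kern_mul_weight_le (hN : 2 ≤ N) {t : ℝ} (ht : t ∈ Set.Ioo (-1 : ℝ) 1) :
    kern N s t * weight N t ≤ kernBound N s * (1 - t) ^ (-1 - s) := by
  have hN' : (2 : ℝ) ≤ N := by exact_mod_cast hN
  rw [kern_mul_weight ht, kernBound]
  have h1 : 0 ≤ (1 - t) ^ (-1 - s) := Real.rpow_nonneg (by linarith [ht.2]) _
  have h2 : (1 + t) ^ ((N : ℝ) / 2 - 1) ≤ 2 ^ ((N : ℝ) / 2 - 1) :=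
    Real.rpow_le_rpow (by linarith [ht.1]) (by linarith [ht.2]) (by linarith)
  gcongr

theorem le_kern_mul_weight (hN : 2 ≤ N) {t : ℝ} (ht : t ∈ Set.Ico (0 : ℝ) 1) :
    2 ^ (-((N : ℝ) / 2 + s)) * (1 - t) ^ (-1 - s) ≤ kern N s t * weight N t := by
  have hN' : (2 : ℝ) ≤ N := by exact_mod_cast hN
  rw [kern_mul_weight ⟨by linarith [ht.1], ht.2⟩]
  have h1 : 0 ≤ (1 - t) ^ (-1 - s) := Real.rpow_nonneg (by linarith [ht.2]) _
  have h2 : 1 ≤ (1 + t) ^ ((N : ℝ) / 2 - 1) := Real.one_le_rpow (by linarith [ht.1]) (by linarith)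
  have h3 : (0 : ℝ) ≤ 2 ^ (-((N : ℝ) / 2 + s)) := by positivity
  nlinarith [mul_le_mul_of_nonneg_left h2 (mul_nonneg h3 h1)]

theorem intervalIntegrable_one_sub_rpow (hs : s < 1) :
    IntervalIntegrable (fun t : ℝ => (1 - t) ^ (-s)) volume (-1) 1 := by
  have h := (intervalIntegral.intervalIntegrable_rpow' (a := 0) (b := 2) (r := -s)
    (by linarith)).comp_sub_left 1
  norm_num at h
  exact h.symm

/-- A function that is `O(1 - t)` is integrable against the singular kernel. -/
theorem integrableOn_mul_kern (hN : 2 ≤ N) (hs : s < 1) {q : ℝ → ℝ} (hq : Measurable q) {C : ℝ}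
    (hC : ∀ t ∈ Set.Icc (-1 : ℝ) 1, |q t| ≤ C * (1 - t)) :
    IntegrableOn (fun t => q t * kern N s t * weight N t) (Set.Ioc (-1 : ℝ) 1) := by
  have h1 := ((intervalIntegrable_iff_integrableOn_Ioc_of_le (by norm_num)).mp
    (intervalIntegrable_one_sub_rpow hs)).const_mul (C * kernBound N s)
  refine h1.mono' ((hq.mul measurable_kern).mul
    (continuous_weight hN).measurable).aestronglyMeasurable ?_
  have hne : ∀ᵐ t ∂(volume.restrict (Set.Ioc (-1 : ℝ) 1)), t ≠ 1 :=
    ae_restrict_of_ae (by simp [ae_iff])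
  filter_upwards [ae_restrict_mem measurableSet_Ioc, hne] with t ht ht1
  have ht' : t ∈ Set.Ioo (-1 : ℝ) 1 := ⟨ht.1, lt_of_le_of_ne ht.2 ht1⟩
  have h2 := hC t (Set.Ioc_subset_Icc_self ht)
  have h3 := kern_mul_weight_le (s := s) hN ht'
  have h4 : 0 < 1 - t := by linarith [ht'.2]
  have h5 : 0 ≤ kern N s t * weight N t :=
    mul_nonneg (kern_nonneg t) (weight_nonneg (Set.Ioc_subset_Icc_self ht))
  have h6 : (1 - t) ^ (-s) = (1 - t) * (1 - t) ^ (-1 - s) := by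
    rw [show -s = 1 + (-1 - s) by ring, Real.rpow_add h4, Real.rpow_one]
  rw [mul_assoc, norm_mul, Real.norm_eq_abs, Real.norm_eq_abs, abs_of_nonneg h5, h6]
  calc |q t| * (kern N s t * weight N t)
      ≤ (C * (1 - t)) * (kernBound N s * (1 - t) ^ (-1 - s)) :=
        mul_le_mul h2 h3 h5 ((abs_nonneg _).trans h2)
    _ = _ := by ring

/-- The polynomial `1 - C_l` has a root at 1; its cofactor is bounded on the compact interval. -/
theorem exists_bound_one_sub (hN : 1 ≤ N) (l : ℕ) :
    ∃ C : ℝ, ∀ t ∈ Set.Icc (-1 : ℝ) 1, |1 - (gegenOne N l).eval t| ≤ C * (1 - t) := by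
  have hroot : (1 - gegenOne N l).IsRoot 1 := by
    simp [IsRoot, gegenOne_eval_one hN]
  obtain ⟨q, hq⟩ := dvd_iff_isRoot.mpr hroot
  obtain ⟨C, hC⟩ := (isCompact_Icc (a := (-1 : ℝ)) (b := 1)).exists_bound_of_continuousOn
    q.continuous.continuousOn
  refine ⟨C, fun t ht => ?_⟩
  have h : 1 - (gegenOne N l).eval t = (t - 1) * q.eval t := by
    have := congrArg (eval t) hq
    simpa using this
  rw [h, abs_mul, abs_sub_comm, abs_of_nonneg (by linarith [ht.2]), mul_comm]
  exact mul_le_mul_of_nonneg_right (hC t ht) (by linarith [ht.2])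

/-- The truncated kernel. -/
def kernTrunc (N : ℕ) (s ε t : ℝ) : ℝ := if ε < Real.sqrt (2 - 2 * t) then kern N s t else 0

theorem measurable_kernTrunc (ε : ℝ) : Measurable (kernTrunc N s ε) :=
  Measurable.ite (measurableSet_lt measurable_const (by fun_prop)) measurable_kern measurable_const

theorem kernTrunc_nonneg (ε t : ℝ) : 0 ≤ kernTrunc N s ε t := by
  unfold kernTrunc
  split_ifs
  exacts [kern_nonneg t, le_rfl]

theorem kernTrunc_le_kern (ε t : ℝ) : kernTrunc N s ε t ≤ kern N s t := by
  unfold kernTrunc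
  split_ifs
  exacts [le_rfl, kern_nonneg t]

theorem kernTrunc_le (hs : 0 < s) {ε : ℝ} (hε : 0 < ε) (t : ℝ) :
    kernTrunc N s ε t ≤ (ε ^ ((N : ℝ) + 2 * s))⁻¹ := by
  unfold kernTrunc
  split_ifs with h
  · exact inv_anti₀ (by positivity) (Real.rpow_le_rpow hε.le h.le (by positivity))
  · positivity

/-- The eigenvalue of the (truncated) singular integral on spherical harmonics of degree `l`. -/
def jTrunc (N : ℕ) (s : ℝ) (l : ℕ) (ε : ℝ) : ℝ :=
  zonalConst N * ∫ t in (-1 : ℝ)..1, (1 - (gegenOne N l).eval t) * kernTrunc N s ε t * weight N t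

/-- The eigenvalue of the singular integral on spherical harmonics of degree `l`. -/
def jFull (N : ℕ) (s : ℝ) (l : ℕ) : ℝ :=
  zonalConst N * ∫ t in (-1 : ℝ)..1, (1 - (gegenOne N l).eval t) * kern N s t * weight N t

/-- Dominated convergence: the untruncated integrand is integrable because `1 - C_l` vanishes at 1.
-/
theorem tendsto_jTrunc (hN : 2 ≤ N) (hs : s < 1) (l : ℕ) :
    Tendsto (jTrunc N s l) (𝓝[>] 0) (𝓝 (jFull N s l)) := by
  obtain ⟨C, hC⟩ := exists_bound_one_sub (N := N) (by omega) l
  have hcont : Continuous fun t => 1 - (gegenOne N l).eval t :=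
    continuous_const.sub (gegenOne N l).continuous
  have hint := integrableOn_mul_kern hN hs hcont.measurable hC
  refine Tendsto.const_mul _ ?_
  simp only [intervalIntegral.integral_of_le (show (-1 : ℝ) ≤ 1 by norm_num)]
  refine tendsto_integral_filter_of_dominated_convergence _ ?_ ?_ hint.norm ?_
  · exact Eventually.of_forall fun ε => ((hcont.measurable.mul (measurable_kernTrunc ε)).mul
      (continuous_weight hN).measurable).aestronglyMeasurable
  · refine Eventually.of_forall fun ε => Eventually.of_forall fun t => ?_
    simp only [norm_mul, Real.norm_eq_abs, abs_of_nonneg (kernTrunc_nonneg _ _),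
      abs_of_nonneg (kern_nonneg _)]
    gcongr
    exact kernTrunc_le_kern _ _
  · have hne : ∀ᵐ t ∂(volume.restrict (Set.Ioc (-1 : ℝ) 1)), t ≠ 1 :=
      ae_restrict_of_ae (by simp [ae_iff])
    filter_upwards [ae_restrict_mem measurableSet_Ioc, hne] with t ht ht1
    have ht' : 0 < Real.sqrt (2 - 2 * t) :=
      Real.sqrt_pos.mpr (by linarith [lt_of_le_of_ne ht.2 ht1])
    refine tendsto_const_nhds.congr' ?_
    filter_upwards [mem_nhdsWithin_of_mem_nhds (gt_mem_nhds ht')] with ε hε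
    rw [kernTrunc, if_pos hε]

variable {m n : ℕ}

theorem integrable_kernTrunc (hs : 0 < s) {ε : ℝ} (hε : 0 < ε) (z : Sph m n) :
    Integrable (fun ζ => kernTrunc N s ε (zonal z ζ)) (surf m n) := by
  refine Integrable.of_bound
    ((measurable_kernTrunc ε).comp (continuous_zonal z).measurable).aestronglyMeasurable
    (ε ^ ((N : ℝ) + 2 * s))⁻¹ (Eventually.of_forall fun ζ => ?_)
  rw [Real.norm_eq_abs, abs_of_nonneg (kernTrunc_nonneg _ _)]
  exact kernTrunc_le hs hε _

variable [Fact (m + n = N + 1)]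

/-- The truncated kernel is bounded, so Funk–Hecke applies to it; the remaining zonal integral is
pushed forward to `[-1, 1]`. -/
theorem integral_kernTrunc_mul_sub (hN : 2 ≤ N) (hs : 0 < s) {ε : ℝ} (hε : 0 < ε) {l : ℕ}
    {v : Sph m n → ℝ} (hv : IsCk N 2 v) (he : LaplaceEigen (ev N l) v) (z : Sph m n) :
    ∫ ζ, kernTrunc N s ε (zonal z ζ) * (v z - v ζ) ∂surf m n = jTrunc N s l ε * v z := by
  have hk := integrable_kernTrunc (N := N) (s := s) hs hε z
  have hw : Continuous fun ζ => (gegenOne N l).eval (zonal z ζ) :=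
    (gegenOne N l).continuous.comp (continuous_zonal z)
  have h1 := funkHecke (by omega) hv he z (measurable_kernTrunc ε) hk
  have h2 : ∫ ζ, kernTrunc N s ε (zonal z ζ) * (v z - v ζ) ∂surf m n =
      v z * ∫ ζ, (1 - (gegenOne N l).eval (zonal z ζ)) * kernTrunc N s ε (zonal z ζ) ∂surf m n := by
    simp only [mul_sub, sub_mul, one_mul]
    rw [integral_sub (hk.mul_const _) (integrable_mul_continuous hk hv.continuous), h1,
      integral_sub hk ((integrable_mul_continuous hk hw).congr
        (Eventually.of_forall fun ζ => mul_comm _ _)), integral_mul_const]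
    simp only [mul_comm, mul_sub]
  rw [h2, integral_comp_zonal (g := fun t => (1 - (gegenOne N l).eval t) * kernTrunc N s ε t) hN z
    ((continuous_const.sub (gegenOne N l).continuous).measurable.mul (measurable_kernTrunc ε)),
    jTrunc]
  ring

theorem setIntegral_eq_jTrunc (hN : 2 ≤ N) (hs : 0 < s) {ε : ℝ} (hε : 0 < ε) {l : ℕ}
    {v : Sph m n → ℝ} (hv : IsCk N 2 v) (he : LaplaceEigen (ev N l) v) (z : Sph m n) :
    ∫ ζ in {ζ : Sph m n | ε < dist z ζ}, (v z - v ζ) / dist z ζ ^ ((N : ℝ) + 2 * s) ∂surf m n =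
      jTrunc N s l ε * v z := by
  rw [← integral_kernTrunc_mul_sub hN hs hε hv he z, ← integral_indicator
    (measurableSet_lt measurable_const (by fun_prop))]
  refine integral_congr_ae (Eventually.of_forall fun ζ => ?_)
  simp only [Set.indicator, kernTrunc, ← dist_eq_sqrt, kern, Set.mem_ofPred_eq]
  split_ifs
  · rw [div_eq_mul_inv, mul_comm]
  · simp

open Classical in
/-- The symbol of the conformal fractional Laplacian. -/
def symbol (N : ℕ) (s μ : ℝ) : ℝ :=
  aConst N s + cConst N s * if h : ∃ l, ev N l = μ then jFull N s h.choose else 0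

theorem symbol_ev (hN : 1 ≤ N) (l : ℕ) :
    symbol N s (ev N l) = aConst N s + cConst N s * jFull N s l := by
  have h : ∃ l', ev N l' = ev N l := ⟨l, rfl⟩
  rw [symbol, dif_pos h, ev_injective hN h.choose_spec]

theorem hasConfFracLaplacianAt (hN : 2 ≤ N) (hs : 0 < s) (hs1 : s < 1) {μ : ℝ} {u : Sph m n → ℝ}
    (hu : IsCk N 2 u) (he : LaplaceEigen μ u) (z : Sph m n) :
    HasConfFracLaplacianAt N s u z (symbol N s μ * u z) := by
  by_cases hμ : ∃ l, ev N l = μ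
  · obtain ⟨l, rfl⟩ := hμ
    refine ⟨jFull N s l * u z, ?_, ?_⟩
    · refine ((tendsto_jTrunc hN hs1 l).mul_const (u z)).congr' ?_
      filter_upwards [self_mem_nhdsWithin] with ε hε
      exact (setIntegral_eq_jTrunc hN hs hε hu he z).symm
    · rw [symbol_ev (by omega)]
      ring
  -- Outside the spectrum `u` vanishes identically, and the value given to the symbol there is
  -- immaterial.
  · push Not at hμ
    have h0 := eigen_eq_zero hu he hμ
    subst h0
    exact ⟨0, by simp, by simp⟩

end Kernel

/-! ### Estimates for Gegenbauer polynomials and for the symbol -/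

section Bounds

variable {N : ℕ} {s : ℝ}

theorem exists_zonal_eq {m n : ℕ} (hm : 1 ≤ m) (hn : 1 ≤ n) {t : ℝ} (ht : t ∈ Set.Icc (-1 : ℝ) 1) :
    ∃ z w : Sph m n, zonal z w = t := by
  let x : EuclideanSpace ℝ (Fin m) := EuclideanSpace.single ⟨0, hm⟩ 1
  let y : EuclideanSpace ℝ (Fin n) := EuclideanSpace.single ⟨0, hn⟩ 1
  have hx : ‖x‖ = 1 := by simp [x]
  have hy : ‖y‖ = 1 := by simp [y]
  have hnorm : ∀ a b : ℝ, a ^ 2 + b ^ 2 = 1 → ‖(pair (a • x) (b • y) : Ambient m n)‖ = 1 :=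
    fun a b hab => by
      have : ‖(pair (a • x) (b • y) : Ambient m n)‖ ^ 2 = 1 := by
        rw [norm_sq_parts]
        change ‖a • x‖ ^ 2 + ‖b • y‖ ^ 2 = 1
        rw [norm_smul, norm_smul, hx, hy, mul_one, mul_one, Real.norm_eq_abs, Real.norm_eq_abs,
          sq_abs, sq_abs, hab]
      nlinarith [norm_nonneg (pair (a • x) (b • y) : Ambient m n)]
  refine ⟨⟨pair ((1 : ℝ) • x) ((0 : ℝ) • y), mem_sphere_zero_iff_norm.mpr (hnorm _ _ (by norm_num))⟩,
    ⟨pair (t • x) (Real.sqrt (1 - t ^ 2) • y), mem_sphere_zero_iff_norm.mpr (hnorm _ _ ?_)⟩, ?_⟩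
  · rw [Real.sq_sqrt (one_sub_sq_nonneg ht)]
    ring
  · rw [zonal, inner_eq_parts]
    change ⟪(1 : ℝ) • x, t • x⟫_ℝ + ⟪(0 : ℝ) • y, Real.sqrt (1 - t ^ 2) • y⟫_ℝ = t
    rw [one_smul, zero_smul, inner_zero_left, inner_smul_right, real_inner_self_eq_norm_sq, hx]
    ring

/-- Funk–Hecke for two zonal functions gives `∫ G(⟨z,·⟩) G(⟨w,·⟩) = G(⟨z,w⟩) I`, with `I` their
common squared norm. Bounding the product by the half-sum of squares yields `|G| I ≤ I`. -/
theorem abs_gegenOne_le_one (hN : 2 ≤ N) (l : ℕ) {t : ℝ} (ht : t ∈ Set.Icc (-1 : ℝ) 1) :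
    |(gegenOne N l).eval t| ≤ 1 := by
  -- The estimate concerns `N` only, so any splitting of the coordinates may be used.
  have hfact : Fact (1 + N = N + 1) := ⟨by omega⟩
  obtain ⟨z, w, rfl⟩ := exists_zonal_eq (m := 1) (n := N) le_rfl (by omega) ht
  set G : ℝ → ℝ := fun t => (gegenOne N l).eval t with hG
  have hGc : Continuous G := (gegenOne N l).continuous
  have hc : ∀ z : Sph 1 N, Continuous fun ζ => G (zonal z ζ) := fun z => hGc.comp (continuous_zonal z)
  have hFH := funkHecke (v := fun ζ => G (zonal w ζ)) (by omega) (isCk_eval_zonal (gegenOne N l) w)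
    (laplaceEigen_gegenOne (by omega) l w) z hGc.measurable
    (integrable_surf_of_continuous (hc z))
  have hzw : zonal w z = zonal z w := real_inner_comm _ _
  have hsq : ∀ z : Sph 1 N, ∫ ζ, G (zonal z ζ) * G (zonal z ζ) ∂surf 1 N =
      zonalConst N * ∫ t in (-1 : ℝ)..1, (G t * G t) * weight N t := fun z =>
    integral_comp_zonal (g := fun t => G t * G t) hN z (hGc.mul hGc).measurable
  set I := zonalConst N * ∫ t in (-1 : ℝ)..1, (G t * G t) * weight N t with hI
  have hIpos : 0 < I := by
    rw [← hsq z]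
    refine integral_sq_pos (hc z) fun h0 => ?_
    have := congrFun h0 z
    simp only [hG, zonal_self, gegenOne_eval_one (show 1 ≤ N by omega)] at this
    exact one_ne_zero this
  rw [hsq z, hzw] at hFH
  have hi : ∀ a b : Sph 1 N, Integrable (fun ζ => G (zonal a ζ) * G (zonal b ζ)) (surf 1 N) :=
    fun a b => integrable_surf_of_continuous ((hc a).mul (hc b))
  have hCS : |∫ ζ, G (zonal z ζ) * G (zonal w ζ) ∂surf 1 N| ≤ I := by
    have h1 : ∫ ζ, (G (zonal z ζ) * G (zonal z ζ) / 2 + G (zonal w ζ) * G (zonal w ζ) / 2)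
        ∂surf 1 N = I := by
      rw [integral_add ((hi z z).div_const 2) ((hi w w).div_const 2), integral_div, integral_div,
        hsq, hsq]
      ring
    rw [← h1, ← Real.norm_eq_abs]
    refine norm_integral_le_of_norm_le (((hi z z).div_const 2).add ((hi w w).div_const 2))
      (Eventually.of_forall fun ζ => ?_)
    rw [Real.norm_eq_abs, abs_le]
    constructor <;> nlinarith [sq_nonneg (G (zonal z ζ) + G (zonal w ζ)),
      sq_nonneg (G (zonal z ζ) - G (zonal w ζ))]
  rw [hFH, abs_mul, abs_of_pos hIpos] at hCS
  exact le_of_mul_le_mul_right (by linarith) hIpos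

theorem ev_ge (hN : 1 ≤ N) {l : ℕ} (hl : 1 ≤ l) : (N : ℝ) ≤ ev N l := by
  have h1 : (1 : ℝ) ≤ l := by exact_mod_cast hl
  have h2 : (1 : ℝ) ≤ N := by exact_mod_cast hN
  unfold ev
  nlinarith

/-- The Gegenbauer equation in self-adjoint form, shifted by `c`. The differentiated function
vanishes at 1, so a sign of the right side decides whether `C_l' ≤ c` or `C_l' ≥ c`. -/
theorem hasDerivAt_rpow_mul_gegen (hN : 2 ≤ N) (l : ℕ) (c : ℝ) {t : ℝ}
    (ht : t ∈ Set.Icc (-1 : ℝ) 1) :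
    HasDerivAt (fun t => (1 - t ^ 2) ^ ((N : ℝ) / 2) * ((derivative (gegenOne N l)).eval t - c))
      (weight N t * (N * t * c - ev N l * (gegenOne N l).eval t)) t := by
  refine (hasDerivAt_mul_rpow hN (((derivative (gegenOne N l)).hasDerivAt t).sub_const c)
    ht).congr_deriv ?_
  have := gegenOne_ode (N := N) (by omega) l t
  congr 1
  linear_combination this

theorem rpow_at_one (hN : 2 ≤ N) : (1 - (1 : ℝ) ^ 2) ^ ((N : ℝ) / 2) = 0 := by
  have hN' : (2 : ℝ) ≤ N := by exact_mod_cast hN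
  rw [one_pow, sub_self, Real.zero_rpow (by linarith)]

/-- Take `c = 2 ev / N`. For `t ≥ 1/2` one has `N t c ≥ ev ≥ ev * C_l`, so the shifted function
increases to 0. -/
theorem derivative_gegenOne_le (hN : 2 ≤ N) (l : ℕ) {t : ℝ} (ht : t ∈ Set.Ico (1 / 2 : ℝ) 1) :
    (derivative (gegenOne N l)).eval t ≤ 2 * ev N l / N := by
  have hN' : (2 : ℝ) ≤ N := by exact_mod_cast hN
  have hsub : ∀ t ∈ Set.Icc (1 / 2 : ℝ) 1, t ∈ Set.Icc (-1 : ℝ) 1 := fun t ht =>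
    ⟨by linarith [ht.1], ht.2⟩
  have hev : 0 ≤ ev N l := by
    unfold ev
    have : (0 : ℝ) ≤ l := Nat.cast_nonneg l
    exact mul_nonneg this (by linarith)
  have hmono : MonotoneOn (fun t => (1 - t ^ 2) ^ ((N : ℝ) / 2) *
      ((derivative (gegenOne N l)).eval t - 2 * ev N l / N)) (Set.Icc (1 / 2) 1) := by
    refine monotoneOn_of_hasDerivWithinAt_nonneg (convex_Icc _ _) (fun t ht =>
      (hasDerivAt_rpow_mul_gegen hN l _ (hsub t ht)).continuousAt.continuousWithinAt)
      (fun t ht => (hasDerivAt_rpow_mul_gegen hN l _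
        (hsub t (interior_subset ht))).hasDerivWithinAt) fun t ht => ?_
    have ht := interior_subset ht
    refine mul_nonneg (weight_nonneg (hsub t ht)) ?_
    have h1 := (abs_le.mp (abs_gegenOne_le_one hN l (hsub t ht))).2
    have h2 : N * t * (2 * ev N l / N) = 2 * t * ev N l := by field_simp
    rw [h2]
    nlinarith [ht.1]
  have h := hmono ⟨ht.1, ht.2.le⟩ ⟨by norm_num, le_rfl⟩ ht.2.le
  simp only [rpow_at_one hN, zero_mul] at h
  have hpos : 0 < (1 - t ^ 2) ^ ((N : ℝ) / 2) :=
    Real.rpow_pos_of_pos (by nlinarith [ht.1, ht.2]) _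
  nlinarith [nonpos_of_mul_nonpos_right h hpos]

theorem one_sub_gegenOne_le_aux (hN : 2 ≤ N) (l : ℕ) {t : ℝ} (ht : t ∈ Set.Icc (1 / 2 : ℝ) 1) :
    1 - (gegenOne N l).eval t ≤ 2 * ev N l / N * (1 - t) := by
  have hanti : AntitoneOn (fun t => (gegenOne N l).eval t - 2 * ev N l / N * t)
      (Set.Icc (1 / 2) 1) := by
    refine antitoneOn_of_hasDerivWithinAt_nonpos (convex_Icc _ _) (by fun_prop) (fun t _ =>
      (((gegenOne N l).hasDerivAt t).sub ((hasDerivAt_id t).const_mul _)).hasDerivWithinAt)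
      fun t ht => ?_
    rw [interior_Icc] at ht
    have := derivative_gegenOne_le hN l ⟨ht.1.le, ht.2⟩
    linarith
  have h := hanti ht ⟨by norm_num, le_rfl⟩ ht.2
  simp only [gegenOne_eval_one (show 1 ≤ N by omega)] at h
  linarith

theorem one_sub_gegenOne_le (hN : 2 ≤ N) {l : ℕ} (hl : 1 ≤ l) {t : ℝ}
    (ht : t ∈ Set.Icc (-1 : ℝ) 1) :
    1 - (gegenOne N l).eval t ≤ 4 * ev N l / N * (1 - t) := by
  have hN' : (2 : ℝ) ≤ N := by exact_mod_cast hN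
  have hev := ev_ge (N := N) (by omega) hl
  have h4 : 1 ≤ ev N l / N := by rw [le_div_iff₀ (by linarith)]; linarith
  rw [mul_div_assoc]
  rcases le_total (1 / 2) t with h | h
  · have := one_sub_gegenOne_le_aux hN l ⟨h, ht.2⟩
    rw [mul_div_assoc] at this
    nlinarith [ht.2]
  -- Here `1 - t ≥ 1/2` and `ev ≥ N`, so the right side is at least 2.
  · have := (abs_le.mp (abs_gegenOne_le_one hN l ht)).1
    nlinarith

/-- Take `c = ev / (2 N)`. On the window `1 - t ≤ N / (4 ev)` the linear upper bound for `1 - C_l`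
gives `C_l ≥ 1/2`. Hence `N t c ≤ ev * C_l`, and the shifted function decreases to 0. -/
theorem le_derivative_gegenOne (hN : 2 ≤ N) {l : ℕ} (hl : 1 ≤ l) {t : ℝ}
    (ht : t ∈ Set.Ico (1 - N / (4 * ev N l)) 1) :
    ev N l / (2 * N) ≤ (derivative (gegenOne N l)).eval t := by
  have hN' : (2 : ℝ) ≤ N := by exact_mod_cast hN
  have hev := ev_ge (N := N) (by omega) hl
  have hev0 : 0 < ev N l := by linarith
  have hδ : N / (4 * ev N l) ≤ 1 / 4 := by
    rw [div_le_iff₀ (by linarith)]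
    linarith
  have hsub : ∀ t ∈ Set.Icc (1 - N / (4 * ev N l)) 1, t ∈ Set.Icc (1 / 2 : ℝ) 1 := fun t ht =>
    ⟨by linarith [ht.1], ht.2⟩
  have hsub' : ∀ t ∈ Set.Icc (1 / 2 : ℝ) 1, t ∈ Set.Icc (-1 : ℝ) 1 := fun t ht =>
    ⟨by linarith [ht.1], ht.2⟩
  have hanti : AntitoneOn (fun t => (1 - t ^ 2) ^ ((N : ℝ) / 2) *
      ((derivative (gegenOne N l)).eval t - ev N l / (2 * N)))
      (Set.Icc (1 - N / (4 * ev N l)) 1) := by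
    refine antitoneOn_of_hasDerivWithinAt_nonpos (convex_Icc _ _) (fun t ht =>
      (hasDerivAt_rpow_mul_gegen hN l _ (hsub' t (hsub t ht))).continuousAt.continuousWithinAt)
      (fun t ht => (hasDerivAt_rpow_mul_gegen hN l _
        (hsub' t (hsub t (interior_subset ht)))).hasDerivWithinAt) fun t ht => ?_
    have ht := interior_subset ht
    refine mul_nonpos_of_nonneg_of_nonpos (weight_nonneg (hsub' t (hsub t ht))) ?_
    have h1 := one_sub_gegenOne_le_aux hN l (hsub t ht)
    have h2 : N * t * (ev N l / (2 * N)) = t / 2 * ev N l := by field_simp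
    have h3 : 2 * ev N l / N * (1 - t) ≤ 1 / 2 := by
      calc 2 * ev N l / N * (1 - t) ≤ 2 * ev N l / N * (N / (4 * ev N l)) := by
            gcongr
            linarith [ht.1]
        _ = 1 / 2 := by field_simp; norm_num
    rw [h2]
    nlinarith [ht.2]
  have h := hanti ⟨ht.1, ht.2.le⟩ ⟨by linarith [ht.1, ht.2], le_rfl⟩ ht.2.le
  simp only [rpow_at_one hN, zero_mul] at h
  have h2 := hsub t ⟨ht.1, ht.2.le⟩
  have hpos : 0 < (1 - t ^ 2) ^ ((N : ℝ) / 2) :=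
    Real.rpow_pos_of_pos (by nlinarith [h2.1, ht.2]) _
  linarith [nonneg_of_mul_nonneg_right h hpos]

theorem le_one_sub_gegenOne (hN : 2 ≤ N) {l : ℕ} (hl : 1 ≤ l) {t : ℝ}
    (ht : t ∈ Set.Icc (1 - N / (4 * ev N l)) 1) :
    ev N l / (2 * N) * (1 - t) ≤ 1 - (gegenOne N l).eval t := by
  have hmono : MonotoneOn (fun t => (gegenOne N l).eval t - ev N l / (2 * N) * t)
      (Set.Icc (1 - N / (4 * ev N l)) 1) := by
    refine monotoneOn_of_hasDerivWithinAt_nonneg (convex_Icc _ _) (by fun_prop) (fun t _ =>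
      (((gegenOne N l).hasDerivAt t).sub ((hasDerivAt_id t).const_mul _)).hasDerivWithinAt)
      fun t ht => ?_
    rw [interior_Icc] at ht
    have := le_derivative_gegenOne hN hl ⟨ht.1.le, ht.2⟩
    linarith
  have h := hmono ht ⟨ht.1.trans ht.2, le_rfl⟩ ht.2
  simp only [gegenOne_eval_one (show 1 ≤ N by omega)] at h
  linarith

theorem jIntegrand_nonneg (hN : 2 ≤ N) (l : ℕ) {t : ℝ} (ht : t ∈ Set.Icc (-1 : ℝ) 1) :
    0 ≤ (1 - (gegenOne N l).eval t) * kern N s t * weight N t := by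
  have h1 := (abs_le.mp (abs_gegenOne_le_one hN l ht)).2
  exact mul_nonneg (mul_nonneg (by linarith) (kern_nonneg t)) (weight_nonneg ht)

theorem intervalIntegrable_jIntegrand (hN : 2 ≤ N) (hs : s < 1) (l : ℕ) {a b : ℝ}
    (ha : a ∈ Set.Icc (-1 : ℝ) 1) (hb : b ∈ Set.Icc (-1 : ℝ) 1) :
    IntervalIntegrable (fun t => (1 - (gegenOne N l).eval t) * kern N s t * weight N t)
      volume a b := by
  obtain ⟨C, hC⟩ := exists_bound_one_sub (N := N) (by omega) l
  have h := (intervalIntegrable_iff_integrableOn_Ioc_of_le (show (-1 : ℝ) ≤ 1 by norm_num)).mpr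
    (integrableOn_mul_kern hN hs
      (continuous_const.sub (gegenOne N l).continuous).measurable hC)
  refine h.mono_set ?_
  rw [Set.uIcc_of_le (show (-1 : ℝ) ≤ 1 by norm_num)]
  exact Set.uIcc_subset_Icc ha hb

theorem jFull_nonneg (hN : 2 ≤ N) (l : ℕ) : 0 ≤ jFull N s l :=
  mul_nonneg (zonalConst_pos hN).le
    (intervalIntegral.integral_nonneg (by norm_num) fun _ ht => jIntegrand_nonneg hN l ht)

theorem integral_one_sub_rpow {r δ : ℝ} (hr : -1 < r) :
    ∫ t in (1 - δ)..1, (1 - t) ^ r = δ ^ (r + 1) / (r + 1) := by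
  rw [intervalIntegral.integral_comp_sub_left (fun t => t ^ r)]
  simp only [sub_self, sub_sub_cancel]
  rw [integral_rpow (Or.inl hr), Real.zero_rpow (by linarith), sub_zero]

/-- Keep only the window `1 - t ≤ δ = N / (4 ev)`, where the integrand dominates a multiple of `ev *
(1 - t)^(-s)`. Its integral scales as `ev * δ^(1 - s)`, that is as `ev^s`. -/
theorem le_jFull (hN : 2 ≤ N) (hs : s < 1) {l : ℕ} (hl : 1 ≤ l) :
    zonalConst N * (2 ^ (-((N : ℝ) / 2 + s)) / (2 * N) * ((N / 4) ^ (1 - s) / (1 - s))) *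
      ev N l ^ s ≤ jFull N s l := by
  have hN' : (2 : ℝ) ≤ N := by exact_mod_cast hN
  have hev := ev_ge (N := N) (by omega) hl
  have hev0 : 0 < ev N l := by linarith
  set δ := N / (4 * ev N l) with hδ
  have hδ0 : 0 < δ := by positivity
  have hδ1 : δ ≤ 1 / 4 := by
    rw [hδ, div_le_iff₀ (by linarith)]
    linarith
  have hI : ∫ t in (1 - δ)..1, (2 ^ (-((N : ℝ) / 2 + s)) * (ev N l / (2 * N))) * (1 - t) ^ (-s) ≤
      ∫ t in (1 - δ)..1, (1 - (gegenOne N l).eval t) * kern N s t * weight N t := by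
    refine intervalIntegral.integral_mono_on_of_le_Ioo (by linarith) ?_
      (intervalIntegrable_jIntegrand hN hs l ⟨by linarith, by linarith⟩ ⟨by norm_num, le_rfl⟩)
      fun t ht => ?_
    · refine ((intervalIntegrable_one_sub_rpow hs).mono_set ?_).const_mul _
      rw [Set.uIcc_of_le (show (-1 : ℝ) ≤ 1 by norm_num)]
      exact Set.uIcc_subset_Icc ⟨by linarith, by linarith⟩ ⟨by norm_num, le_rfl⟩
    · have h1 := le_one_sub_gegenOne hN hl ⟨ht.1.le, ht.2.le⟩
      have h2 := le_kern_mul_weight (s := s) hN ⟨by linarith [ht.1], ht.2⟩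
      have h4 : 0 < 1 - t := by linarith [ht.2]
      have h6 : (1 - t) ^ (-s) = (1 - t) * (1 - t) ^ (-1 - s) := by
        rw [show -s = 1 + (-1 - s) by ring, Real.rpow_add h4, Real.rpow_one]
      have h7 : (0 : ℝ) ≤ ev N l / (2 * N) * (1 - t) := by positivity
      have h8 : (0 : ℝ) ≤ 2 ^ (-((N : ℝ) / 2 + s)) * (1 - t) ^ (-1 - s) := by positivity
      calc 2 ^ (-((N : ℝ) / 2 + s)) * (ev N l / (2 * N)) * (1 - t) ^ (-s)
          = (ev N l / (2 * N) * (1 - t)) * (2 ^ (-((N : ℝ) / 2 + s)) * (1 - t) ^ (-1 - s)) := by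
            rw [h6]; ring
        _ ≤ (1 - (gegenOne N l).eval t) * (kern N s t * weight N t) :=
            mul_le_mul h1 h2 h8 (h7.trans h1)
        _ = _ := by ring
  have hsplit : ∫ t in (1 - δ)..1, (1 - (gegenOne N l).eval t) * kern N s t * weight N t ≤
      ∫ t in (-1 : ℝ)..1, (1 - (gegenOne N l).eval t) * kern N s t * weight N t := by
    rw [← intervalIntegral.integral_add_adjacent_intervals (b := 1 - δ)
      (intervalIntegrable_jIntegrand hN hs l ⟨le_rfl, by norm_num⟩ ⟨by linarith, by linarith⟩)
      (intervalIntegrable_jIntegrand hN hs l ⟨by linarith, by linarith⟩ ⟨by norm_num, le_rfl⟩)]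
    have : 0 ≤ ∫ t in (-1 : ℝ)..(1 - δ), (1 - (gegenOne N l).eval t) * kern N s t * weight N t :=
      intervalIntegral.integral_nonneg (by linarith) fun t ht =>
        jIntegrand_nonneg hN l ⟨ht.1, by linarith [ht.2]⟩
    linarith
  rw [intervalIntegral.integral_const_mul, integral_one_sub_rpow (by linarith)] at hI
  have hpow : δ ^ (-s + 1) = (N / 4) ^ (1 - s) * ev N l ^ s * (ev N l)⁻¹ := by
    rw [hδ, show (N : ℝ) / (4 * ev N l) = N / 4 * (ev N l)⁻¹ by field_simp,
      Real.mul_rpow (by positivity) (by positivity), Real.inv_rpow hev0.le,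
      ← Real.rpow_neg hev0.le, show -(-s + 1) = s + (-1) by ring, Real.rpow_add hev0,
      Real.rpow_neg_one, show -s + 1 = 1 - s by ring]
    ring
  rw [hpow] at hI
  rw [jFull, mul_assoc]
  refine mul_le_mul_of_nonneg_left (le_trans (le_of_eq ?_) (hI.trans hsplit))
    (zonalConst_pos hN).le
  have h1s : 1 - s ≠ 0 := by linarith
  have h2s : -s + 1 ≠ 0 := by linarith
  rw [show -s + 1 = 1 - s by ring]
  field_simp

/-- Split at `1 - t = δ = 1 / ev`. The linear bound on `1 - C_l` gives `ev * δ^(1 - s)` near 1, and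
the bound by 2 gives `δ^(-s)` on the rest; both equal `ev^s`. -/
theorem jFull_le (hN : 2 ≤ N) (hs0 : 0 < s) (hs : s < 1) {l : ℕ} (hl : 1 ≤ l) :
    jFull N s l ≤ zonalConst N * (kernBound N s * (4 / N / (1 - s) + 2 / s)) * ev N l ^ s := by
  have hN' : (2 : ℝ) ≤ N := by exact_mod_cast hN
  have hev := ev_ge (N := N) (by omega) hl
  have hev0 : 0 < ev N l := by linarith
  set δ := (ev N l)⁻¹ with hδ
  have hδ0 : 0 < δ := by positivity
  have hδ1 : δ ≤ 1 := inv_le_one_of_one_le₀ (by linarith)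
  have hK := kernBound_pos (N := N) (s := s)
  have hnear : ∫ t in (1 - δ)..1, (1 - (gegenOne N l).eval t) * kern N s t * weight N t ≤
      ∫ t in (1 - δ)..1, (4 * ev N l / N * kernBound N s) * (1 - t) ^ (-s) := by
    refine intervalIntegral.integral_mono_on_of_le_Ioo (by linarith)
      (intervalIntegrable_jIntegrand hN hs l ⟨by linarith, by linarith⟩ ⟨by norm_num, le_rfl⟩)
      ?_ fun t ht => ?_
    · refine ((intervalIntegrable_one_sub_rpow hs).mono_set ?_).const_mul _
      rw [Set.uIcc_of_le (show (-1 : ℝ) ≤ 1 by norm_num)]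
      exact Set.uIcc_subset_Icc ⟨by linarith, by linarith⟩ ⟨by norm_num, le_rfl⟩
    · have ht' : t ∈ Set.Ioo (-1 : ℝ) 1 := ⟨by linarith [ht.1], ht.2⟩
      have h1 := one_sub_gegenOne_le hN hl (Set.Ioo_subset_Icc_self ht')
      have h2 := kern_mul_weight_le (s := s) hN ht'
      have h3 : 0 ≤ kern N s t * weight N t :=
        mul_nonneg (kern_nonneg t) (weight_nonneg (Set.Ioo_subset_Icc_self ht'))
      have h4 : 0 < 1 - t := by linarith [ht.2]
      have h6 : (1 - t) ^ (-s) = (1 - t) * (1 - t) ^ (-1 - s) := by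
        rw [show -s = 1 + (-1 - s) by ring, Real.rpow_add h4, Real.rpow_one]
      calc (1 - (gegenOne N l).eval t) * kern N s t * weight N t
          = (1 - (gegenOne N l).eval t) * (kern N s t * weight N t) := by ring
        _ ≤ (4 * ev N l / N * (1 - t)) * (kernBound N s * (1 - t) ^ (-1 - s)) :=
            mul_le_mul h1 h2 h3 (by positivity)
        _ = _ := by rw [h6]; ring
  have hcont : ContinuousOn (fun t : ℝ => (1 - t) ^ (-1 - s)) (Set.uIcc (-1) (1 - δ)) := by
    rw [Set.uIcc_of_le (by linarith)]
    refine (continuous_const.sub continuous_id).continuousOn.rpow_const fun t ht => Or.inl ?_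
    have := ht.2
    change 1 - t ≠ 0
    linarith
  have hfar : ∫ t in (-1 : ℝ)..(1 - δ), (1 - (gegenOne N l).eval t) * kern N s t * weight N t ≤
      ∫ t in (-1 : ℝ)..(1 - δ), (2 * kernBound N s) * (1 - t) ^ (-1 - s) := by
    refine intervalIntegral.integral_mono_on_of_le_Ioo (by linarith)
      (intervalIntegrable_jIntegrand hN hs l ⟨le_rfl, by norm_num⟩ ⟨by linarith, by linarith⟩)
      (hcont.intervalIntegrable.const_mul _) fun t ht => ?_
    have ht' : t ∈ Set.Ioo (-1 : ℝ) 1 := ⟨ht.1, by linarith [ht.2]⟩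
    have h1 := (abs_le.mp (abs_gegenOne_le_one hN l (Set.Ioo_subset_Icc_self ht'))).1
    have h2 := kern_mul_weight_le (s := s) hN ht'
    have h3 : 0 ≤ kern N s t * weight N t :=
      mul_nonneg (kern_nonneg t) (weight_nonneg (Set.Ioo_subset_Icc_self ht'))
    calc (1 - (gegenOne N l).eval t) * kern N s t * weight N t
        = (1 - (gegenOne N l).eval t) * (kern N s t * weight N t) := by ring
      _ ≤ 2 * (kernBound N s * (1 - t) ^ (-1 - s)) := mul_le_mul (by linarith) h2 h3 (by norm_num)
      _ = _ := by ring
  have hfar2 : ∫ t in (-1 : ℝ)..(1 - δ), (1 - t) ^ (-1 - s) ≤ δ ^ (-s) / s := by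
    rw [intervalIntegral.integral_comp_sub_left (fun t => t ^ (-1 - s))]
    rw [show (1 : ℝ) - (1 - δ) = δ by ring, show (1 : ℝ) - -1 = 2 by norm_num]
    rw [integral_rpow (Or.inr ⟨by linarith, by
      rw [Set.uIcc_of_le (by linarith)]
      exact fun h => by linarith [h.1]⟩)]
    have h1 : (0 : ℝ) ≤ (2 : ℝ) ^ (-1 - s + 1) := by positivity
    rw [show -1 - s + 1 = -s by ring] at *
    rw [div_neg, ← neg_div, neg_sub]
    gcongr
    linarith
  rw [intervalIntegral.integral_const_mul, integral_one_sub_rpow (by linarith)] at hnear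
  rw [intervalIntegral.integral_const_mul] at hfar
  have hδs : δ ^ (-s) = ev N l ^ s := by
    rw [hδ, Real.inv_rpow hev0.le, ← Real.rpow_neg hev0.le, neg_neg]
  have hδs1 : δ ^ (-s + 1) = ev N l ^ s * (ev N l)⁻¹ := by
    rw [Real.rpow_add hδ0, hδs, Real.rpow_one]
  rw [hδs1, show -s + 1 = 1 - s by ring] at hnear
  rw [hδs] at hfar2
  have hfar3 := hfar.trans (mul_le_mul_of_nonneg_left hfar2 (by positivity))
  rw [jFull, ← intervalIntegral.integral_add_adjacent_intervals (b := 1 - δ)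
      (intervalIntegrable_jIntegrand hN hs l ⟨le_rfl, by norm_num⟩ ⟨by linarith, by linarith⟩)
      (intervalIntegrable_jIntegrand hN hs l ⟨by linarith, by linarith⟩ ⟨by norm_num, le_rfl⟩),
    mul_assoc]
  refine mul_le_mul_of_nonneg_left ((add_le_add hfar3 hnear).trans (le_of_eq ?_))
    (zonalConst_pos hN).le
  have h1s : 1 - s ≠ 0 := by linarith
  field_simp
  ring

theorem cConst_pos (hs0 : 0 < s) (hs : s < 1) : 0 < cConst N s := by
  have h1 : 0 < Real.Gamma ((N : ℝ) / 2 + s) := Real.Gamma_pos_of_pos (by positivity)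
  have h2 : 0 < Real.Gamma (2 - s) := Real.Gamma_pos_of_pos (by linarith)
  have h3 : 0 < 1 - s := by linarith
  have := Real.pi_pos
  unfold cConst
  positivity

theorem aConst_pos (hN : 2 ≤ N) (hs0 : 0 < s) (hs : s < 1) : 0 < aConst N s := by
  have hN' : (2 : ℝ) ≤ N := by exact_mod_cast hN
  have h1 : 0 < Real.Gamma ((N : ℝ) / 2 + s) := Real.Gamma_pos_of_pos (by positivity)
  have h2 : 0 < Real.Gamma ((N : ℝ) / 2 - s) := Real.Gamma_pos_of_pos (by linarith)
  exact div_pos h1 h2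

theorem symbol_pos (hN : 2 ≤ N) (hs0 : 0 < s) (hs : s < 1) (l : ℕ) : 0 < symbol N s (ev N l) := by
  rw [symbol_ev (by omega)]
  have := mul_nonneg (cConst_pos (N := N) hs0 hs).le (jFull_nonneg (s := s) hN l)
  linarith [aConst_pos hN hs0 hs]

theorem symbol_bounds (hN : 2 ≤ N) (hs0 : 0 < s) (hs : s < 1) :
    ∃ C : ℝ, 1 < C ∧ ∀ l : ℕ, C⁻¹ * (1 + ev N l ^ s) ≤ symbol N s (ev N l) ∧
      symbol N s (ev N l) ≤ C * (1 + ev N l ^ s) := by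
  have hN' : (2 : ℝ) ≤ N := by exact_mod_cast hN
  have hA := aConst_pos hN hs0 hs
  have hc := cConst_pos (N := N) hs0 hs
  have hz := zonalConst_pos hN
  have hK := kernBound_pos (N := N) (s := s)
  have hs1 : 0 < 1 - s := by linarith
  set a := cConst N s * (zonalConst N *
    (2 ^ (-((N : ℝ) / 2 + s)) / (2 * N) * ((N / 4) ^ (1 - s) / (1 - s)))) with ha
  set b := cConst N s * (zonalConst N * (kernBound N s * (4 / N / (1 - s) + 2 / s))) with hb
  have ha0 : 0 < a := by positivity
  have hb0 : 0 < b := by positivity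
  have hbd : ∀ l : ℕ, aConst N s + a * ev N l ^ s ≤ symbol N s (ev N l) ∧
      symbol N s (ev N l) ≤ aConst N s + b * ev N l ^ s := fun l => by
    rw [symbol_ev (by omega)]
    -- In degree 0 the singular integral vanishes and `0 ^ s = 0`, leaving the constant `aConst`.
    rcases Nat.eq_zero_or_pos l with rfl | hl
    · have h1 : gegenOne N 0 = 1 := by
        have h0 : gegen N 0 = 1 := by simp [gegen, jacobi, jacobiCoeff]
        simp [gegenOne, h0]
      have h2 : jFull N s 0 = 0 := by simp [jFull, h1]
      have h3 : ev N 0 = 0 := by simp [ev]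
      rw [h2, h3, Real.zero_rpow hs0.ne']
      simp
    · have h1 := mul_le_mul_of_nonneg_left (le_jFull hN hs hl) hc.le
      have h2 := mul_le_mul_of_nonneg_left (jFull_le hN hs0 hs hl) hc.le
      rw [← mul_assoc] at h1 h2
      exact ⟨by linarith, by linarith⟩
  -- One constant that exceeds 1, both upper coefficients and the inverses of both lower ones.
  refine ⟨2 + aConst N s + b + (aConst N s)⁻¹ + a⁻¹, by
    have := inv_pos.mpr hA
    have := inv_pos.mpr ha0
    linarith, fun l => ?_⟩
  have hx : 0 ≤ ev N l ^ s := by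
    refine Real.rpow_nonneg ?_ _
    have : (0 : ℝ) ≤ l := Nat.cast_nonneg l
    exact mul_nonneg this (by linarith)
  set C := 2 + aConst N s + b + (aConst N s)⁻¹ + a⁻¹ with hC
  have hiA := inv_pos.mpr hA
  have hia := inv_pos.mpr ha0
  obtain ⟨h1, h2⟩ := hbd l
  have hCA : C⁻¹ ≤ aConst N s := by
    rw [← inv_inv (aConst N s)]
    exact inv_anti₀ hiA (by linarith)
  have hCa : C⁻¹ ≤ a := by
    rw [← inv_inv a]
    exact inv_anti₀ hia (by linarith)
  constructor
  · refine le_trans ?_ h1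
    rw [mul_add, mul_one]
    exact add_le_add hCA (mul_le_mul_of_nonneg_right hCa hx)
  · refine h2.trans ?_
    rw [mul_add, mul_one]
    exact add_le_add (by linarith) (mul_le_mul_of_nonneg_right (by linarith) hx)

end Bounds

/-! ### The Gagliardo form -/

section Gagliardo

variable {N m n : ℕ} {s : ℝ}

/-- Restriction of an ambient polynomial to a compact set; used for the finiteness of the Gagliardo
seminorm. -/
theorem lipschitz_Phi (i : ℕ) : ∃ K : NNReal, LipschitzWith K (Phi m n i) := by
  set F : Ambient m n → ℝ := fun x =>
    (jacobi ((n : ℝ) / 2 - 1) ((m : ℝ) / 2 - 1) i).eval (quad (signs m n) x) with hF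
  have hC : ContDiff ℝ 1 F :=
    (by simpa using Polynomial.contDiff_aeval (𝕜 := ℝ) (jacobi ((n : ℝ) / 2 - 1) ((m : ℝ) / 2 - 1) i) 1 :
      ContDiff ℝ 1 fun t => (jacobi ((n : ℝ) / 2 - 1) ((m : ℝ) / 2 - 1) i).eval t).comp
      (contDiff_quad _)
  obtain ⟨K, hK⟩ := (hC.locallyLipschitz.locallyLipschitzOn
    (s := Metric.sphere 0 1)).exists_lipschitzOnWith_of_compact (isCompact_sphere _ _)
  refine ⟨K, fun z ζ => ?_⟩
  have := hK z.2 ζ.2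
  simp only [hF, ← f_eq_quad] at this
  exact this

theorem gagliardo_eq (N m n : ℕ) (s : ℝ) :
    gagliardo N m n s = ((surf m n).prod (surf m n)).withDensity fun p =>
      ENNReal.ofReal (cConst N s / 2 * kern N s (zonal p.1 p.2)) := by
  simp only [gagliardo, kern, ← dist_eq_sqrt, div_eq_mul_inv]

theorem continuous_zonal_prod : Continuous fun p : Sph m n × Sph m n => zonal p.1 p.2 := by
  unfold zonal
  fun_prop

theorem zonal_comm (z ζ : Sph m n) : zonal z ζ = zonal ζ z := real_inner_comm _ _

theorem gagliardo_absolutelyContinuous :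
    gagliardo N m n s ≪ (surf m n).prod (surf m n) := withDensity_absolutelyContinuous _ _

theorem ae_gagliardo_of_ae {P : Sph m n → Prop} (h : ∀ᵐ z ∂surf m n, P z) :
    ∀ᵐ p ∂gagliardo N m n s, P p.1 ∧ P p.2 := by
  refine gagliardo_absolutelyContinuous.ae_le ?_
  exact (Measure.quasiMeasurePreserving_fst.ae h).and (Measure.quasiMeasurePreserving_snd.ae h)

theorem measurable_kern_zonal :
    Measurable fun p : Sph m n × Sph m n => cConst N s / 2 * kern N s (zonal p.1 p.2) :=
  (measurable_kern.comp continuous_zonal_prod.measurable).const_mul _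

theorem integral_gagliardo (hs0 : 0 < s) (hs : s < 1) (g : Sph m n × Sph m n → ℝ) :
    ∫ p, g p ∂gagliardo N m n s =
      ∫ p, cConst N s / 2 * kern N s (zonal p.1 p.2) * g p ∂(surf m n).prod (surf m n) := by
  rw [gagliardo_eq, integral_withDensity_eq_integral_toReal_smul
    measurable_kern_zonal.ennreal_ofReal (Eventually.of_forall fun x => ENNReal.ofReal_lt_top)]
  refine integral_congr_ae (Eventually.of_forall fun p => ?_)
  simp only [smul_eq_mul]
  rw [ENNReal.toReal_ofReal (mul_nonneg (half_pos (cConst_pos hs0 hs)).le (kern_nonneg _))]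

theorem integrable_gagliardo_iff (hs0 : 0 < s) (hs : s < 1) {g : Sph m n × Sph m n → ℝ} :
    Integrable g (gagliardo N m n s) ↔
      Integrable (fun p => cConst N s / 2 * kern N s (zonal p.1 p.2) * g p)
        ((surf m n).prod (surf m n)) := by
  rw [gagliardo_eq, integrable_withDensity_iff_integrable_smul'
    measurable_kern_zonal.ennreal_ofReal (Eventually.of_forall fun x => ENNReal.ofReal_lt_top)]
  refine integrable_congr (Eventually.of_forall fun p => ?_)
  simp only [smul_eq_mul]
  rw [ENNReal.toReal_ofReal (mul_nonneg (half_pos (cConst_pos hs0 hs)).le (kern_nonneg _))]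

variable [Fact (m + n = N + 1)]

/-- The factor `2 - 2 t = |z - ζ|²` tames the kernel, and the inner integral of the absolute value
does not depend on `z`. -/
theorem integrable_sq_dist_mul_kern (hN : 2 ≤ N) (hs : s < 1) :
    Integrable (fun p : Sph m n × Sph m n => (2 - 2 * zonal p.1 p.2) * kern N s (zonal p.1 p.2))
      ((surf m n).prod (surf m n)) := by
  have hm : Measurable fun t : ℝ => (2 - 2 * t) * kern N s t :=
    Measurable.mul (by fun_prop) measurable_kern
  have hint := integrableOn_mul_kern (s := s) (q := fun t => 2 - 2 * t) hN hs (by fun_prop) (C := 2)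
    fun t ht => by
      rw [abs_of_nonneg (by linarith [ht.2])]
      linarith
  refine (integrable_prod_iff
    (hm.comp continuous_zonal_prod.measurable).aestronglyMeasurable).mpr ⟨Eventually.of_forall fun z => integrable_comp_zonal hN z hm hint, ?_⟩
  have : ∀ z : Sph m n, ∫ ζ, ‖(2 - 2 * zonal z ζ) * kern N s (zonal z ζ)‖ ∂surf m n =
      zonalConst N * ∫ t in (-1 : ℝ)..1, ‖(2 - 2 * t) * kern N s t‖ * weight N t := fun z =>
    integral_comp_zonal hN z hm.norm
  exact (integrable_const _).congr (Eventually.of_forall fun z => (this z).symm)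

/-- Lipschitz functions have finite Gagliardo seminorm. -/
theorem memLp_sub_gagliardo (hN : 2 ≤ N) (hs0 : 0 < s) (hs : s < 1) {v : Sph m n → ℝ} {K : NNReal}
    (hv : LipschitzWith K v) :
    MemLp (fun p : Sph m n × Sph m n => v p.1 - v p.2) 2 (gagliardo N m n s) := by
  have hc : Continuous fun p : Sph m n × Sph m n => v p.1 - v p.2 :=
    (hv.continuous.comp continuous_fst).sub (hv.continuous.comp continuous_snd)
  rw [memLp_two_iff_integrable_sq hc.aestronglyMeasurable, integrable_gagliardo_iff hs0 hs]
  refine ((integrable_sq_dist_mul_kern (s := s) hN hs).const_mul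
    (cConst N s / 2 * (K : ℝ) ^ 2)).mono'
    (measurable_kern_zonal.mul (hc.pow 2).measurable).aestronglyMeasurable
    (Eventually.of_forall fun p => ?_)
  have h1 : (v p.1 - v p.2) ^ 2 ≤ (K : ℝ) ^ 2 * (2 - 2 * zonal p.1 p.2) := by
    have h := hv.dist_le_mul p.1 p.2
    rw [Real.dist_eq] at h
    rw [← dist_sq_eq, ← mul_pow, ← sq_abs]
    gcongr
  have hc0 := cConst_pos (N := N) hs0 hs
  have hk := kern_nonneg (N := N) (s := s) (zonal p.1 p.2)
  rw [Real.norm_eq_abs, abs_of_nonneg (by positivity)]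
  calc _ ≤ cConst N s / 2 * kern N s (zonal p.1 p.2) * ((K : ℝ) ^ 2 * (2 - 2 * zonal p.1 p.2)) := by
        gcongr
    _ = _ := by ring

/-- By symmetry of the kernel, the form is twice the integral of `u(z) (v(z) - v(ζ))`, whose inner
integral is known. Truncation makes the two halves separately integrable. -/
theorem integral_kernTrunc_mul_sub_mul_sub (hN : 2 ≤ N) (hs : 0 < s) {ε : ℝ} (hε : 0 < ε) {l : ℕ}
    {u v : Sph m n → ℝ} (hu : Continuous u) (hv : IsCk N 2 v) (he : LaplaceEigen (ev N l) v) :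
    ∫ p : Sph m n × Sph m n, kernTrunc N s ε (zonal p.1 p.2) * ((u p.1 - u p.2) * (v p.1 - v p.2))
      ∂(surf m n).prod (surf m n) = 2 * (jTrunc N s l ε * ∫ z, u z * v z ∂surf m n) := by
  have hk : Integrable (fun p : Sph m n × Sph m n => kernTrunc N s ε (zonal p.1 p.2))
      ((surf m n).prod (surf m n)) := by
    refine Integrable.of_bound
      ((measurable_kernTrunc ε).comp continuous_zonal_prod.measurable).aestronglyMeasurable
      (ε ^ ((N : ℝ) + 2 * s))⁻¹ (Eventually.of_forall fun p => ?_)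
    rw [Real.norm_eq_abs, abs_of_nonneg (kernTrunc_nonneg _ _)]
    exact kernTrunc_le hs hε _
  obtain ⟨g, hg⟩ : ∃ g : Sph m n × Sph m n → ℝ, g = fun p =>
    kernTrunc N s ε (zonal p.1 p.2) * (u p.1 * (v p.1 - v p.2)) := ⟨_, rfl⟩
  have hv' := hv.continuous
  have hgi : Integrable g ((surf m n).prod (surf m n)) := by
    have hc : Continuous fun p : Sph m n × Sph m n => u p.1 * (v p.1 - v p.2) := by fun_prop
    obtain ⟨C, hC⟩ := isCompact_univ.exists_bound_of_continuousOn hc.continuousOn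
    rw [hg]
    exact hk.mul_bdd (c := C) hc.aestronglyMeasurable
      (Eventually.of_forall fun p => hC p (Set.mem_univ p))
  have h1 : ∫ p, g p ∂(surf m n).prod (surf m n) = jTrunc N s l ε * ∫ z, u z * v z ∂surf m n := by
    rw [integral_prod _ hgi, ← integral_const_mul]
    refine integral_congr_ae (Eventually.of_forall fun z => ?_)
    simp only [hg]
    have := integral_kernTrunc_mul_sub hN hs hε hv he z
    rw [mul_left_comm, ← this, ← integral_const_mul]
    refine integral_congr_ae (Eventually.of_forall fun ζ => ?_)
    ring
  have h2 : ∀ p : Sph m n × Sph m n, kernTrunc N s ε (zonal p.1 p.2) *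
      ((u p.1 - u p.2) * (v p.1 - v p.2)) = g p + g p.swap := fun p => by
    simp only [hg, Prod.fst_swap, Prod.snd_swap, zonal_comm p.2 p.1]
    ring
  simp only [h2]
  have hgs : Integrable (fun p : Sph m n × Sph m n => g p.swap) ((surf m n).prod (surf m n)) :=
    hgi.swap
  rw [integral_add hgi hgs, integral_prod_swap, h1]
  ring

theorem tendsto_kernTrunc (hs : 0 < s) (t : ℝ) :
    Tendsto (fun ε => kernTrunc N s ε t) (𝓝[>] 0) (𝓝 (kern N s t)) := by
  refine tendsto_const_nhds.congr' ?_
  -- Where the distance is zero, the default `0⁻¹ = 0` makes the kernel vanish, in agreement with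
  -- its truncations.
  rcases (Real.sqrt_nonneg (2 - 2 * t)).eq_or_lt with h | h
  · refine Eventually.of_forall fun ε => ?_
    have h0 : kern N s t = 0 := by
      rw [kern, ← h, Real.zero_rpow (by positivity), inv_zero]
    simp [kernTrunc, h0]
  · filter_upwards [mem_nhdsWithin_of_mem_nhds (gt_mem_nhds h)] with ε hε
    exact (if_pos hε).symm

/-- The Gagliardo form against an eigenfunction. -/
theorem integral_gagliardo_sub_mul_sub (hN : 2 ≤ N) (hs0 : 0 < s) (hs : s < 1) {l : ℕ}
    {u v : Sph m n → ℝ} (hu : Continuous u) (hv : IsCk N 2 v) (he : LaplaceEigen (ev N l) v)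
    (hint : Integrable (fun p : Sph m n × Sph m n => (u p.1 - u p.2) * (v p.1 - v p.2))
      (gagliardo N m n s)) :
    ∫ p, (u p.1 - u p.2) * (v p.1 - v p.2) ∂gagliardo N m n s =
      cConst N s * jFull N s l * ∫ z, u z * v z ∂surf m n := by
  have hv' := hv.continuous
  have hc : Continuous fun p : Sph m n × Sph m n => (u p.1 - u p.2) * (v p.1 - v p.2) := by fun_prop
  have hc0 := cConst_pos (N := N) hs0 hs
  rw [integrable_gagliardo_iff hs0 hs] at hint
  rw [integral_gagliardo hs0 hs]
  -- The truncation is removed by dominated convergence; the assumed integrability of the full form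
  -- provides the bound.
  have hlim := tendsto_integral_filter_of_dominated_convergence (l := 𝓝[>] (0 : ℝ))
    (F := fun ε (p : Sph m n × Sph m n) => cConst N s / 2 * kernTrunc N s ε (zonal p.1 p.2) *
      ((u p.1 - u p.2) * (v p.1 - v p.2))) _
    (Eventually.of_forall fun ε => ((((measurable_kernTrunc ε).comp
      continuous_zonal_prod.measurable).const_mul _).mul hc.measurable).aestronglyMeasurable)
    (Eventually.of_forall fun ε => Eventually.of_forall fun p => by
      simp only [norm_mul, Real.norm_eq_abs, abs_of_nonneg (kernTrunc_nonneg _ _)]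
      refine mul_le_mul_of_nonneg_right (mul_le_mul_of_nonneg_left
        ((kernTrunc_le_kern ε _).trans (le_abs_self _)) ?_) ?_ <;> positivity)
    hint.norm
    (Eventually.of_forall fun p => ((tendsto_kernTrunc hs0 _).const_mul _).mul_const _)
  refine tendsto_nhds_unique hlim ?_
  have h := ((tendsto_jTrunc hN hs l).const_mul (cConst N s)).mul_const (∫ z, u z * v z ∂surf m n)
  refine h.congr' ?_
  filter_upwards [self_mem_nhdsWithin] with ε hε
  have h1 := integral_kernTrunc_mul_sub_mul_sub (s := s) hN hs0 hε hu hv he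
  simp only [mul_assoc]
  rw [integral_const_mul, h1]
  ring

end Gagliardo

/-! ### The fractional Sobolev space -/

section SobolevFractional

variable {N m n : ℕ} {s : ℝ}

theorem inner_fst_Hs (hA : 0 < aConst N s)
    (u v : Lp ℝ 2 (ENNReal.ofReal (aConst N s) • surf m n)) :
    ⟪u, v⟫_ℝ = aConst N s * ∫ z, u z * v z ∂surf m n := by
  rw [inner_Lp_eq, integral_smul_measure, ENNReal.toReal_ofReal hA.le, smul_eq_mul]

variable [Fact (m + n = N + 1)]

theorem snd_ae_eq_of_mem_Hs (hA : 0 < aConst N s) {p : HsPair N m n s} (hp : p ∈ Hs N m n s) :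
    p.snd =ᵐ[gagliardo N m n s] fun q => p.fst q.1 - p.fst q.2 := by
  have hν : ae (ENNReal.ofReal (aConst N s) • surf m n) = ae (surf m n) :=
    Measure.ae_ennreal_smul_measure_eq (ENNReal.ofReal_pos.mpr hA).ne' _
  set T : Set (HsPair N m n s) :=
    {p | p.snd =ᵐ[gagliardo N m n s] fun q => p.fst q.1 - p.fst q.2} with hT
  have hcl : IsClosed T := by
    refine isClosed_of_closure_subset fun p hp => ?_
    obtain ⟨x, hx, hxp⟩ := mem_closure_iff_seq_limit.mp hp
    obtain ⟨k, hk, hlim⟩ := (tendstoInMeasure_of_tendsto_Lp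
      ((continuous_withLp_fst.tendsto p).comp hxp)).exists_seq_tendsto_ae
    obtain ⟨k', hk', hlim'⟩ := (tendstoInMeasure_of_tendsto_Lp
      (((continuous_snd.comp (WithLp.prod_continuous_ofLp 2 _ _)).tendsto p).comp
        (hxp.comp hk.tendsto_atTop))).exists_seq_tendsto_ae
    rw [Filter.Eventually, hν] at hlim
    filter_upwards [ae_gagliardo_of_ae hlim, hlim', ae_all_iff.mpr fun j => hx j]
      with q hq hq' hxq
    refine tendsto_nhds_unique hq' ?_
    refine ((hq.1.sub hq.2).comp hk'.tendsto_atTop).congr fun j => ?_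
    exact (hxq (k (k' j))).symm
  refine closure_minimal (t := T) (fun p hp => ?_) hcl hp
  induction hp using Submodule.span_induction with
  | mem p hp =>
    obtain ⟨u, -, h1, h2⟩ := hp
    filter_upwards [h2, ae_gagliardo_of_ae h1] with q hq hq'
    rw [hq, hq'.1, hq'.2]
  | zero =>
    have h1 : ∀ᵐ z ∂surf m n, (0 : HsPair N m n s).fst z = 0 := by
      rw [Filter.Eventually, ← hν]
      exact Lp.coeFn_zero _ _ _
    filter_upwards [Lp.coeFn_zero ℝ 2 (gagliardo N m n s), ae_gagliardo_of_ae h1] with q hq hq'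
    rw [hq'.1, hq'.2, sub_zero]
    exact hq
  | add p p' _ _ hp hp' =>
    have h1 : ∀ᵐ z ∂surf m n, (p + p').fst z = p.fst z + p'.fst z := by
      rw [Filter.Eventually, ← hν]
      exact Lp.coeFn_add _ _
    rw [hT, Set.mem_ofPred_eq]
    filter_upwards [Lp.coeFn_add p.snd p'.snd, ae_gagliardo_of_ae h1, hp, hp'] with q hq hq' h2 h3
    rw [hq'.1, hq'.2]
    refine hq.trans ?_
    rw [Pi.add_apply, h2, h3]
    ring
  | smul c p _ hp =>
    have h1 : ∀ᵐ z ∂surf m n, (c • p).fst z = c * p.fst z := by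
      rw [Filter.Eventually, ← hν]
      exact Lp.coeFn_smul _ _
    rw [hT, Set.mem_ofPred_eq]
    filter_upwards [Lp.coeFn_smul c p.snd, ae_gagliardo_of_ae h1, hp] with q hq hq' h2
    rw [hq'.1, hq'.2]
    refine hq.trans ?_
    rw [Pi.smul_apply, h2, smul_eq_mul]
    ring

/-- The inner product of `H^s` against an eigenfunction of the Laplace-Beltrami operator. -/
theorem inner_Hs (hN : 2 ≤ N) (hs0 : 0 < s) (hs : s < 1) {l : ℕ} {v : Sph m n → ℝ}
    (hv : IsCk N 2 v) (he : LaplaceEigen (ev N l) v) {p q : HsPair N m n s} (hp : p ∈ Hs N m n s)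
    (hq : RepresentsHs v q) :
    ⟪q, p⟫_ℝ = symbol N s (ev N l) * ∫ z, p.fst z * v z ∂surf m n := by
  have hA := aConst_pos hN hs0 hs
  -- The measure of the first component carries the factor `aConst`, hence the division.
  have hr : ∀ w : Lp ℝ 2 (ENNReal.ofReal (aConst N s) • surf m n),
      ⟪(symbol N s (ev N l) / aConst N s) • q.fst, w⟫_ℝ =
        symbol N s (ev N l) * ∫ z, w z * v z ∂surf m n := fun w => by
    rw [real_inner_smul_left, inner_fst_Hs hA, ← mul_assoc, div_mul_cancel₀ _ hA.ne']
    congr 1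
    refine integral_congr_ae ?_
    filter_upwards [hq.1] with z hz
    rw [hz, mul_comm]
  rw [← hr]
  refine inner_eq_inner_fst_of_mem_closure ?_ hp
  rintro p ⟨u, hu, hpu⟩
  have hprod : (fun x => p.snd x * q.snd x) =ᵐ[gagliardo N m n s]
      fun x => (u x.1 - u x.2) * (v x.1 - v x.2) := by
    filter_upwards [hpu.2, hq.2] with x h1 h2
    rw [h1, h2]
  have hint : Integrable (fun x : Sph m n × Sph m n => (u x.1 - u x.2) * (v x.1 - v x.2))
      (gagliardo N m n s) :=
    ((Lp.memLp p.snd).integrable_mul (Lp.memLp q.snd)).congr hprod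
  have h1 : ⟪q.ofLp.1, p.ofLp.1⟫_ℝ = aConst N s * ∫ z, u z * v z ∂surf m n := by
    rw [inner_fst_Hs hA]
    congr 1
    refine integral_congr_ae ?_
    filter_upwards [hpu.1, hq.1] with z h1 h2
    rw [mul_comm]
    exact congrArg₂ _ h1 h2
  have h2 : ⟪q.ofLp.2, p.ofLp.2⟫_ℝ = cConst N s * jFull N s l * ∫ z, u z * v z ∂surf m n := by
    rw [← integral_gagliardo_sub_mul_sub hN hs0 hs hu.continuous hv he hint, L2.inner_def]
    exact integral_congr_ae hprod
  rw [WithLp.prod_inner_apply, h1, h2, hr, symbol_ev (by omega), ← add_mul]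
  congr 1
  refine integral_congr_ae ?_
  filter_upwards [hpu.1] with z hz
  rw [hz]

theorem exists_representsHs_Phi (hN : 2 ≤ N) (hs0 : 0 < s) (hs : s < 1) (i : ℕ) :
    ∃ p : HsPair N m n s, RepresentsHs (Phi m n i) p := by
  obtain ⟨K, hK⟩ := lipschitz_Phi (m := m) (n := n) i
  have h1 : MemLp (Phi m n i) 2 (ENNReal.ofReal (aConst N s) • surf m n) :=
    (memLp_of_continuous (continuous_Phi i)).smul_measure ENNReal.ofReal_ne_top
  have h2 := memLp_sub_gagliardo hN hs0 hs hK
  refine ⟨WithLp.toLp 2 (h1.toLp, h2.toLp), ?_, h2.coeFn_toLp⟩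
  rw [EventuallyEq, Filter.Eventually, ← Measure.ae_ennreal_smul_measure_eq
    (ENNReal.ofReal_pos.mpr (aConst_pos hN hs0 hs)).ne' (surf m n)]
  exact h1.coeFn_toLp

/-- As for the first-order space, with the positive symbol at `λ_i` in place of `1 + λ_i`. A zero
first component now forces a zero second one because the latter is the difference of values of the
former. -/
theorem exists_basis_Hs (hN : 2 ≤ N) (hm : 1 ≤ m) (hn : 1 ≤ n) (hs0 : 0 < s) (hs : s < 1) :
    ∃ e : ℕ → HsPair N m n s,
      (∀ i, RepresentsHs (Phi m n i) (e i)) ∧ IsOrthogonalBasis e (HsG N m n s) := by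
  have hA := aConst_pos hN hs0 hs
  have hA' : ENNReal.ofReal (aConst N s) ≠ 0 := (ENNReal.ofReal_pos.mpr hA).ne'
  set ν := ENNReal.ofReal (aConst N s) • surf m n with hνdef
  have hν : ae ν = ae (surf m n) := Measure.ae_ennreal_smul_measure_eq hA' _
  choose e he using fun i => exists_representsHs_Phi (m := m) (n := n) hN hs0 hs i
  have heH : ∀ i, e i ∈ Hs N m n s := fun i =>
    Submodule.le_topologicalClosure _ (Submodule.subset_span ⟨_, isCk_Phi i, he i⟩)
  have hin : ∀ i, ∀ p ∈ Hs N m n s, ⟪e i, p⟫_ℝ =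
      symbol N s (ev N (2 * i)) * ∫ z, p.fst z * Phi m n i z ∂surf m n := fun i p hp =>
    inner_Hs hN hs0 hs (isCk_Phi i) (lam_eq_ev (N := N) i ▸ laplaceEigen_Phi hm hn i) hp (he i)
  have hcl : IsClosed (invariantLp ν hν : Set (Lp ℝ 2 ν)) :=
    isClosed_invariantLp _ hν fun A B => (measurePreserving_act A B).smul_measure _
  let K : Submodule ℝ (HsPair N m n s) := Hs N m n s ⊓
    { carrier := {p | p.fst ∈ invariantLp ν hν}
      zero_mem' := Submodule.zero_mem (invariantLp ν hν)
      add_mem' := fun {p q} hp hq => Submodule.add_mem (invariantLp ν hν) hp hq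
      smul_mem' := fun c p hp => Submodule.smul_mem (invariantLp ν hν) c hp }
  refine ⟨e, he, ?_⟩
  refine isOrthogonalBasis_of_total (K := K) ?_ (fun i => ?_) (fun i h => ?_)
    (fun i j hij => ?_) fun p hp h => ?_
  · exact (Submodule.isClosed_topologicalClosure _).inter (hcl.preimage continuous_withLp_fst)
  · exact ⟨heH i, (gInvariant_Phi i).aeGInvariant.congr (he i).1.symm⟩
  · have h1 : (e i).fst = 0 := by rw [h]; rfl
    have h2 : (e i).fst =ᵐ[surf m n] 0 := by
      rw [EventuallyEq, Filter.Eventually, ← hν]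
      exact (Lp.eq_zero_iff_ae_eq_zero).mp h1
    exact Phi_ne_zero hm hn i (Continuous.ae_eq_iff_eq (surf m n) (continuous_Phi i)
      continuous_zero |>.mp ((he i).1.symm.trans h2))
  · rw [hin i _ (heH j)]
    refine mul_eq_zero_of_right _ ?_
    rw [← integral_Phi_mul_Phi hm hn hij.symm]
    refine integral_congr_ae ?_
    filter_upwards [(he j).1] with z hz
    rw [hz]
  · have hmem : MemLp p.fst 2 (surf m n) := by
      have := (Lp.memLp p.fst).smul_measure (c := (ENNReal.ofReal (aConst N s))⁻¹)
        (ENNReal.inv_ne_top.mpr hA')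
      rwa [smul_smul, ENNReal.inv_mul_cancel hA' ENNReal.ofReal_ne_top, one_smul] at this
    have h1 : p.fst =ᵐ[surf m n] 0 := by
      refine ae_eq_zero_of_integral_mul_Phi hm hn hmem hp.2 fun i => ?_
      have := h i
      rw [hin i p hp.1] at this
      exact (mul_eq_zero.mp this).resolve_left (symbol_pos hN hs0 hs _).ne'
    have h2 : p.fst = 0 := by
      rw [Lp.eq_zero_iff_ae_eq_zero, EventuallyEq, Filter.Eventually, hν]
      exact h1
    have h3 : p.snd = 0 := by
      rw [Lp.eq_zero_iff_ae_eq_zero]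
      filter_upwards [snd_ae_eq_of_mem_Hs hA hp.1, ae_gagliardo_of_ae h1] with q hq hq'
      rw [hq, hq'.1, hq'.2]
      simp
    exact WithLp.ofLp_injective 2 (Prod.ext h2 h3)

end SobolevFractional

end

end SphereJacobi

/-! ### Assembly of the theorem -/

theorem mainTheorem5 (N : ℕ) (hN : 3 ≤ N) :
    (∀ (m n : ℕ) [Fact (m + n = N + 1)], 2 ≤ m → 2 ≤ n →
      -- orthogonal basis of the invariant square integrable functions
      (∃ e : ℕ → L2 m n,
        (∀ i, e i =ᵐ[surf m n] Phi m n i) ∧ IsOrthogonalBasis e (L2G m n)) ∧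
      -- orthogonal basis of the invariant functions of the first-order Sobolev space
      (∃ e : ℕ → H1Pair m n,
        (∀ i, RepresentsH1 (Phi m n i) (e i)) ∧ IsOrthogonalBasis e (H1G N m n)) ∧
      -- smooth invariant eigenfunctions of the Laplace-Beltrami operator
      (∀ i, IsCk N ∞ (Phi m n i) ∧ GInvariant (Phi m n i) ∧ Phi m n i ≠ 0 ∧
        LaplaceEigen (lam N i) (Phi m n i)) ∧
      -- the eigenvalues are distinct and simple, and there are no others
      StrictMono (lam N) ∧
      (∀ (i : ℕ) (u : Sph m n → ℝ),
        IsCk N 2 u → GInvariant u → LaplaceEigen (lam N i) u → ∃ a : ℝ, u = a • Phi m n i) ∧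
      (∀ (μ : ℝ) (u : Sph m n → ℝ),
        IsCk N 2 u → GInvariant u → u ≠ 0 → LaplaceEigen μ u → ∃ i, μ = lam N i)) ∧
    (∀ s : ℝ, 0 < s → s < 1 → ∃ φ : ℝ → ℝ,
      -- two-sided bound for the symbol
      (∃ C : ℝ, 1 < C ∧ ∀ i : ℕ,
        C⁻¹ * (1 + lam N i ^ s) ≤ φ (lam N i) ∧ φ (lam N i) ≤ C * (1 + lam N i ^ s)) ∧
      ∀ (m n : ℕ) [Fact (m + n = N + 1)], 2 ≤ m → 2 ≤ n →
        -- `φ` is the symbol of the conformal fractional Laplacian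
        (∀ (μ : ℝ) (u : Sph m n → ℝ), IsCk N ∞ u → LaplaceEigen μ u →
          ∀ z, HasConfFracLaplacianAt N s u z (φ μ * u z)) ∧
        -- in particular for the functions `Φ_i`
        (∀ i z, HasConfFracLaplacianAt N s (Phi m n i) z (φ (lam N i) * Phi m n i z)) ∧
        -- orthogonal basis of the invariant functions of the fractional Sobolev space
        (∃ e : ℕ → HsPair N m n s,
          (∀ i, RepresentsHs (Phi m n i) (e i)) ∧ IsOrthogonalBasis e (HsG N m n s))) := by
  have hN1 : 1 ≤ N := by omega
  have hN2 : 2 ≤ N := by omega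
  -- The symbol is fixed before `m` and `n` are introduced.
  refine ⟨fun m n _ hm hn => ?_, fun s hs0 hs => ⟨symbol N s, ?_, fun m n _ hm hn => ?_⟩⟩
  · have hm1 : 1 ≤ m := by omega
    have hn1 : 1 ≤ n := by omega
    exact ⟨exists_basis_L2 hm1 hn1, exists_basis_H1 hm1 hn1,
      fun i => ⟨isCk_Phi i, gInvariant_Phi i, Phi_ne_zero hm1 hn1 i, laplaceEigen_Phi hm1 hn1 i⟩,
      lam_strictMono hN1, fun i u hu hG he => eq_smul_Phi hm1 hn1 i hu hG he,
      fun μ u hu hG h0 he => exists_eq_lam hm1 hn1 hu hG h0 he⟩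
  · obtain ⟨C, hC, h⟩ := symbol_bounds hN2 hs0 hs
    -- The invariant eigenvalues are those of even degree `2 * i`.
    exact ⟨C, hC, fun i => by simpa only [lam_eq_ev] using h (2 * i)⟩
  · have hm1 : 1 ≤ m := by omega
    have hn1 : 1 ≤ n := by omega
    exact ⟨fun μ u hu he => hasConfFracLaplacianAt hN2 hs0 hs (hu.of_le two_le_infty) he,
      fun i => hasConfFracLaplacianAt hN2 hs0 hs (isCk_Phi i) (laplaceEigen_Phi hm1 hn1 i),
      exists_basis_Hs hN2 hm1 hn1 hs0 hs⟩
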